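/- Let $c>0$, $\varepsilon>0$, and let $\xi\in\mathcal I_\varepsilon=[-\frac{c^2}{2}+\varepsilon,\ \frac{c^2}{3}-\varepsilon]$. Let $a=a(\xi)\in(0,c)$ be defined by $$\int_0^{\mathrm i a}\Big(k^2+\xi+\tfrac{c^2-a^2}{2}\Big)\sqrt{\tfrac{k^2+a^2}{k^2+c^2}}\,dk=0,$$ and let $\Lambda\in\mathbb R$, $\tilde\Lambda=\frac{\Lambda}{2\pi}$, $\sigma_1=\begin{pmatrix}0&1\\1&0\end{pmatrix}$, $\mathcal G=\{\mathrm i c,\mathrm i a,-\mathrm i a,-\mathrm i c\}$. The segment $[\mathrm i c,-\mathrm i c]$ is oriented from top to bottom, and $f_+$, $f_-$ denote the limits on it from the right and from the left half plane. Let $w(k)=\sqrt{(k^2+c^2)(k^2+a^2)}$ on $\mathbb C\setminus([\mathrm i c,\mathrm i a]\cup[-\mathrm i a,-\mathrm i c])$ with $w(0)>0$ (the upper sheet of the Riemann surface of $w$). Put $\Gamma=\big(\int_{\mathbf a}\frac{d\zeta}{w}\big)^{-1}=\big(2\int_{\mathrm i a}^{-\mathrm i a}\frac{d\zeta}{w}\big)^{-1}$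 and $\tau=\int_{\mathbf b}\Gamma\frac{d\zeta}{w}$, where $\mathbf b$ encircles $[\mathrm i a,\mathrm i c]$ counterclockwise on the upper sheet. Let $A(k)=\int_{\mathrm i c}^k\Gamma\frac{d\zeta}{w}$ along paths on the upper sheet avoiding $[\mathrm i c,-\mathrm i c]$, and $\theta_3(z\,|\,\tau)=\sum_{n\in\mathbb Z}e^{(n^2\tau+2nz)\pi\mathrm i}$. Put $$\tilde\gamma(k)=\sqrt[4]{\tfrac{k^2+a^2}{k^2+c^2}}\ \ (\tilde\gamma(0)>0),\qquad \gamma(k)=\tilde\gamma(k)\sqrt{\tfrac ca},$$ $$\mu(k)=\frac{\theta_3(A(k)-\frac14-\tilde\Lambda\,|\,\tau)}{\theta_3(A(k)-\frac14\,|\,\tau)},\quad \nu(k)=\frac{\theta_3(-A(k)-\frac14-\tilde\Lambda\,|\,\tau)}{\theta_3(-A(k)-\frac14\,|\,\tau)},\quad \tilde\mu(k)=\mu(-k),\quad\tilde\nu(k)=\nu(-k),$$ $$M^{\rm mod}(k)=\begin{pmatrix}(\gamma(k)+\gamma^{-1}(k))\mu(k)&(\gamma(k)-\gamma^{-1}(k))\nu(k)\\(\gamma(k)-\gamma^{-1}(k))\tilde\nu(k)&(\gamma(k)+\gamma^{-1}(k))\tilde\mu(k)\end{pmatrix},\qquad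 k\in\mathbb C\setminus[\mathrm i c,-\mathrm i c].$$ Let $v^{\rm mod}$ be $\mathrm i\sigma_1$ on $(\mathrm i c,\mathrm i a)$, $-\mathrm i\sigma_1$ on $(-\mathrm i a,-\mathrm i c)$, and $\mathrm{diag}(e^{-\mathrm i\Lambda},e^{\mathrm i\Lambda})$ on $(\mathrm i a,-\mathrm i a)$. The vector model problem asks for $m=(m_1,m_2)$, holomorphic in $\mathbb C\setminus[\mathrm i c,-\mathrm i c]$, continuous up to the boundary except at $\mathcal G$, with $m_+=m_-v^{\rm mod}$, $m(-k)=m(k)\sigma_1$, $m(k)\to(1,1)$ as $k\to\infty$, and $m(k)=O((k-\kappa)^{-1/4})$ as $k\to\kappa\in\mathcal G$. Put also $$m^{\rm mod}(k)=\Big(\tilde\gamma(k)\frac{\hat\alpha(k)}{\hat\alpha(\infty)},\ \tilde\gamma(k)\frac{\hat\beta(k)}{\hat\beta(\infty)}\Big),\quad \hat\alpha=\frac{\theta_3(2A-\frac12-\tilde\Lambda\,|\,2\tau)}{\theta_3(2A-\frac12\,|\,2\tau)},\quad \hat\beta=\frac{\theta_3(-2A+\frac12-\tilde\Lambda\,|\,2\tau)}{\theta_3(-2A+\frac12\,|\,2\tau)}.$$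 Then: 1. $M^{\rm mod}$ is holomorphic in $\mathbb C\setminus[\mathrm i c,-\mathrm i c]$, has continuous boundary values on the segment outside $\mathcal G$, and satisfies $M^{\rm mod}_+=M^{\rm mod}_-v^{\rm mod}$ there. 2. $M^{\rm mod}(k)=\sigma_1M^{\rm mod}(-k)\sigma_1$. 3. $M^{\rm mod}(k)=O((k-\kappa)^{-1/4})$ as $k\to\kappa\in\mathcal G$. 4. The determinant does not depend on $k$: $$\det M^{\rm mod}(k)=4\,\frac{\theta_3(\frac\tau2-\tilde\Lambda\,|\,\tau)\,\theta_3(-\frac\tau2-\tilde\Lambda\,|\,\tau)}{\theta_3(\frac\tau2\,|\,\tau)^2}.$$ 5. $\det M^{\rm mod}(k)=0$ if and only if $\Lambda=\pi(2n+1)$ for some $n\in\mathbb Z$. 6. The limits $\mu(\infty)$, $\nu(\infty)$ of $\mu$, $\nu$ as $k\to\infty$ exist, are real, and are positive uniformly in $\Lambda\in\mathbb R$ and $\xi\in\mathcal I_\varepsilon$: there is a constant $C>0$ depending only on $c$ and $\varepsilon$ with $\mu(\infty)\ge C$, $\nu(\infty)\ge C$. 7. The vector model problem has exactly one solution. It is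 the function $m^{\rm mod}$, and $$m^{\rm mod}(k)=\frac{\sqrt{ac}}{(c+a)\mu(\infty)+(c-a)\nu(\infty)}\,(1,1)\,M^{\rm mod}(k).$$ -/

import Mathlib

open Filter Topology Asymptotics

noncomputable section

namespace KdVModel

/-- The plane cut along the vertical segment from `i c` to `-i c`. -/
def cutPlane (c : ℝ) : Set ℂ := {k | ¬ (k.re = 0 ∧ |k.im| ≤ c)}

/-- The four exceptional points `± i a`, `± i c`. -/
def nodes (c a : ℝ) : Set ℂ :=
  {Complex.I * c, Complex.I * a, -(Complex.I * a), -(Complex.I * c)}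

/-- `f₊(i y) = p` and `f₋(i y) = q`, as full one-sided limits. The imaginary axis is oriented from
top to bottom, so its `+` side is the right half plane and its `-` side the left one. -/
def HasBoundaryValues {E : Type*} [TopologicalSpace E] (f : ℂ → E) (y : ℝ) (p q : E) : Prop :=
  Tendsto f (𝓝[{z : ℂ | 0 < z.re}] (Complex.I * y)) (𝓝 p) ∧
  Tendsto f (𝓝[{z : ℂ | z.re < 0}] (Complex.I * y)) (𝓝 q)

/-- `a ∈ (0, c)` is the band edge that belongs to `ξ`:
`∫₀^{ia} (k² + ξ + (c² - a²)/2) √((k² + a²)/(k² + c²)) dk = 0`, written with `k = i s`. -/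
def IsBandEdge (c ξ a : ℝ) : Prop :=
  0 < a ∧ a < c ∧
    ∫ s in (0 : ℝ)..a,
      (-s ^ 2 + ξ + (c ^ 2 - a ^ 2) / 2) * √((a ^ 2 - s ^ 2) / (c ^ 2 - s ^ 2)) = 0

/-- `w(k) = √((k² + c²)(k² + a²))`, cut along `[ia, ic] ∪ [-ic, -ia]`, with `w(0) = a c > 0`. The
quotient under the principal root is negative or zero, or has a pole, only on the two cuts, so this
is the holomorphic branch on the complement of the cuts (the upper sheet). -/
def w (c a : ℝ) (k : ℂ) : ℂ :=
  (k ^ 2 + (c : ℂ) ^ 2) * ((k ^ 2 + (a : ℂ) ^ 2) / (k ^ 2 + (c : ℂ) ^ 2)) ^ (1 / 2 : ℂ)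

/-- The boundary value `w₊(i s)` from the right half plane, for `a < s < c`. -/
def wPlus (c a s : ℝ) : ℂ := Complex.I * (√((c ^ 2 - s ^ 2) * (s ^ 2 - a ^ 2)) : ℝ)

/-- `Γ = (∫_𝐚 dζ / w)⁻¹`. The `𝐚`-cycle runs from `i a` to `-i a` on the upper sheet and back on
the lower sheet, where `w` changes sign, so its period is twice the integral over the upper sheet
(parametrized by `ζ = -i s`). -/
def Gam (c a : ℝ) : ℂ :=
  (2 * ∫ s in (-a)..a, (-Complex.I) / w c a (-Complex.I * (s : ℂ)))⁻¹

/-- `τ = ∫_𝐛 Γ dζ / w`. The `𝐛`-cycle is the counterclockwise loop around `[ia, ic]` on the upper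
sheet, shrunk to the cut: up along the right side, and down along the left side, where `w` has the
opposite value, so that both sides contribute equally. -/
def tau (c a : ℝ) : ℂ :=
  Gam c a * (2 * ∫ s in a..c, Complex.I / wPlus c a s)

/-- The value of the Abel map at infinity of the upper sheet: `∫_{ic}^{i∞} Γ dζ / w`. -/
def abelInfty (c a : ℝ) : ℂ :=
  Gam c a * ∫ s in Set.Ioi c, Complex.I / w c a (Complex.I * (s : ℂ))

/-- The Abel map `A(k) = ∫_{ic}^k Γ dζ / w` on the upper sheet along paths which avoid
`[ic, -ic]`. The path goes from `i c` to infinity along the imaginary axis and comes back to `k`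
along the ray `ζ = s k`, `s ∈ [1, ∞)`, which avoids `[ic, -ic]` for every `k ∈ cutPlane c`. Infinity
is a regular point of the upper sheet, where the differential is holomorphic. -/
def abel (c a : ℝ) (k : ℂ) : ℂ :=
  abelInfty c a - Gam c a * ∫ s in Set.Ioi (1 : ℝ), k / w c a ((s : ℂ) * k)

/-- `θ₃(z | τ) = ∑ₙ exp((n² τ + 2 n z) π i)`. -/
def theta (z t : ℂ) : ℂ := jacobiTheta₂ z t

/-- `Λ / (2 π)`. -/
def lamTilde (Λ : ℝ) : ℂ := ((Λ / (2 * Real.pi) : ℝ) : ℂ)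

/-- `γ̃(k) = ((k² + a²)/(k² + c²))^{1/4}`, cut along `[ia, ic] ∪ [-ic, -ia]`, `γ̃(0) > 0`. -/
def gammaTilde (c a : ℝ) (k : ℂ) : ℂ :=
  ((k ^ 2 + (a : ℂ) ^ 2) / (k ^ 2 + (c : ℂ) ^ 2)) ^ (1 / 4 : ℂ)

/-- `γ(k) = γ̃(k) √(c / a)`, so that `γ(0) = 1`. -/
def gam (c a : ℝ) (k : ℂ) : ℂ := gammaTilde c a k * (√(c / a) : ℝ)

/-- `μ(k) = θ₃(A(k) - 1/4 - Λ/(2π) | τ) / θ₃(A(k) - 1/4 | τ)`. -/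
def mu (c a Λ : ℝ) (k : ℂ) : ℂ :=
  theta (abel c a k - 1 / 4 - lamTilde Λ) (tau c a) / theta (abel c a k - 1 / 4) (tau c a)

/-- `ν(k) = θ₃(-A(k) - 1/4 - Λ/(2π) | τ) / θ₃(-A(k) - 1/4 | τ)`. -/
def nu (c a Λ : ℝ) (k : ℂ) : ℂ :=
  theta (-abel c a k - 1 / 4 - lamTilde Λ) (tau c a) / theta (-abel c a k - 1 / 4) (tau c a)

/-- The matrix `M^mod`. -/
def matMod (c a Λ : ℝ) (k : ℂ) : Matrix (Fin 2) (Fin 2) ℂ :=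
  !![(gam c a k + (gam c a k)⁻¹) * mu c a Λ k, (gam c a k - (gam c a k)⁻¹) * nu c a Λ k;
     (gam c a k - (gam c a k)⁻¹) * nu c a Λ (-k), (gam c a k + (gam c a k)⁻¹) * mu c a Λ (-k)]

/-- `σ₁`. -/
def sigma1 : Matrix (Fin 2) (Fin 2) ℂ := !![0, 1; 1, 0]

/-- The jump matrix `v^mod` at the point `i y`, for `|y| < c`, `|y| ≠ a`. -/
def vMod (a Λ y : ℝ) : Matrix (Fin 2) (Fin 2) ℂ :=
  if a < y then !![0, Complex.I; Complex.I, 0]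
  else if y < -a then !![0, -Complex.I; -Complex.I, 0]
  else !![Complex.exp (-(Complex.I * Λ)), 0; 0, Complex.exp (Complex.I * Λ)]

/-- `m` solves the vector model problem. -/
structure IsVectorModelSolution (c a Λ : ℝ) (m : ℂ → Fin 2 → ℂ) : Prop where
  holomorphic : DifferentiableOn ℂ m (cutPlane c)
  jump : ∀ y : ℝ, |y| < c → |y| ≠ a →
    ∃ p q : Fin 2 → ℂ, HasBoundaryValues m y p q ∧ p = Matrix.vecMul q (vMod a Λ y)
  symmetric : ∀ k ∈ cutPlane c, m (-k) = Matrix.vecMul (m k) sigma1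
  normalized : Tendsto m (cocompact ℂ) (𝓝 ![1, 1])
  singular : ∀ κ ∈ nodes c a,
    m =O[𝓝[cutPlane c] κ] fun k => ‖k - κ‖ ^ (-(1 / 4) : ℝ)

/-- `α̂(k) = θ₃(2A(k) - 1/2 - Λ/(2π) | 2τ) / θ₃(2A(k) - 1/2 | 2τ)`, in terms of the value
`A = A(k)`. -/
def alphaHat (c a Λ : ℝ) (A : ℂ) : ℂ :=
  theta (2 * A - 1 / 2 - lamTilde Λ) (2 * tau c a) / theta (2 * A - 1 / 2) (2 * tau c a)

/-- `β̂(k) = θ₃(-2A(k) + 1/2 - Λ/(2π) | 2τ) / θ₃(-2A(k) + 1/2 | 2τ)`, in terms of the value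
`A = A(k)`. -/
def betaHat (c a Λ : ℝ) (A : ℂ) : ℂ :=
  theta (-2 * A + 1 / 2 - lamTilde Λ) (2 * tau c a) / theta (-2 * A + 1 / 2) (2 * tau c a)

/-- The vector model solution `m^mod(k) = (γ̃(k) α̂(k)/α̂(∞), γ̃(k) β̂(k)/β̂(∞))`. -/
def vecMod (c a Λ : ℝ) (k : ℂ) : Fin 2 → ℂ :=
  ![gammaTilde c a k * (alphaHat c a Λ (abel c a k) / alphaHat c a Λ (abelInfty c a)),
    gammaTilde c a k * (betaHat c a Λ (abel c a k) / betaHat c a Λ (abelInfty c a))]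

/-- The vector function `√(ac) / ((c + a) μ∞ + (c - a) ν∞) · (1, 1) M^mod(k)`. -/
def rowMod (c a Λ μ ν : ℝ) (k : ℂ) : Fin 2 → ℂ :=
  ((√(a * c) / ((c + a) * μ + (c - a) * ν) : ℝ) : ℂ) •
    Matrix.vecMul ![1, 1] (matMod c a Λ k)

end KdVModel

end

namespace KdVModel

/-! Put B = A - 1/4. Since A(∞) = 1/4, B is odd and vanishes at infinity. On the segment its
one-sided limits satisfy B₊ = B₋ - τ in the gap and B₊ = ∓1/2 - B₋ on the upper and lower band,
while γ₊ = γ₋ in the gap and γ₊ = ±iγ₋ on the bands. The entries of M are γ ± γ⁻¹ times the quotient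
θ₃(z - Λ/2π)/θ₃(z) at z = ±B or ±B - 1/2. This quotient has period 1 and is multiplied by exp(iΛ)
under z ↦ z + τ, so the jump relation is pure algebra (`matPhi_upper`, `matPhi_lower`,
`matPhi_gap`).

Regularity needs the zeros of θ₃. A Fourier argument shows that quasi-periodicity determines θ₃ up
to a constant, which yields the product formula. Hence the zeros are exactly the points 1/2 + τ/2 +
ℤ + τℤ, and 1/2 + τ/2 is a simple one. The map B stays in the strip |Im B| < Im τ/2
(`abs_im_abelRed_lt`), so no denominator vanishes off the segment. On the segment one vanishes only
at k = 0, where the factor γ - γ⁻¹ is o(k) and wins.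

Everything global rests on one principle, `exists_eq_const`: an even function on the cut plane
without jumps, with singularities of order at most -1/2 at finitely many points and with growth
o(k²), is constant. Applied to det M it leaves one evaluation, at k = 0, where M is diagonal.

For uniqueness, let m and n be two solutions. The principle gives (m₁n₂ + m₂n₁)w = 2k² + const, and
it makes k(m₁n₂ - m₂n₁) constant, hence zero. The symmetric forms of the pairs (m,m), (n,n), (m,n)
then satisfy a polynomial identity, which forces their three constants to agree, and m = n follows.
The multiple of (1,1)M and m^mod both solve the vector problem, so they coincide without any
identity between theta functions of moduli τ and 2τ being proved.

That m^mod has the right singularities at ±ia uses the principle once more. It gives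
(θ₃(2B|2τ)/θ₃(1/2 - 2B|2τ))² k² = r(k² + a²) with r ≠ 0 (`exists_thetaRatioSq_eq`), so the
denominator vanishes like a square root, and the quarter-order zero of γ̃ reduces the resulting pole
to order -1/4.

For the uniform positivity, the values at infinity are theta quotients at real points. There the two
halves of the product are complex conjugate, so the quotient is positive, with a lower bound that
depends only on a lower bound for Im τ. Such a bound holds once c - a is bounded below: if a
approached c, the root in the band edge equation would tend to 1 and the equation would force ξ
towards c²/3, which is excluded by ξ ≤ c²/3 - ε. Small a does no harm, since c - a is then large. -/

/-! ### Functions without jumps on the segment, and Liouville's theorem -/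

open Complex Set MeasureTheory in
/-- A continuous function on an open set which is holomorphic off the imaginary axis is
holomorphic. -/
theorem differentiableOn_of_continuousOn_of_off_imaginary_axis {U : Set ℂ} (hU : IsOpen U)
    {f : ℂ → ℂ} (hc : ContinuousOn f U) (hd : ∀ z ∈ U, z.re ≠ 0 → DifferentiableAt ℂ f z) :
    DifferentiableOn ℂ f U := by
  rw [← isConservativeOn_and_continuousOn_iff_isDifferentiableOn hU]
  refine ⟨?_, hc⟩
  intro z w hzw
  rw [← add_eq_zero_iff_eq_neg, wedgeIntegral_add_wedgeIntegral_eq]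
  -- A rectangle whose interior misses the axis is covered by Cauchy's theorem with mere continuity
  -- on the boundary. By Morera, only rectangles that straddle the axis remain.
  have key : ∀ z w : ℂ, Rectangle z w ⊆ U → (0 : ℝ) ∉ Ioo (min z.re w.re) (max z.re w.re) →
      (∫ x : ℝ in z.re..w.re, f (x + z.im * I)) - (∫ x : ℝ in z.re..w.re, f (x + w.im * I)) +
      I • (∫ y : ℝ in z.im..w.im, f (w.re + y * I)) -
      I • (∫ y : ℝ in z.im..w.im, f (z.re + y * I)) = 0 := by
    intro z w hzw h0
    refine integral_boundary_rect_eq_zero_of_continuousOn_of_differentiableOn f z w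
      (hc.mono hzw) ?_
    intro x hx
    refine (hd x (hzw ?_) ?_).differentiableWithinAt
    · exact ⟨Ioo_subset_Icc_self hx.1, Ioo_subset_Icc_self hx.2⟩
    · intro h
      apply h0
      rw [← h]
      exact hx.1
  by_cases h0 : (0 : ℝ) ∈ Ioo (min z.re w.re) (max z.re w.re)
  swap
  · exact key z w hzw h0
  have h0' : (0 : ℝ) ∈ uIcc z.re w.re := Ioo_subset_Icc_self h0
  -- The rectangle is cut along the axis. Each half has the axis only as an edge, and the two
  -- integrals along that edge cancel.
  have e1 := key z (w.im * I) (by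
    refine Subset.trans ?_ hzw
    intro x hx
    refine ⟨?_, ?_⟩
    · have := hx.1
      simp only [mul_re, ofReal_re, I_re, mul_zero, ofReal_im, I_im, mul_one, sub_self,
        mem_preimage] at this
      exact uIcc_subset_uIcc left_mem_uIcc h0' this
    · simpa using hx.2) (by
      simp only [mul_re, ofReal_re, I_re, mul_zero, ofReal_im, I_im, mul_one, sub_self, mem_Ioo,
        not_and, not_lt]
      intro h
      rcases le_total z.re 0 with h1 | h1
      · rw [max_eq_right h1]
      · rw [min_eq_right h1] at h; exact absurd h (lt_irrefl _))
  have e2 := key (z.im * I) w (by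
    refine Subset.trans ?_ hzw
    intro x hx
    refine ⟨?_, ?_⟩
    · have := hx.1
      simp only [mul_re, ofReal_re, I_re, mul_zero, ofReal_im, I_im, mul_one, sub_self,
        mem_preimage] at this
      exact uIcc_subset_uIcc h0' right_mem_uIcc this
    · simpa using hx.2) (by
      simp only [mul_re, ofReal_re, I_re, mul_zero, ofReal_im, I_im, mul_one, sub_self, mem_Ioo,
        not_and, not_lt]
      intro h
      rcases le_total w.re 0 with h1 | h1
      · rw [max_eq_left h1]
      · rw [min_eq_left h1] at h; exact absurd h (lt_irrefl _))
  have hint : ∀ b ∈ uIcc z.im w.im, ∀ a₁ ∈ uIcc z.re w.re, ∀ a₂ ∈ uIcc z.re w.re,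
      IntervalIntegrable (fun x : ℝ => f (x + b * I)) volume a₁ a₂ := by
    intro b hb a₁ h1 a₂ h2
    apply ContinuousOn.intervalIntegrable
    refine (hc.mono hzw).comp (by fun_prop) ?_
    intro x hx
    refine ⟨?_, ?_⟩
    · simpa using uIcc_subset_uIcc h1 h2 hx
    · simpa using hb
  have a1 := intervalIntegral.integral_add_adjacent_intervals
    (hint z.im left_mem_uIcc z.re left_mem_uIcc 0 h0')
    (hint z.im left_mem_uIcc 0 h0' w.re right_mem_uIcc)
  have a2 := intervalIntegral.integral_add_adjacent_intervals
    (hint w.im right_mem_uIcc z.re left_mem_uIcc 0 h0')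
    (hint w.im right_mem_uIcc 0 h0' w.re right_mem_uIcc)
  simp only [mul_re, ofReal_re, I_re, mul_zero, ofReal_im, I_im, mul_one, sub_self, mul_im,
    add_zero, ofReal_zero] at e1 e2
  rw [← a1, ← a2]
  linear_combination e1 + e2

theorem isOpen_cutPlane (c : ℝ) : IsOpen (cutPlane c) := by
  have : cutPlane c = {k : ℂ | k.re = 0 ∧ |k.im| ≤ c}ᶜ := rfl
  rw [this, isOpen_compl_iff]
  apply IsClosed.inter
  · exact isClosed_eq Complex.continuous_re continuous_const
  · exact isClosed_le (Complex.continuous_im.abs) continuous_const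

theorem mem_cutPlane_of_re_ne {c : ℝ} {k : ℂ} (h : k.re ≠ 0) : k ∈ cutPlane c :=
  fun h' => h h'.1

theorem nhdsWithin_right_neBot (y : ℝ) :
    (𝓝[{z : ℂ | 0 < z.re}] (Complex.I * y)).NeBot := by
  rw [← mem_closure_iff_nhdsWithin_neBot]
  rw [Complex.closure_setOfPred_lt_re]
  simp

theorem eq_I_mul_im {k : ℂ} (h : k.re = 0) : k = Complex.I * k.im := by
  apply Complex.ext <;> simp [h]

open Complex Set in
/-- Extension of a function without jump on the segment by its one-sided limits. -/
theorem exists_continuousOn_extension {c : ℝ} {f : ℂ → ℂ}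
    (hf : ContinuousOn f (cutPlane c)) {S : Set ℝ} (hS : S.Finite) (hc : c ∈ S)
    (hc' : -c ∈ S)
    (hb : ∀ y : ℝ, |y| < c → y ∉ S → ∃ p, HasBoundaryValues f y p p) :
    ∃ g : ℂ → ℂ, EqOn g f (cutPlane c) ∧ ContinuousOn g ((fun y : ℝ => I * y) '' S)ᶜ := by
  classical
  have hlt : ∀ y : ℝ, |y| ≤ c → y ∉ S → |y| < c := by
    intro y h1 h2
    refine lt_of_le_of_ne h1 ?_
    intro h
    rcases abs_eq_abs.1 (h.trans (abs_of_nonneg (h ▸ abs_nonneg y)).symm) with h | h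
    · exact h2 (h ▸ hc)
    · exact h2 (h ▸ hc')
  -- On the segment the right-hand limit is used; where there is no jump, the left-hand one is the
  -- same.
  let g : ℂ → ℂ := fun k =>
    if k ∈ cutPlane c then f k else limUnder (𝓝[{z : ℂ | 0 < z.re}] k) f
  have hg : EqOn g f (cutPlane c) := fun k hk => by simp [g, hk]
  have hlim : ∀ y : ℝ, |y| < c → y ∉ S → HasBoundaryValues f y (g (I * y)) (g (I * y)) := by
    intro y h1 h2
    obtain ⟨p, hp⟩ := hb y h1 h2
    have : g (I * y) = p := by
      have h3 : I * (y : ℂ) ∉ cutPlane c := by simp [cutPlane, h1.le]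
      simp only [g, h3, if_false]
      have := nhdsWithin_right_neBot y
      exact hp.1.limUnder_eq
    rw [this]
    exact hp
  refine ⟨g, hg, ?_⟩
  intro k hk
  apply ContinuousAt.continuousWithinAt
  by_cases hkc : k ∈ cutPlane c
  · have h1 : ContinuousAt f k := hf.continuousAt ((isOpen_cutPlane c).mem_nhds hkc)
    exact h1.congr (by
      filter_upwards [(isOpen_cutPlane c).mem_nhds hkc] with z hz using (hg hz).symm)
  · have hk0 : k.re = 0 ∧ |k.im| ≤ c := not_not.1 hkc
    obtain ⟨y, rfl⟩ : ∃ y : ℝ, k = I * y := ⟨k.im, eq_I_mul_im hk0.1⟩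
    have hyS : y ∉ S := fun h => hk ⟨y, h, rfl⟩
    have hy : |y| < c := hlt y (by simpa using hk0.2) hyS
    have hl := hlim y hy hyS
    -- Closed neighbourhoods are needed because the value at a nearby point of the segment is itself
    -- a limit of values in V.
    rw [ContinuousAt, (closed_nhds_basis (g (I * y))).tendsto_right_iff]
    rintro V ⟨hV, hVc⟩
    have h1 : ∀ᶠ z in 𝓝 (I * (y : ℂ)), 0 < z.re → f z ∈ V :=
      eventually_nhdsWithin_iff.1 (hl.1.eventually_mem hV)
    have h2 : ∀ᶠ z in 𝓝 (I * (y : ℂ)), z.re < 0 → f z ∈ V :=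
      eventually_nhdsWithin_iff.1 (hl.2.eventually_mem hV)
    have h3 : ∀ᶠ z in 𝓝 (I * (y : ℂ)), |z.im| < c ∧ z.im ∉ S := by
      have : Tendsto Complex.im (𝓝 (I * (y : ℂ))) (𝓝 y) := by
        have := Complex.continuous_im.tendsto (I * (y : ℂ))
        simpa using this
      refine this.eventually (p := fun t => |t| < c ∧ t ∉ S) ?_
      apply Filter.Eventually.and
      · exact (continuous_abs.tendsto y).eventually (gt_mem_nhds hy)
      · exact hS.isClosed.isOpen_compl.mem_nhds hyS
    filter_upwards [h1.eventually_nhds, h2, h3] with z hz1 hz2 hz3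
    rcases lt_trichotomy z.re 0 with h | h | h
    · rw [hg (mem_cutPlane_of_re_ne h.ne)]; exact hz2 h
    · have hz : z = I * z.im := eq_I_mul_im h
      have hl' := (hlim z.im hz3.1 hz3.2).1
      rw [← hz] at hl'
      have := nhdsWithin_right_neBot z.im
      rw [← hz] at this
      exact hVc.mem_of_tendsto hl' (eventually_nhdsWithin_iff.2 hz1)
    · rw [hg (mem_cutPlane_of_re_ne h.ne')]; exact hz1.self_of_nhds h

open Complex Set in
/-- A function which is holomorphic off the segment, has no jump on it and at most weak singularities
at finitely many points of the segment extends to an entire function. -/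
theorem exists_entire_extension {c : ℝ} {f : ℂ → ℂ}
    (hf : DifferentiableOn ℂ f (cutPlane c)) {S : Set ℝ} (hS : S.Finite) (hc : c ∈ S)
    (hc' : -c ∈ S)
    (hb : ∀ y : ℝ, |y| < c → y ∉ S → ∃ p, HasBoundaryValues f y p p)
    (hs : ∀ y ∈ S, f =O[𝓝[cutPlane c] (I * y)] fun k => ‖k - I * y‖ ^ (-(1 / 2) : ℝ)) :
    ∃ F : ℂ → ℂ, Differentiable ℂ F ∧ EqOn F f (cutPlane c) := by
  classical
  obtain ⟨g, hg, hgc⟩ := exists_continuousOn_extension hf.continuousOn hS hc hc' hb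
  set T : Set ℂ := (fun y : ℝ => I * y) '' S with hT
  have hTf : T.Finite := hS.image _
  have hTo : IsOpen Tᶜ := hTf.isClosed.isOpen_compl
  have hgd : DifferentiableOn ℂ g Tᶜ := by
    apply differentiableOn_of_continuousOn_of_off_imaginary_axis hTo hgc
    intro z _ hz
    have h1 : DifferentiableAt ℂ f z :=
      hf.differentiableAt ((isOpen_cutPlane c).mem_nhds (mem_cutPlane_of_re_ne hz))
    apply h1.congr_of_eventuallyEq
    filter_upwards [(isOpen_cutPlane c).mem_nhds (mem_cutPlane_of_re_ne hz)] with x hx using hg hx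
  -- The growth bound is given on the cut plane only; it passes to the points of the segment by
  -- continuity of both sides.
  have hbound : ∀ y ∈ S, ∃ C : ℝ, ∀ᶠ z in 𝓝[≠] (I * (y : ℂ)),
      ‖g z‖ ≤ C * ‖z - I * y‖ ^ (-(1 / 2) : ℝ) := by
    intro y hy
    obtain ⟨C, hC⟩ := (hs y hy).bound
    refine ⟨C, ?_⟩
    rw [eventually_nhdsWithin_iff] at hC ⊢
    have hiso : ∀ᶠ z in 𝓝 (I * (y : ℂ)), z ≠ I * y → z ∈ Tᶜ := by
      have : IsClosed (T \ {I * (y : ℂ)}) := (hTf.subset sdiff_subset).isClosed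
      filter_upwards [this.isOpen_compl.mem_nhds (by simp)] with z hz hne hzT
      exact hz ⟨hzT, hne⟩
    filter_upwards [hC.eventually_nhds, hiso] with z hz hz' hne
    have hzT : z ∈ Tᶜ := hz' hne
    by_cases hzc : z ∈ cutPlane c
    · rw [hg hzc]
      have := hz.self_of_nhds hzc
      rwa [Real.norm_of_nonneg (by positivity)] at this
    · have hz0 : z = I * z.im := eq_I_mul_im (not_not.1 hzc).1
      have := nhdsWithin_right_neBot z.im
      rw [← hz0] at this
      have hcont : ContinuousAt g z := hgc.continuousAt (hTo.mem_nhds hzT)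
      have hcont2 : ContinuousAt (fun z => C * ‖z - I * y‖ ^ (-(1 / 2) : ℝ)) z := by
        apply ContinuousAt.mul continuousAt_const
        apply ContinuousAt.rpow_const
        · fun_prop
        · left; simpa [sub_eq_zero] using hne
      refine le_of_tendsto_of_tendsto (hcont.norm.mono_left nhdsWithin_le_nhds)
        (hcont2.mono_left nhdsWithin_le_nhds)
        (b := 𝓝[{z : ℂ | 0 < z.re}] z) ?_
      rw [EventuallyLE, eventually_nhdsWithin_iff]
      filter_upwards [hz] with x hx hx0
      have hxc : x ∈ cutPlane c := mem_cutPlane_of_re_ne (ne_of_gt hx0)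
      have := hx hxc
      rw [Real.norm_of_nonneg (by positivity)] at this
      simpa [hg hxc] using this
  let F : ℂ → ℂ := fun k => if k ∈ T then limUnder (𝓝[≠] k) g else g k
  have hFT : ∀ k ∉ T, F k = g k := fun k hk => by simp [F, hk]
  have hFd : Differentiable ℂ F := by
    intro k
    by_cases hk : k ∈ T
    · have hiso : (T \ {k})ᶜ ∈ 𝓝 k :=
        (hTf.subset sdiff_subset).isClosed.isOpen_compl.mem_nhds (by simp)
      obtain ⟨y, hy, rfl⟩ := hk
      have hupd : DifferentiableOn ℂ (Function.update g (I * y) (limUnder (𝓝[≠] (I * (y : ℂ))) g))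
          (T \ {I * (y : ℂ)})ᶜ := by
        apply differentiableOn_update_limUnder_of_isLittleO hiso
        · apply hgd.mono
          intro z hz hzT
          exact hz.1 ⟨hzT, hz.2⟩
        · obtain ⟨C, hC⟩ := hbound y hy
          have hz0 : Tendsto (fun z : ℂ => ‖z - I * y‖) (𝓝[≠] (I * (y : ℂ))) (𝓝 0) := by
            have : ContinuousAt (fun z : ℂ => ‖z - I * y‖) (I * (y : ℂ)) := by fun_prop
            have := this.tendsto
            simp only [sub_self, norm_zero] at this
            exact this.mono_left nhdsWithin_le_nhds
          have hinv : Tendsto (fun z : ℂ => ‖(z - I * y)⁻¹‖) (𝓝[≠] (I * (y : ℂ))) atTop := by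
            simp only [norm_inv]
            apply Tendsto.inv_tendsto_nhdsGT_zero
            refine tendsto_nhdsWithin_iff.2 ⟨hz0, ?_⟩
            filter_upwards [self_mem_nhdsWithin] with z hz
            simpa [sub_eq_zero] using hz
          -- Order -1/2 is weaker than a simple pole, which is exactly what the removable
          -- singularity theorem asks for.
          have h2 : g =o[𝓝[≠] (I * (y : ℂ))] fun z => (z - I * y)⁻¹ := by
            have h3 : g =O[𝓝[≠] (I * (y : ℂ))] fun z => ‖z - I * y‖ ^ (-(1 / 2) : ℝ) := by
              apply IsBigO.of_bound C
              filter_upwards [hC] with z hz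
              rwa [Real.norm_of_nonneg (by positivity : (0:ℝ) ≤ ‖z - I * y‖ ^ (-(1 / 2) : ℝ))]
            apply h3.trans_isLittleO
            have h4 : Tendsto (fun z : ℂ => ‖z - I * y‖ ^ (1 / 2 : ℝ)) (𝓝[≠] (I * (y : ℂ)))
                (𝓝 0) := by
              have := hz0.rpow_const (p := 1 / 2) (Or.inr (by norm_num))
              simpa using this
            have h5 : (fun z : ℂ => ‖z - I * y‖ ^ (-(1 / 2) : ℝ)) =ᶠ[𝓝[≠] (I * (y : ℂ))]
                fun z => ‖z - I * y‖ ^ (1 / 2 : ℝ) * ‖(z - I * y)⁻¹‖ := by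
              filter_upwards [self_mem_nhdsWithin] with z hz
              have : 0 < ‖z - I * y‖ := by simpa [sub_eq_zero] using hz
              rw [norm_inv, ← Real.rpow_neg_one, ← Real.rpow_add this]
              norm_num
            rw [← isLittleO_norm_right]
            refine h5.trans_isLittleO ?_
            have := (isLittleO_one_iff ℝ).2 h4
            simpa using this.mul_isBigO (isBigO_refl (fun z : ℂ => ‖(z - I * y)⁻¹‖) _)
          apply h2.sub
          rw [isLittleO_const_left]
          right
          exact hinv
      refine (hupd.differentiableAt hiso).congr_of_eventuallyEq ?_
      filter_upwards [hiso] with z hz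
      by_cases hzy : z = I * y
      · have h' : (I * (y : ℂ)) ∈ T := ⟨y, hy, rfl⟩
        simp [hzy, F, h']
      · have : z ∉ T := fun h => hz ⟨h, hzy⟩
        rw [hFT z this, Function.update_of_ne hzy]
    · refine (hgd.differentiableAt (hTo.mem_nhds hk)).congr_of_eventuallyEq ?_
      filter_upwards [hTo.mem_nhds hk] with z hz using hFT z hz
  refine ⟨F, hFd, ?_⟩
  have hopen : IsOpen (cutPlane c) := isOpen_cutPlane c
  intro k hk
  have hdense : Dense Tᶜ := hTf.countable.dense_compl ℝ
  -- The exceptional heights are not assumed to lie in [-c, c], so an exceptional point can belong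
  -- to the cut plane; there equality follows by density.
  by_cases hkT : k ∈ T
  · have h1 : ContinuousAt F k := (hFd k).continuousAt
    have h2 : ContinuousAt f k := hf.continuousOn.continuousAt (hopen.mem_nhds hk)
    have : (𝓝[Tᶜ] k).NeBot := mem_closure_iff_nhdsWithin_neBot.1 (hdense k)
    refine tendsto_nhds_unique (h1.mono_left (nhdsWithin_le_nhds (s := Tᶜ))) ?_
    refine (h2.mono_left (nhdsWithin_le_nhds (s := Tᶜ))).congr' ?_
    filter_upwards [self_mem_nhdsWithin, nhdsWithin_le_nhds (hopen.mem_nhds hk)] with z hz hz'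
    rw [hFT z hz, hg hz']
  · rw [hFT k hkT, hg hk]

open Complex Set in
/-- An even entire function which is `o(k²)` at infinity is constant. -/
theorem even_entire_eq_of_isLittleO_sq {F : ℂ → ℂ} (hF : Differentiable ℂ F)
    (heven : ∀ k, F (-k) = F k)
    (ho : F =o[cocompact ℂ] fun k => k ^ 2) (k : ℂ) : F k = F 0 := by
  have hd : ∀ {f : ℂ → ℂ}, Differentiable ℂ f → Differentiable ℂ (dslope f 0) := by
    intro f hf
    rw [← differentiableOn_univ] at hf ⊢
    exact (differentiableOn_dslope univ_mem).2 hf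
  have h0 : dslope F 0 0 = 0 := by
    rw [dslope_same]
    have h1 : HasDerivAt F (deriv F 0) 0 := (hF 0).hasDerivAt
    have h2 : HasDerivAt (fun k => F (-k)) (-deriv F 0) 0 := by
      have h3 : HasDerivAt F (deriv F 0) (-0) := by simpa using h1
      simpa [Function.comp_def] using h3.comp (0 : ℂ) (hasDerivAt_neg (0 : ℂ))
    have h4 : (fun k => F (-k)) = F := funext heven
    rw [h4] at h2
    have := h1.unique h2
    exact self_eq_neg.mp this
  -- Evenness kills the linear coefficient, so (F(k) - F(0))/k² is entire. It tends to zero at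
  -- infinity and therefore vanishes.
  have hval : ∀ k ≠ 0, dslope (dslope F 0) 0 k = (F k - F 0) / k ^ 2 := by
    intro k hk
    rw [dslope_of_ne _ hk, slope_def_field, h0, dslope_of_ne _ hk, slope_def_field]
    field_simp
    ring
  have hne : ∀ᶠ k : ℂ in cocompact ℂ, k ≠ 0 := by
    have := (isCompact_singleton (x := (0 : ℂ))).compl_mem_cocompact
    filter_upwards [this] with k hk using hk
  have hlim : Tendsto (dslope (dslope F 0) 0) (cocompact ℂ) (𝓝 0) := by
    have hc : (fun _ : ℂ => F 0) =o[cocompact ℂ] fun k : ℂ => k ^ 2 := by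
      rw [isLittleO_const_left]
      right
      have : Tendsto (fun k : ℂ => ‖k‖) (cocompact ℂ) atTop := tendsto_norm_cocompact_atTop
      simpa [Function.comp_def] using (tendsto_pow_atTop (two_ne_zero)).comp this
    have := (ho.sub hc).tendsto_div_nhds_zero
    refine this.congr' ?_
    filter_upwards [hne] with k hk using (hval k hk).symm
  by_cases hk : k = 0
  · rw [hk]
  · have := (hd (hd hF)).apply_eq_of_tendsto_cocompact k hlim
    rw [hval k hk, div_eq_zero_iff] at this
    rcases this with h | h
    · exact sub_eq_zero.1 h
    · exact absurd h (pow_ne_zero 2 hk)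

/-! ### The theta function is determined by its quasi-periodicity -/

open Complex Real in
/-- The `n`-th Fourier coefficient of a `1`-periodic entire function with the quasi-periodicity of
the theta function with modulus `i t`. -/
theorem fourier_integral_of_quasiPeriodic {t : ℝ} {f : ℂ → ℂ} (hf : Differentiable ℂ f)
    (h1 : ∀ z, f (z + 1) = f z) (h2 : ∀ z, f (z + I * t) = cexp (π * t - 2 * π * I * z) * f z)
    (n : ℤ) :
    ∫ x in (0 : ℝ)..1, cexp (-(2 * π * I * n * x)) * f x =
      cexp (-(π * t * n ^ 2)) * ∫ x in (0 : ℝ)..1, f x := by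
  -- Cauchy's theorem on the rectangle [0,1] × [0,t]: the vertical sides cancel by periodicity, and
  -- the multiplier turns the top side into the next coefficient.
  have key : ∀ n : ℤ, ∫ x in (0 : ℝ)..1, cexp (-(2 * π * I * n * x)) * f x =
      cexp (π * t * (2 * n + 1)) *
        ∫ x in (0 : ℝ)..1, cexp (-(2 * π * I * (n + 1 : ℤ) * x)) * f x := by
    intro n
    have hF := integral_boundary_rect_eq_zero_of_differentiableOn
      (fun z => cexp (-(2 * π * I * n * z)) * f z) 0 (1 + I * t) (by
        apply Differentiable.differentiableOn
        fun_prop)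
    simp only [zero_re, add_re, one_re, mul_re, I_re, ofReal_re, zero_mul, I_im, ofReal_im,
      mul_zero, sub_self, add_zero, zero_im, ofReal_zero, add_im, one_im, mul_im, one_mul,
      zero_add, ofReal_one] at hF
    have hp : ∀ y : ℝ, cexp (-(2 * π * I * n * (1 + y * I))) * f (1 + y * I) =
        cexp (-(2 * π * I * n * (y * I))) * f (y * I) := by
      intro y
      rw [add_comm (1 : ℂ), h1]
      congr 1
      rw [Complex.exp_eq_exp_iff_exists_int]
      exact ⟨-n, by push_cast; ring⟩
    simp only [hp, add_sub_cancel_right] at hF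
    rw [sub_eq_zero] at hF
    rw [hF, ← intervalIntegral.integral_const_mul]
    congr 1
    ext x
    rw [mul_comm (t : ℂ) I, h2, ← mul_assoc, ← mul_assoc, ← Complex.exp_add, ← Complex.exp_add]
    congr 2
    push_cast
    linear_combination (-2 * π * n * t : ℂ) * I_sq
  induction n using Int.induction_on with
  | zero => simp
  | succ n ih =>
    have := key n
    rw [ih] at this
    have h3 : cexp (π * t * (2 * (n : ℤ) + 1)) ≠ 0 := Complex.exp_ne_zero _
    apply mul_left_cancel₀ h3
    rw [← this, ← mul_assoc, ← Complex.exp_add]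
    congr 2
    push_cast
    ring
  | pred n ih =>
    have := key (-n - 1)
    rw [show (-(n : ℤ) - 1 + 1) = -n by ring, ih] at this
    rw [this, ← mul_assoc, ← Complex.exp_add]
    congr 2
    push_cast
    ring

-- The recursion makes the Fourier coefficients those of θ₃, up to the mean value as a common
-- factor. They are summable, so the Fourier series converges pointwise and can be compared term by
-- term.
open Complex Real in
theorem eqOn_real_of_quasiPeriodic {t : ℝ} (ht : 0 < t) {f : ℂ → ℂ} (hf : Differentiable ℂ f)
    (h1 : ∀ z, f (z + 1) = f z) (h2 : ∀ z, f (z + I * t) = cexp (π * t - 2 * π * I * z) * f z)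
    (x : ℝ) : f x = (∫ x in (0 : ℝ)..1, f x) * theta x (I * t) := by
  have hper : Function.Periodic (fun x : ℝ => f x) 1 := by
    intro x
    simp only [ofReal_add, ofReal_one]
    exact h1 _
  let F : C(UnitAddCircle, ℂ) := ⟨hper.lift, by
    apply continuous_coinduced_dom.mpr
    have : Continuous f := hf.continuous
    change Continuous fun x : ℝ => f x
    fun_prop⟩
  have hcoe : ∀ n, fourierCoeff F n = cexp (-(π * t * n ^ 2)) * ∫ x in (0 : ℝ)..1, f x := by
    intro n
    rw [fourierCoeff_eq_intervalIntegral _ _ 0, ← fourier_integral_of_quasiPeriodic hf h1 h2 n]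
    simp only [zero_add, div_one, one_smul]
    congr 1
    ext x
    have : F (x : UnitAddCircle) = f x := rfl
    rw [this, fourier_coe_apply, smul_eq_mul]
    congr 2
    push_cast
    ring
  have hτ : 0 < (I * (t : ℂ)).im := by simpa using ht
  have hs := (hasSum_jacobiTheta₂_term (x : ℂ) hτ).mul_left (∫ x in (0 : ℝ)..1, f x)
  have hterm : ∀ n : ℤ, (∫ x in (0 : ℝ)..1, f x) * jacobiTheta₂_term n x (I * t) =
      fourierCoeff F n * cexp (2 * π * I * n * x) := by
    intro n
    rw [hcoe, jacobiTheta₂_term, Complex.exp_add]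
    have : cexp (π * I * n ^ 2 * (I * t)) = cexp (-(π * t * n ^ 2)) := by
      congr 1
      linear_combination (π * n ^ 2 * t : ℂ) * I_sq
    rw [this]
    ring
  have hs0 := (hasSum_jacobiTheta₂_term (0 : ℂ) hτ).mul_left (∫ x in (0 : ℝ)..1, f x)
  have hsum : Summable (fourierCoeff F) := by
    refine hs0.summable.congr ?_
    intro n
    rw [hcoe, jacobiTheta₂_term]
    have : cexp (2 * π * I * n * 0 + π * I * n ^ 2 * (I * t)) = cexp (-(π * t * n ^ 2)) := by
      congr 1
      linear_combination (π * n ^ 2 * t : ℂ) * I_sq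
    rw [this]
    ring
  have hx := has_pointwise_sum_fourier_series_of_summable hsum (x : UnitAddCircle)
  have e : (fun n => fourierCoeff F n • fourier n (x : UnitAddCircle)) =
      fun n => (∫ x in (0 : ℝ)..1, f x) * jacobiTheta₂_term n x (I * t) := by
    ext n
    rw [hterm, smul_eq_mul, fourier_coe_apply]
    congr 2
    push_cast
    ring
  rw [e] at hx
  exact hx.unique hs

open Complex Real in
/-- The quasi-periodicity determines the theta function up to a constant factor. -/
theorem exists_eq_const_mul_theta {t : ℝ} (ht : 0 < t) {f : ℂ → ℂ} (hf : Differentiable ℂ f)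
    (h1 : ∀ z, f (z + 1) = f z) (h2 : ∀ z, f (z + I * t) = cexp (π * t - 2 * π * I * z) * f z) :
    ∃ c : ℂ, ∀ z, f z = c * theta z (I * t) := by
  refine ⟨∫ x in (0 : ℝ)..1, f x, ?_⟩
  have hτ : 0 < (I * (t : ℂ)).im := by simpa using ht
  have hth : Differentiable ℂ fun z => (∫ x in (0 : ℝ)..1, f x) * theta z (I * t) :=
    fun z => (differentiableAt_jacobiTheta₂_fst z hτ).const_mul _
  -- Identity theorem: the real points 1/(n+1) accumulate at 0.
  have := AnalyticOnNhd.eq_of_frequently_eq (f := f)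
    (g := fun z => (∫ x in (0 : ℝ)..1, f x) * theta z (I * t)) (z₀ := 0)
    (fun z _ => hf.analyticAt z) (fun z _ => hth.analyticAt z) (by
      have h0 : Tendsto (fun n : ℕ => ((1 / ((n : ℝ) + 1) : ℝ) : ℂ)) atTop (𝓝[≠] 0) := by
        rw [tendsto_nhdsWithin_iff]
        refine ⟨?_, Eventually.of_forall fun n => ?_⟩
        · have := (Complex.continuous_ofReal.tendsto 0).comp
            (tendsto_one_div_add_atTop_nhds_zero_nat (𝕜 := ℝ))
          simpa only [Complex.ofReal_zero, Function.comp_def] using this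
        · have : (1 / ((n : ℝ) + 1) : ℝ) ≠ 0 := by positivity
          simpa only [Set.mem_compl_iff, Set.mem_singleton_iff, Complex.ofReal_eq_zero] using this
      exact h0.frequently (Frequently.of_forall fun n =>
        eqOn_real_of_quasiPeriodic ht hf h1 h2 _))
  intro z
  exact congrFun this z


/-! ### The infinite product -/

/-- The product `∏ₙ (1 + q²ⁿ⁺¹ u)`, one of the two factors in the product formula for the theta
function. -/
noncomputable def thetaFactor (q : ℝ) (u : ℂ) : ℂ := ∏' n : ℕ, (1 + (q : ℂ) ^ (2 * n + 1) * u)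

section Product

variable {q : ℝ}

theorem summable_norm_thetaFactor (h0 : 0 < q) (h1 : q < 1) (u : ℂ) :
    Summable fun n : ℕ => ‖(q : ℂ) ^ (2 * n + 1) * u‖ := by
  have h2 : Summable fun n : ℕ => q ^ (2 * n + 1) := by
    have : Summable fun n : ℕ => (q ^ 2) ^ n * q :=
      (summable_geometric_of_lt_one (by positivity) (by nlinarith)).mul_right q
    refine this.congr fun n => ?_
    rw [← pow_mul, ← pow_succ]
  refine (h2.mul_right ‖u‖).congr fun n => ?_
  rw [norm_mul, norm_pow, Complex.norm_real, Real.norm_of_nonneg h0.le]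

theorem multipliable_thetaFactor (h0 : 0 < q) (h1 : q < 1) (u : ℂ) :
    Multipliable fun n : ℕ => (1 + (q : ℂ) ^ (2 * n + 1) * u) :=
  multipliable_one_add_of_summable (summable_norm_thetaFactor h0 h1 u)

theorem differentiable_thetaFactor (h0 : 0 < q) (h1 : q < 1) :
    Differentiable ℂ (thetaFactor q) := by
  intro u
  have hb : IsOpen (Metric.ball (0 : ℂ) (‖u‖ + 1)) := Metric.isOpen_ball
  have hmem : u ∈ Metric.ball (0 : ℂ) (‖u‖ + 1) := by simp
  have hsum := summable_norm_thetaFactor h0 h1 ((‖u‖ + 1 : ℝ) : ℂ)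
  have hprod := hsum.hasProdLocallyUniformlyOn_nat_one_add
    (f := fun n (u : ℂ) => (q : ℂ) ^ (2 * n + 1) * u) hb (Eventually.of_forall fun n x hx => by
      rw [norm_mul, norm_mul, Complex.norm_real, Real.norm_of_nonneg (by positivity)]
      have : ‖x‖ < ‖u‖ + 1 := by simpa using hx
      gcongr) (fun n => by fun_prop)
  have := hprod.differentiableOn (Eventually.of_forall fun s => by
    simpa [Finset.prod_fn] using DifferentiableOn.finsetProd (fun _ _ => by fun_prop)) hb
  exact this.differentiableAt (hb.mem_nhds hmem)

/-- Splitting off the first factor gives the q-difference equation behind the quasi-periodicity of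
θ₃. -/
theorem thetaFactor_eq_mul (h0 : 0 < q) (h1 : q < 1) (u : ℂ) :
    thetaFactor q u = (1 + q * u) * thetaFactor q (q ^ 2 * u) := by
  unfold thetaFactor
  rw [tprod_eq_zero_mul' (f := fun n : ℕ => (1 + (q : ℂ) ^ (2 * n + 1) * u))]
  · congr 1
    · simp
    · congr 1
      ext n
      ring
  · refine (multipliable_thetaFactor h0 h1 (q ^ 2 * u)).congr fun n => ?_
    ring

theorem thetaFactor_ne_zero (h0 : 0 < q) (h1 : q < 1) {u : ℂ}
    (h : ∀ n : ℕ, 1 + (q : ℂ) ^ (2 * n + 1) * u ≠ 0) : thetaFactor q u ≠ 0 :=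
  tprod_one_add_ne_zero_of_summable h (summable_norm_thetaFactor h0 h1 u)

theorem conj_thetaFactor (h0 : 0 < q) (h1 : q < 1) (u : ℂ) :
    (starRingEnd ℂ) (thetaFactor q u) = thetaFactor q ((starRingEnd ℂ) u) := by
  unfold thetaFactor
  rw [(multipliable_thetaFactor h0 h1 u).map_tprod (starRingEnd ℂ) Complex.continuous_conj]
  congr 1
  ext n
  simp

/-- Comparison of the factors on the unit circle, for two different nomes. -/
theorem norm_thetaFactor_mul_le {q₀ : ℝ} (h0 : 0 < q) (h1 : q ≤ q₀) (h2 : q₀ < 1) {u v : ℂ}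
    (hu : ‖u‖ = 1) (hv : ‖v‖ = 1) :
    ‖thetaFactor q v‖ * ‖thetaFactor q₀ (-1)‖ ≤ ‖thetaFactor q u‖ * ‖thetaFactor q₀ 1‖ := by
  have hq0 : 0 < q₀ := h0.trans_le h1
  have hq1 : q < 1 := h1.trans_lt h2
  have hl : ∀ {q : ℝ} (h0 : 0 < q) (h1 : q < 1) (u : ℂ),
      Tendsto (fun N => ∏ n ∈ Finset.range N, ‖1 + (q : ℂ) ^ (2 * n + 1) * u‖) atTop
        (𝓝 ‖thetaFactor q u‖) := by
    intro q h0 h1 u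
    have := (multipliable_thetaFactor h0 h1 u).hasProd.tendsto_prod_nat.norm
    refine this.congr fun N => ?_
    rw [norm_prod]
  refine le_of_tendsto_of_tendsto' ((hl h0 hq1 v).mul (hl hq0 h2 (-1)))
    ((hl h0 hq1 u).mul (hl hq0 h2 1)) fun N => ?_
  rw [← Finset.prod_mul_distrib, ← Finset.prod_mul_distrib]
  refine Finset.prod_le_prod (fun _ _ => by positivity) fun n _ => ?_
  have hQ : q ^ (2 * n + 1) ≤ q₀ ^ (2 * n + 1) := by gcongr
  have hQ1 : q₀ ^ (2 * n + 1) < 1 := pow_lt_one₀ hq0.le h2 (by omega)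
  have hQ0 : 0 < q ^ (2 * n + 1) := by positivity
  have e1 : ‖1 + (q : ℂ) ^ (2 * n + 1) * v‖ ≤ 1 + q ^ (2 * n + 1) := by
    refine (norm_add_le _ _).trans ?_
    rw [norm_mul, hv, norm_pow, Complex.norm_real, Real.norm_of_nonneg h0.le]
    simp
  have e2 : 1 - q ^ (2 * n + 1) ≤ ‖1 + (q : ℂ) ^ (2 * n + 1) * u‖ := by
    have := norm_sub_le_norm_add (1 : ℂ) ((q : ℂ) ^ (2 * n + 1) * u)
    rw [norm_mul, hu, norm_pow, Complex.norm_real, Real.norm_of_nonneg h0.le] at this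
    simpa using this
  have e3 : ‖1 + (q₀ : ℂ) ^ (2 * n + 1) * (-1)‖ = 1 - q₀ ^ (2 * n + 1) := by
    have : (1 + (q₀ : ℂ) ^ (2 * n + 1) * (-1)) = ((1 - q₀ ^ (2 * n + 1) : ℝ) : ℂ) := by
      push_cast; ring
    rw [this, Complex.norm_real, Real.norm_of_nonneg (by linarith)]
  have e4 : ‖1 + (q₀ : ℂ) ^ (2 * n + 1) * 1‖ = 1 + q₀ ^ (2 * n + 1) := by
    have : (1 + (q₀ : ℂ) ^ (2 * n + 1) * 1) = ((1 + q₀ ^ (2 * n + 1) : ℝ) : ℂ) := by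
      push_cast; ring
    rw [this, Complex.norm_real, Real.norm_of_nonneg (by positivity)]
  rw [e3, e4]
  -- On the unit circle each factor has modulus between 1 - qⁿ' and 1 + qⁿ' with n' = 2n + 1. The
  -- middle inequality is q ≤ q₀ in disguise.
  calc _ ≤ (1 + q ^ (2 * n + 1)) * (1 - q₀ ^ (2 * n + 1)) := by
        gcongr
    _ ≤ (1 - q ^ (2 * n + 1)) * (1 + q₀ ^ (2 * n + 1)) := by nlinarith
    _ ≤ _ := by gcongr

end Product

/-! ### Product formula, zeros and real values of theta -/

section Theta

open Complex Real

variable {t : ℝ}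

theorem theta_add_one (z τ : ℂ) : theta (z + 1) τ = theta z τ := jacobiTheta₂_add_left z τ

theorem theta_neg (z τ : ℂ) : theta (-z) τ = theta z τ := jacobiTheta₂_neg_left z τ

theorem theta_add_tau (z τ : ℂ) : theta (z + τ) τ = cexp (-π * I * (τ + 2 * z)) * theta z τ :=
  jacobiTheta₂_add_left' z τ

theorem differentiable_theta (ht : 0 < t) : Differentiable ℂ fun z => theta z (I * t) := fun z =>
  differentiableAt_jacobiTheta₂_fst z (by simpa using ht)

/-- The product formula for the theta function, up to the constant. -/
theorem exists_theta_eq_thetaFactor_mul (ht : 0 < t) :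
    ∃ c : ℂ, c ≠ 0 ∧ ∀ z, theta z (I * t) =
      c * (thetaFactor (rexp (-(π * t))) (cexp (2 * π * I * z)) *
        thetaFactor (rexp (-(π * t))) (cexp (-(2 * π * I * z)))) := by
  set q := rexp (-(π * t)) with hq
  have h0 : 0 < q := Real.exp_pos _
  have h1 : q < 1 := by
    rw [hq, Real.exp_lt_one_iff]
    have := Real.pi_pos
    nlinarith [mul_pos this ht]
  have hqC : (q : ℂ) = cexp (-(π * t)) := by rw [hq]; push_cast; rfl
  have hd := differentiable_thetaFactor h0 h1
  obtain ⟨c, hc⟩ := exists_eq_const_mul_theta ht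
    (f := fun z => thetaFactor q (cexp (2 * π * I * z)) * thetaFactor q (cexp (-(2 * π * I * z))))
    (by fun_prop)
    (by
      intro z
      have e1 : cexp (2 * π * I * (z + 1)) = cexp (2 * π * I * z) := by
        rw [mul_add, mul_one, Complex.exp_add, Complex.exp_two_pi_mul_I, mul_one]
      have e2 : cexp (-(2 * π * I * (z + 1))) = cexp (-(2 * π * I * z)) := by
        rw [Complex.exp_neg, e1, ← Complex.exp_neg]
      simp only [e1, e2])
    (by
      intro z
      have e1 : cexp (2 * π * I * (z + I * t)) = q ^ 2 * cexp (2 * π * I * z) := by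
        rw [hqC, ← Complex.exp_nat_mul, ← Complex.exp_add]
        congr 1
        push_cast
        linear_combination (2 * π * t : ℂ) * I_sq
      have e2 : cexp (-(2 * π * I * z)) = q ^ 2 * cexp (-(2 * π * I * (z + I * t))) := by
        rw [hqC, ← Complex.exp_nat_mul, ← Complex.exp_add]
        congr 1
        push_cast
        linear_combination (2 * π * t : ℂ) * I_sq
      have f1 := thetaFactor_eq_mul h0 h1 (cexp (2 * π * I * z))
      have f2 := thetaFactor_eq_mul h0 h1 (cexp (-(2 * π * I * (z + I * t))))
      rw [← e1] at f1
      rw [← e2] at f2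
      -- Under z ↦ z + it one product loses a factor and the other gains one; their ratio is the
      -- multiplier of θ₃.
      have e3 : 1 + (q : ℂ) * cexp (-(2 * π * I * (z + I * t))) =
          cexp (π * t - 2 * π * I * z) * (1 + q * cexp (2 * π * I * z)) := by
        have g1 : (q : ℂ) * cexp (-(2 * π * I * (z + I * t))) = cexp (π * t - 2 * π * I * z) := by
          rw [hqC, ← Complex.exp_add]
          congr 1
          linear_combination (-2 * π * t : ℂ) * I_sq
        have g2 : cexp (π * t - 2 * π * I * z) * (q * cexp (2 * π * I * z)) = 1 := by
          rw [hqC, ← Complex.exp_add, ← Complex.exp_add, ← Complex.exp_zero]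
          congr 1
          ring
        linear_combination g1 - g2
      rw [f2, e3, f1]
      ring)
  have hne : thetaFactor q 1 * thetaFactor q 1 ≠ 0 := by
    have : thetaFactor q 1 ≠ 0 := by
      apply thetaFactor_ne_zero h0 h1
      intro n
      have : (1 + (q : ℂ) ^ (2 * n + 1) * 1) = ((1 + q ^ (2 * n + 1) : ℝ) : ℂ) := by
        push_cast; ring
      rw [this, Complex.ofReal_ne_zero]
      positivity
    exact mul_ne_zero this this
  have hc0 : c ≠ 0 := by
    rintro rfl
    have := hc 0
    simp only [mul_zero, Complex.exp_zero, neg_zero, zero_mul] at this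
    exact hne this
  refine ⟨c⁻¹, inv_ne_zero hc0, fun z => ?_⟩
  rw [hc z, inv_mul_cancel_left₀ hc0]

theorem nome_pos_lt_one (ht : 0 < t) : 0 < rexp (-(π * t)) ∧ rexp (-(π * t)) < 1 := by
  refine ⟨Real.exp_pos _, ?_⟩
  rw [Real.exp_lt_one_iff]
  nlinarith [mul_pos Real.pi_pos ht]

/-- The zeros of the theta function. -/
theorem exists_int_of_theta_eq_zero (ht : 0 < t) {z : ℂ} (hz : theta z (I * t) = 0) :
    ∃ m n : ℤ, z = 1 / 2 + I * t / 2 + m + n * (I * t) := by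
  obtain ⟨c, hc, h⟩ := exists_theta_eq_thetaFactor_mul ht
  obtain ⟨h0, h1⟩ := nome_pos_lt_one ht
  have key : ∀ {z : ℂ} {n : ℕ},
      1 + ((rexp (-(π * t)) : ℝ) : ℂ) ^ (2 * n + 1) * cexp (2 * π * I * z) = 0 →
      ∃ m : ℤ, z = 1 / 2 + m - (2 * n + 1) * (I * t) / 2 := by
    intro z n hz
    have hqC : ((rexp (-(π * t)) : ℝ) : ℂ) = cexp (-(π * t)) := by push_cast; rfl
    have : cexp ((2 * n + 1 : ℕ) * (-(π * t)) + 2 * π * I * z + π * I) = 1 := by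
      rw [Complex.exp_add, Complex.exp_add, Complex.exp_pi_mul_I, Complex.exp_nat_mul, ← hqC]
      linear_combination -hz
    rw [Complex.exp_eq_one_iff] at this
    obtain ⟨m, hm⟩ := this
    refine ⟨m - 1, ?_⟩
    have hpi : (2 * π * I : ℂ) ≠ 0 := Complex.two_pi_I_ne_zero
    apply mul_left_cancel₀ hpi
    rw [Nat.cast_add, Nat.cast_mul, Nat.cast_one, Nat.cast_ofNat] at hm
    rw [Int.cast_sub, Int.cast_one]
    linear_combination hm + (2 * (n : ℂ) + 1) * (π * t : ℂ) * I_sq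
  rw [h z, mul_eq_zero, mul_eq_zero] at hz
  rcases hz with hz | hz | hz
  · exact absurd hz hc
  · by_contra hcon
    apply thetaFactor_ne_zero h0 h1 _ hz
    intro n hn
    obtain ⟨m, hm⟩ := key hn
    refine hcon ⟨m, -n - 1, ?_⟩
    rw [hm]
    push_cast
    ring
  · by_contra hcon
    apply thetaFactor_ne_zero h0 h1 _ hz
    intro n hn
    rw [show -(2 * π * I * z) = 2 * π * I * (-z) by ring] at hn
    obtain ⟨m, hm⟩ := key hn
    refine hcon ⟨-m - 1, n, ?_⟩
    rw [← neg_neg z, hm]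
    push_cast
    ring

/-- The points 1/2 ± it/2 differ by the quasi-period, with multiplier exp(πi) = -1 between them,
while evenness and period 1 give equal values. -/
theorem theta_half_eq_zero (t : ℝ) : theta (1 / 2 + I * t / 2) (I * t) = 0 := by
  have h1 := theta_add_tau (1 / 2 - I * t / 2) (I * t)
  have h2 : theta (1 / 2 - I * t / 2) (I * t) = theta (1 / 2 + I * t / 2) (I * t) := by
    rw [← theta_neg, ← theta_add_one]
    congr 1
    ring
  rw [h2, show -(π : ℂ) * I * (I * t + 2 * (1 / 2 - I * t / 2)) = -(π * I) by ring,
    Complex.exp_neg, Complex.exp_pi_mul_I] at h1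
  have : (1 / 2 - I * t / 2 + I * t : ℂ) = 1 / 2 + I * t / 2 := by ring
  rw [this] at h1
  norm_num at h1 ⊢
  exact self_eq_neg.mp h1

/-- The zero of the theta function is simple. -/
theorem exists_hasDerivAt_theta_half (ht : 0 < t) :
    ∃ d : ℂ, d ≠ 0 ∧ HasDerivAt (fun z => theta z (I * t)) d (1 / 2 + I * t / 2) := by
  obtain ⟨c, hc, h⟩ := exists_theta_eq_thetaFactor_mul ht
  obtain ⟨h0, h1⟩ := nome_pos_lt_one ht
  set q := rexp (-(π * t)) with hq
  have hqC : (q : ℂ) = cexp (-(π * t)) := by rw [hq]; push_cast; rfl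
  have hd := differentiable_thetaFactor h0 h1
  set z₀ : ℂ := 1 / 2 + I * t / 2 with hz₀
  -- R is the product without the one factor that vanishes at z₀, so simplicity reduces to R(z₀) ≠
  -- 0.
  let R : ℂ → ℂ := fun z => thetaFactor q (cexp (2 * π * I * z)) *
    thetaFactor q (q ^ 2 * cexp (-(2 * π * I * z)))
  have hR : Differentiable ℂ R := by fun_prop
  have heq : ∀ z, theta z (I * t) = (1 + q * cexp (-(2 * π * I * z))) * (c * R z) := by
    intro z
    rw [h z, thetaFactor_eq_mul h0 h1 (cexp (-(2 * π * I * z)))]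
    ring
  have e1 : cexp (2 * π * I * z₀) = -q := by
    rw [hqC, hz₀, show (2 * π * I * (1 / 2 + I * t / 2) : ℂ) = π * I + -(π * t) by
      linear_combination (π * t : ℂ) * I_sq, Complex.exp_add, Complex.exp_pi_mul_I]
    ring
  have hq0 : (q : ℂ) ≠ 0 := by exact_mod_cast h0.ne'
  have e2 : (q : ℂ) * cexp (-(2 * π * I * z₀)) = -1 := by
    rw [Complex.exp_neg, e1]
    field_simp
  have hR0 : R z₀ ≠ 0 := by
    apply mul_ne_zero
    · rw [e1]
      apply thetaFactor_ne_zero h0 h1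
      intro n
      have : (1 + (q : ℂ) ^ (2 * n + 1) * -q) = ((1 - q ^ (2 * n + 2) : ℝ) : ℂ) := by
        push_cast; ring
      rw [this, Complex.ofReal_ne_zero]
      have := pow_lt_one₀ h0.le h1 (show 2 * n + 2 ≠ 0 by omega)
      linarith
    · have : (q : ℂ) ^ 2 * cexp (-(2 * π * I * z₀)) = -q := by
        rw [pow_two, mul_assoc, e2]; ring
      rw [this]
      apply thetaFactor_ne_zero h0 h1
      intro n
      have : (1 + (q : ℂ) ^ (2 * n + 1) * -q) = ((1 - q ^ (2 * n + 2) : ℝ) : ℂ) := by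
        push_cast; ring
      rw [this, Complex.ofReal_ne_zero]
      have := pow_lt_one₀ h0.le h1 (show 2 * n + 2 ≠ 0 by omega)
      linarith
  have hd1 : HasDerivAt (fun z => 1 + (q : ℂ) * cexp (-(2 * π * I * z))) (2 * π * I) z₀ := by
    have h3 : HasDerivAt (fun z : ℂ => -(2 * π * I * z)) (-(2 * π * I)) z₀ := by
      have := ((hasDerivAt_id z₀).const_mul (-(2 * π * I) : ℂ))
      simpa only [id_eq, mul_one, neg_mul] using this
    refine ((h3.cexp.const_mul (q : ℂ)).const_add 1).congr_deriv ?_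
    rw [← mul_assoc, e2]
    ring
  refine ⟨2 * π * I * (c * R z₀), ?_, ?_⟩
  · exact mul_ne_zero Complex.two_pi_I_ne_zero (mul_ne_zero hc hR0)
  · have h5 := hd1.mul ((hR z₀).hasDerivAt.const_mul c)
    have h6 : (fun z => theta z (I * t)) =
        (fun z => 1 + (q : ℂ) * cexp (-(2 * π * I * z))) * fun z => c * R z := funext heq
    rw [h6]
    refine h5.congr_deriv ?_
    rw [e2]
    ring

/-- On the real line the values of a theta function with imaginary modulus differ by positive
factors, which are bounded below if the modulus is bounded away from zero. -/
theorem exists_theta_real_ratio_lower_bound {t₀ : ℝ} (ht₀ : 0 < t₀) :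
    ∃ C : ℝ, 0 < C ∧ ∀ t, t₀ ≤ t → ∀ x y : ℝ, theta y (I * t) ≠ 0 ∧
      ∃ r : ℝ, C ≤ r ∧ theta x (I * t) / theta y (I * t) = r := by
  obtain ⟨h0, h1⟩ := nome_pos_lt_one ht₀
  set q₀ := rexp (-(π * t₀))
  have hne : ∀ {t : ℝ}, 0 < t → ∀ {u : ℂ}, ‖u‖ = 1 → thetaFactor (rexp (-(π * t))) u ≠ 0 := by
    intro t ht u hu
    obtain ⟨h0, h1⟩ := nome_pos_lt_one ht
    apply thetaFactor_ne_zero h0 h1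
    intro n hn
    have h2 := pow_lt_one₀ h0.le h1 (show 2 * n + 1 ≠ 0 by omega)
    have h3 : ((rexp (-(π * t)) : ℝ) : ℂ) ^ (2 * n + 1) * u = -1 := by linear_combination hn
    have h4 := congrArg norm h3
    rw [norm_mul, hu, norm_pow, Complex.norm_real, Real.norm_of_nonneg h0.le] at h4
    simp only [mul_one, norm_neg, norm_one] at h4
    exact h2.ne h4
  have hp1 : 0 < ‖thetaFactor q₀ 1‖ := norm_pos_iff.2 (hne ht₀ (by simp))
  have hp2 : 0 < ‖thetaFactor q₀ (-1)‖ := norm_pos_iff.2 (hne ht₀ (by simp))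
  -- The worst case is the largest nome q₀, compared between u = -1 and u = 1; the square accounts
  -- for the two conjugate products.
  refine ⟨(‖thetaFactor q₀ (-1)‖ / ‖thetaFactor q₀ 1‖) ^ 2, by positivity, ?_⟩
  intro t ht x y
  have ht' : 0 < t := ht₀.trans_le ht
  obtain ⟨g0, g1⟩ := nome_pos_lt_one ht'
  obtain ⟨c, hc, h⟩ := exists_theta_eq_thetaFactor_mul ht'
  have hunit : ∀ x : ℝ, ‖cexp (2 * π * I * x)‖ = 1 := by
    intro x
    rw [show (2 * π * I * x : ℂ) = ((2 * π * x : ℝ) : ℂ) * I by push_cast; ring,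
      Complex.norm_exp_ofReal_mul_I]
  -- For real x the second product is the conjugate of the first. The unknown constant c cancels in
  -- the ratio.
  have hreal : ∀ x : ℝ, theta x (I * t) =
      c * ((‖thetaFactor (rexp (-(π * t))) (cexp (2 * π * I * x))‖ ^ 2 : ℝ) : ℂ) := by
    intro x
    have : cexp (-(2 * π * I * x)) = (starRingEnd ℂ) (cexp (2 * π * I * x)) := by
      rw [← Complex.exp_conj]
      congr 1
      simp [Complex.conj_ofReal, Complex.conj_ofNat]
    rw [h, this, ← conj_thetaFactor g0 g1, Complex.mul_conj, Complex.normSq_eq_norm_sq]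
  have hpos : ∀ x : ℝ, 0 < ‖thetaFactor (rexp (-(π * t))) (cexp (2 * π * I * x))‖ := fun x =>
    norm_pos_iff.2 (hne ht' (hunit x))
  refine ⟨?_, ?_⟩
  · rw [hreal]
    refine mul_ne_zero hc ?_
    rw [Complex.ofReal_ne_zero]
    exact pow_ne_zero 2 (hpos y).ne'
  · refine ⟨(‖thetaFactor (rexp (-(π * t))) (cexp (2 * π * I * x))‖ /
      ‖thetaFactor (rexp (-(π * t))) (cexp (2 * π * I * y))‖) ^ 2, ?_, ?_⟩
    · have hq : rexp (-(π * t)) ≤ q₀ := by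
        apply Real.exp_le_exp.2
        have := Real.pi_pos
        nlinarith
      have := norm_thetaFactor_mul_le g0 hq h1 (hunit x) (hunit y)
      refine pow_le_pow_left₀ (by positivity) ?_ 2
      rw [div_le_div_iff₀ hp1 (hpos y)]
      linarith
    · rw [hreal, hreal, mul_div_mul_left _ _ hc, ← Complex.ofReal_div, div_pow]

end Theta

/-! ### The branches of γ̃ and w and their boundary values -/

section Roots

variable {c a : ℝ}

/-- The plane cut along `[ia, ic] ∪ [-ic, -ia]`. -/
def bandPlane (c a : ℝ) : Set ℂ := {k | ¬ (k.re = 0 ∧ a ≤ |k.im| ∧ |k.im| ≤ c)}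

theorem isOpen_bandPlane (c a : ℝ) : IsOpen (bandPlane c a) := by
  have : bandPlane c a = {k : ℂ | k.re = 0 ∧ a ≤ |k.im| ∧ |k.im| ≤ c}ᶜ := rfl
  rw [this, isOpen_compl_iff]
  apply IsClosed.inter
  · exact isClosed_eq Complex.continuous_re continuous_const
  · apply IsClosed.inter
    · exact isClosed_le continuous_const (Complex.continuous_im.abs)
    · exact isClosed_le (Complex.continuous_im.abs) continuous_const

theorem cutPlane_subset_bandPlane : cutPlane c ⊆ bandPlane c a :=
  fun _ hk h => hk ⟨h.1, h.2.2⟩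

theorem mem_bandPlane_of_lt {y : ℝ} (h : |y| < a) : Complex.I * y ∈ bandPlane c a := by
  intro h'
  have := h'.2.1
  simp only [Complex.mul_im, Complex.I_re, Complex.ofReal_im, mul_zero, Complex.I_im,
    Complex.ofReal_re, one_mul, zero_add] at this
  exact absurd h (not_lt.2 this)

theorem neg_mem_cutPlane {k : ℂ} (hk : k ∈ cutPlane c) : -k ∈ cutPlane c := by
  intro h; apply hk; simpa using h

theorem sq_add_sq_ne_zero_of_re_im {u : ℝ} {k : ℂ} (h : ¬ (k.re = 0 ∧ |k.im| = |u|)) :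
    k ^ 2 + (u : ℂ) ^ 2 ≠ 0 := by
  intro h0
  have h1 : (k - Complex.I * u) * (k + Complex.I * u) = 0 := by
    linear_combination h0 - (u : ℂ) ^ 2 * Complex.I_sq
  rcases mul_eq_zero.1 h1 with h2 | h2
  · apply h
    rw [sub_eq_zero.1 h2]
    simp
  · apply h
    rw [eq_neg_of_add_eq_zero_left h2]
    simp

theorem sq_add_c_sq_ne_zero (ha : 0 < a) (hac : a < c) {k : ℂ} (hk : k ∈ bandPlane c a) :
    k ^ 2 + (c : ℂ) ^ 2 ≠ 0 := by
  apply sq_add_sq_ne_zero_of_re_im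
  rintro ⟨h1, h2⟩
  rw [abs_of_pos (ha.trans hac)] at h2
  exact hk ⟨h1, by rw [h2]; exact hac.le, h2.le⟩

theorem sq_add_a_sq_ne_zero (ha : 0 < a) (hac : a < c) {k : ℂ} (hk : k ∈ bandPlane c a) :
    k ^ 2 + (a : ℂ) ^ 2 ≠ 0 := by
  apply sq_add_sq_ne_zero_of_re_im
  rintro ⟨h1, h2⟩
  rw [abs_of_pos ha] at h2
  exact hk ⟨h1, h2.ge, by rw [h2]; exact hac.le⟩

/-- On the complement of the bands the quotient under the roots stays off the cut of the principal
branch. -/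
theorem quotient_mem_slitPlane (ha : 0 < a) (hac : a < c) {k : ℂ} (hk : k ∈ bandPlane c a) :
    (k ^ 2 + (a : ℂ) ^ 2) / (k ^ 2 + (c : ℂ) ^ 2) ∈ Complex.slitPlane := by
  have hc0 := sq_add_c_sq_ne_zero ha hac hk
  by_contra hcon
  rw [Complex.mem_slitPlane_iff, not_or, not_lt, not_not] at hcon
  obtain ⟨h1, h2⟩ := hcon
  -- A quotient on the closed negative axis means k² + a² = -ρ(k² + c²) with ρ ≥ 0. The imaginary
  -- part gives Re k · Im k = 0 and the real part excludes real k. For k = iy, y² is then a weighted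
  -- mean of a² and c², so k lies on a band.
  set ρ : ℝ := -((k ^ 2 + (a : ℂ) ^ 2) / (k ^ 2 + (c : ℂ) ^ 2)).re with hρ
  have hρ0 : 0 ≤ ρ := by linarith
  have hq : (k ^ 2 + (a : ℂ) ^ 2) / (k ^ 2 + (c : ℂ) ^ 2) = -(ρ : ℂ) := by
    apply Complex.ext
    · simp [hρ]
    · simpa using h2
  rw [div_eq_iff hc0] at hq
  have hre := congrArg Complex.re hq
  have him := congrArg Complex.im hq
  simp only [pow_two, Complex.add_re, Complex.mul_re, Complex.ofReal_re, Complex.ofReal_im,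
    mul_zero, sub_zero, Complex.neg_re, Complex.neg_im, Complex.add_im, Complex.mul_im, zero_mul,
    add_zero, neg_zero] at hre him
  have h3 : k.re * k.im = 0 := by
    have : (k.re * k.im) * (2 * (1 + ρ)) = 0 := by linarith
    rcases mul_eq_zero.1 this with h | h
    · exact h
    · exfalso; linarith
  have h4 : k.re = 0 := by
    rcases mul_eq_zero.1 h3 with h | h
    · exact h
    · rw [h] at hre
      nlinarith [sq_nonneg k.re, mul_nonneg hρ0 (sq_nonneg k.re), mul_nonneg hρ0 (sq_nonneg c),
        sq_pos_of_pos ha]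
  apply hk
  rw [h4] at hre
  refine ⟨h4, ?_, ?_⟩
  · rw [← abs_of_pos ha]
    apply sq_le_sq.1
    nlinarith [mul_nonneg hρ0 (by nlinarith : 0 ≤ c ^ 2 - a ^ 2)]
  · rw [← abs_of_pos (ha.trans hac)]
    apply sq_le_sq.1
    nlinarith [mul_nonneg hρ0 (by nlinarith : 0 ≤ c ^ 2 - a ^ 2)]

theorem differentiableAt_gammaTilde (ha : 0 < a) (hac : a < c) {k : ℂ} (hk : k ∈ bandPlane c a) :
    DifferentiableAt ℂ (gammaTilde c a) k := by
  unfold gammaTilde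
  refine DifferentiableAt.cpow_const ?_ (quotient_mem_slitPlane ha hac hk)
  exact DifferentiableAt.div (by fun_prop) (by fun_prop) (sq_add_c_sq_ne_zero ha hac hk)

theorem gammaTilde_ne_zero (ha : 0 < a) (hac : a < c) {k : ℂ} (hk : k ∈ bandPlane c a) :
    gammaTilde c a k ≠ 0 := by
  unfold gammaTilde
  rw [Complex.cpow_ne_zero_iff]
  exact Or.inl (Complex.slitPlane_ne_zero (quotient_mem_slitPlane ha hac hk))

theorem gammaTilde_neg (c a : ℝ) (k : ℂ) : gammaTilde c a (-k) = gammaTilde c a k := by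
  simp [gammaTilde]

theorem w_neg (c a : ℝ) (k : ℂ) : w c a (-k) = w c a k := by
  simp [w]

theorem w_eq (c a : ℝ) (k : ℂ) : w c a k = (k ^ 2 + (c : ℂ) ^ 2) * gammaTilde c a k ^ 2 := by
  unfold w gammaTilde
  rw [← Complex.cpow_nat_mul]
  norm_num

theorem gammaTilde_pow_four (c a : ℝ) (k : ℂ) :
    gammaTilde c a k ^ 4 = (k ^ 2 + (a : ℂ) ^ 2) / (k ^ 2 + (c : ℂ) ^ 2) := by
  unfold gammaTilde
  rw [← Complex.cpow_nat_mul]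
  norm_num

theorem w_sq {k : ℂ} (hk : k ^ 2 + (c : ℂ) ^ 2 ≠ 0) :
    w c a k ^ 2 = (k ^ 2 + (a : ℂ) ^ 2) * (k ^ 2 + (c : ℂ) ^ 2) := by
  rw [w_eq, mul_pow, ← pow_mul, gammaTilde_pow_four]
  field_simp

theorem w_ne_zero (ha : 0 < a) (hac : a < c) {k : ℂ} (hk : k ∈ bandPlane c a) : w c a k ≠ 0 := by
  rw [w_eq]
  exact mul_ne_zero (sq_add_c_sq_ne_zero ha hac hk) (pow_ne_zero 2 (gammaTilde_ne_zero ha hac hk))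

theorem differentiableAt_w (ha : 0 < a) (hac : a < c) {k : ℂ} (hk : k ∈ bandPlane c a) :
    DifferentiableAt ℂ (w c a) k := by
  have : w c a = fun k => (k ^ 2 + (c : ℂ) ^ 2) * gammaTilde c a k ^ 2 := funext (w_eq c a)
  rw [this]
  exact DifferentiableAt.mul (by fun_prop) ((differentiableAt_gammaTilde ha hac hk).pow 2)

theorem gammaTilde_conj (ha : 0 < a) (hac : a < c) {k : ℂ} (hk : k ∈ bandPlane c a) :
    gammaTilde c a ((starRingEnd ℂ) k) = (starRingEnd ℂ) (gammaTilde c a k) := by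
  have h := quotient_mem_slitPlane ha hac hk
  have e : (((starRingEnd ℂ) k) ^ 2 + (a : ℂ) ^ 2) / (((starRingEnd ℂ) k) ^ 2 + (c : ℂ) ^ 2) =
      (starRingEnd ℂ) ((k ^ 2 + (a : ℂ) ^ 2) / (k ^ 2 + (c : ℂ) ^ 2)) := by
    simp
  unfold gammaTilde
  rw [e, ← Complex.conj_conj (1 / 4 : ℂ), ← Complex.conj_cpow _ _ (Complex.slitPlane_arg_ne_pi h)]
  simp [Complex.conj_ofNat]

theorem w_conj (ha : 0 < a) (hac : a < c) {k : ℂ} (hk : k ∈ bandPlane c a) :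
    w c a ((starRingEnd ℂ) k) = (starRingEnd ℂ) (w c a k) := by
  rw [w_eq, w_eq, gammaTilde_conj ha hac hk]
  simp

/-- The value of the root on the imaginary axis, inside the gap and outside of the segment. -/
theorem gammaTilde_I_mul {y : ℝ} :
    gammaTilde c a (Complex.I * y) = (((a ^ 2 - y ^ 2) / (c ^ 2 - y ^ 2) : ℝ) : ℂ) ^ (1 / 4 : ℂ) := by
  unfold gammaTilde
  congr 1
  push_cast
  rw [mul_pow, Complex.I_sq]
  congr 1 <;> ring

/-- On the bands the principal branch of the quartic root has argument `π / 4`. -/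
theorem conj_gammaTilde_of_band {y : ℝ} (hy : (a ^ 2 - y ^ 2) / (c ^ 2 - y ^ 2) ≤ 0) :
    (starRingEnd ℂ) (gammaTilde c a (Complex.I * y)) =
      -Complex.I * gammaTilde c a (Complex.I * y) := by
  rw [gammaTilde_I_mul, Complex.ofReal_cpow_of_nonpos hy]
  set r := -((a ^ 2 - y ^ 2) / (c ^ 2 - y ^ 2)) with hr
  have hr0 : 0 ≤ r := by linarith
  have h1 : (-(((a ^ 2 - y ^ 2) / (c ^ 2 - y ^ 2) : ℝ) : ℂ)) ^ (1 / 4 : ℂ) =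
      ((r ^ (1 / 4 : ℝ) : ℝ) : ℂ) := by
    rw [Complex.ofReal_cpow hr0, hr]
    push_cast
    rfl
  rw [h1, map_mul, Complex.conj_ofReal, ← Complex.exp_conj, mul_left_comm]
  congr 1
  have h2 : -Complex.I = Complex.exp (-(Real.pi / 2 * Complex.I)) := by
    rw [Complex.exp_neg, Complex.exp_pi_div_two_mul_I, Complex.inv_I]
  rw [h2, ← Complex.exp_add]
  congr 1
  simp only [map_mul, Complex.conj_ofReal, Complex.conj_I, map_div₀, map_one, Complex.conj_ofNat]
  ring

/-- The quotient is 1 - (c² - a²)/(k² + c²), whose imaginary part has the sign of Im k². This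
decides from which side the cut of the principal root is approached. -/
theorem im_quotient_nonneg (hac : a ^ 2 ≤ c ^ 2) {k : ℂ} (hre : 0 ≤ k.re) (him : 0 ≤ k.im) :
    0 ≤ ((k ^ 2 + (a : ℂ) ^ 2) / (k ^ 2 + (c : ℂ) ^ 2)).im := by
  rw [Complex.div_im]
  simp only [pow_two, Complex.add_re, Complex.mul_re, Complex.ofReal_re, Complex.ofReal_im,
    mul_zero, sub_zero, Complex.add_im, Complex.mul_im, zero_mul, add_zero]
  rw [← sub_div]
  apply div_nonneg _ (Complex.normSq_nonneg _)
  have := mul_nonneg hre him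
  nlinarith

/-- The right boundary value of the quartic root on the upper band. -/
theorem tendsto_gammaTilde_right_of_pos (ha : 0 < a) {y : ℝ} (h1 : a < y) (h2 : y < c) :
    Tendsto (gammaTilde c a) (𝓝[{z : ℂ | 0 < z.re}] (Complex.I * y))
      (𝓝 (gammaTilde c a (Complex.I * y))) := by
  have hy : 0 < y := ha.trans h1
  have hval : ((Complex.I * y) ^ 2 + (a : ℂ) ^ 2) / ((Complex.I * y) ^ 2 + (c : ℂ) ^ 2) =
      (((a ^ 2 - y ^ 2) / (c ^ 2 - y ^ 2) : ℝ) : ℂ) := by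
    push_cast
    rw [mul_pow, Complex.I_sq]
    congr 1 <;> ring
  have hneg : (a ^ 2 - y ^ 2) / (c ^ 2 - y ^ 2) < 0 :=
    div_neg_of_neg_of_pos (by nlinarith) (by nlinarith)
  have hc0 : (Complex.I * y) ^ 2 + (c : ℂ) ^ 2 ≠ 0 := by
    have : (Complex.I * y) ^ 2 + (c : ℂ) ^ 2 = ((c ^ 2 - y ^ 2 : ℝ) : ℂ) := by
      push_cast
      rw [mul_pow, Complex.I_sq]
      ring
    rw [this, Complex.ofReal_ne_zero]
    nlinarith
  -- From the right of the upper band the quotient reaches the negative axis through the closed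
  -- upper half plane, where the principal logarithm is continuous up to the axis.
  have hq : Tendsto (fun k : ℂ => (k ^ 2 + (a : ℂ) ^ 2) / (k ^ 2 + (c : ℂ) ^ 2))
      (𝓝[{z : ℂ | 0 < z.re}] (Complex.I * y))
      (𝓝[{z : ℂ | 0 ≤ z.im}] (((a ^ 2 - y ^ 2) / (c ^ 2 - y ^ 2) : ℝ) : ℂ)) := by
    rw [tendsto_nhdsWithin_iff]
    refine ⟨?_, ?_⟩
    · rw [← hval]
      apply Tendsto.mono_left _ nhdsWithin_le_nhds
      apply ContinuousAt.tendsto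
        (f := fun k : ℂ => (k ^ 2 + (a : ℂ) ^ 2) / (k ^ 2 + (c : ℂ) ^ 2))
      exact ContinuousAt.div (by fun_prop) (by fun_prop) hc0
    · have hpos : ∀ᶠ k : ℂ in 𝓝 (Complex.I * (y : ℂ)), 0 < k.im :=
        Complex.continuous_im.continuousAt.eventually_const_lt (by simpa using hy)
      rw [eventually_nhdsWithin_iff]
      filter_upwards [hpos] with k hk hk'
      exact im_quotient_nonneg (by nlinarith) (le_of_lt hk') hk.le
  have hlog : ContinuousWithinAt (fun z : ℂ => z ^ (1 / 4 : ℂ)) {z : ℂ | 0 ≤ z.im}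
      (((a ^ 2 - y ^ 2) / (c ^ 2 - y ^ 2) : ℝ) : ℂ) := by
    have hne : (((a ^ 2 - y ^ 2) / (c ^ 2 - y ^ 2) : ℝ) : ℂ) ≠ 0 := by
      rw [Complex.ofReal_ne_zero]; exact hneg.ne
    have h3 := Complex.continuousWithinAt_log_of_re_neg_of_im_zero
      (z := (((a ^ 2 - y ^ 2) / (c ^ 2 - y ^ 2) : ℝ) : ℂ)) (by rw [Complex.ofReal_re]; exact hneg)
      (Complex.ofReal_im _)
    have h4 : ContinuousWithinAt (fun z : ℂ => Complex.exp (Complex.log z * (1 / 4)))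
        {z : ℂ | 0 ≤ z.im} (((a ^ 2 - y ^ 2) / (c ^ 2 - y ^ 2) : ℝ) : ℂ) :=
      (h3.mul continuousWithinAt_const).cexp
    refine h4.congr_of_eventuallyEq ?_ ?_
    · have : ∀ᶠ z : ℂ in 𝓝 (((a ^ 2 - y ^ 2) / (c ^ 2 - y ^ 2) : ℝ) : ℂ), z ≠ 0 :=
        isOpen_ne.mem_nhds hne
      filter_upwards [nhdsWithin_le_nhds this] with z hz
      rw [Complex.cpow_def_of_ne_zero hz]
    · rw [Complex.cpow_def_of_ne_zero hne]
  rw [gammaTilde_I_mul]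
  exact hlog.tendsto.comp hq

theorem tendsto_conj_right (y : ℝ) :
    Tendsto (starRingEnd ℂ) (𝓝[{z : ℂ | 0 < z.re}] (Complex.I * y))
      (𝓝[{z : ℂ | 0 < z.re}] (Complex.I * (-y : ℝ))) := by
  rw [tendsto_nhdsWithin_iff]
  refine ⟨?_, ?_⟩
  · have := (Complex.continuous_conj.tendsto (Complex.I * (y : ℂ)))
    have e : (starRingEnd ℂ) (Complex.I * (y : ℂ)) = Complex.I * (-y : ℝ) := by simp
    rw [e] at this
    exact this.mono_left nhdsWithin_le_nhds
  · filter_upwards [self_mem_nhdsWithin] with z hz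
    simpa using hz

/-- The right boundary value of the quartic root on the lower band. -/
theorem tendsto_gammaTilde_right_of_neg (ha : 0 < a) {y : ℝ} (h1 : y < -a) (h2 : -c < y) :
    Tendsto (gammaTilde c a) (𝓝[{z : ℂ | 0 < z.re}] (Complex.I * y))
      (𝓝 (-Complex.I * gammaTilde c a (Complex.I * y))) := by
  have hac : a < c := by linarith
  -- Conjugation preserves the right half plane and exchanges the two bands.
  have h3 := (tendsto_gammaTilde_right_of_pos (c := c) ha (y := -y) (by linarith)
    (by linarith)).comp (tendsto_conj_right y)
  have h4 := (Complex.continuous_conj.tendsto _).comp h3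
  have hneg : (a ^ 2 - (-y) ^ 2) / (c ^ 2 - (-y) ^ 2) < 0 :=
    div_neg_of_neg_of_pos (by nlinarith) (by nlinarith)
  rw [conj_gammaTilde_of_band hneg.le] at h4
  have e : Complex.I * ((-y : ℝ) : ℂ) = -(Complex.I * y) := by push_cast; ring
  rw [e, gammaTilde_neg] at h4
  refine h4.congr' ?_
  filter_upwards [self_mem_nhdsWithin] with z hz
  have hz' : z ∈ bandPlane c a := cutPlane_subset_bandPlane (mem_cutPlane_of_re_ne (ne_of_gt hz))
  simp only [Function.comp_apply]
  rw [gammaTilde_conj ha hac hz', Complex.conj_conj]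

/-- The boundary values of the quartic root from the right half plane. -/
noncomputable def gammaRight (c a y : ℝ) : ℂ :=
  if -c < y ∧ y < -a then -Complex.I * gammaTilde c a (Complex.I * y)
  else gammaTilde c a (Complex.I * y)

theorem tendsto_gammaTilde_right (ha : 0 < a) (hac : a < c) {y : ℝ} (h1 : |y| ≠ a) (h2 : |y| ≠ c) :
    Tendsto (gammaTilde c a) (𝓝[{z : ℂ | 0 < z.re}] (Complex.I * y)) (𝓝 (gammaRight c a y)) := by
  unfold gammaRight
  split_ifs with h
  · exact tendsto_gammaTilde_right_of_neg ha h.2 h.1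
  · by_cases h' : a < y ∧ y < c
    · exact tendsto_gammaTilde_right_of_pos ha h'.1 h'.2
    · have hmem : Complex.I * y ∈ bandPlane c a := by
        rintro ⟨-, h3, h4⟩
        simp only [Complex.mul_im, Complex.I_re, Complex.ofReal_im, mul_zero, Complex.I_im,
          Complex.ofReal_re, one_mul, zero_add] at h3 h4
        have h5 : a < |y| := lt_of_le_of_ne h3 h1.symm
        have h6 : |y| < c := lt_of_le_of_ne h4 h2
        rw [abs_lt] at h6
        rcases lt_abs.1 h5 with h7 | h7
        · exact h' ⟨h7, h6.2⟩
        · exact h ⟨h6.1, by linarith⟩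
      exact (differentiableAt_gammaTilde ha hac hmem).continuousAt.tendsto.mono_left
        nhdsWithin_le_nhds

theorem gammaRight_ne_zero (ha : 0 < a) (hac : a < c) {y : ℝ} (h1 : |y| ≠ a) (h2 : |y| ≠ c) :
    gammaRight c a y ≠ 0 := by
  have hg : gammaTilde c a (Complex.I * y) ≠ 0 := by
    rw [gammaTilde_I_mul, Complex.cpow_ne_zero_iff]
    left
    rw [Complex.ofReal_ne_zero]
    apply div_ne_zero
    · rw [sub_ne_zero]
      intro h
      apply h1
      rw [← abs_of_pos ha]
      exact ((sq_eq_sq_iff_abs_eq_abs _ _).1 h).symm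
    · rw [sub_ne_zero]
      intro h
      apply h2
      rw [← abs_of_pos (ha.trans hac)]
      exact ((sq_eq_sq_iff_abs_eq_abs _ _).1 h).symm
  unfold gammaRight
  split_ifs
  · exact mul_ne_zero (neg_ne_zero.2 Complex.I_ne_zero) hg
  · exact hg

/-- Because the root is even, its left limit at iy is its right limit at -iy. Jump relations
therefore appear throughout as relations between right limits at y and -y; this one is γ₊ = iγ₋. -/
theorem gammaRight_upper (ha : 0 < a) {y : ℝ} (h1 : a < y) (h2 : y < c) :
    gammaRight c a y = Complex.I * gammaRight c a (-y) := by
  unfold gammaRight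
  rw [if_neg (by rintro ⟨h3, h4⟩; linarith), if_pos (by constructor <;> linarith)]
  have e : Complex.I * ((-y : ℝ) : ℂ) = -(Complex.I * y) := by push_cast; ring
  rw [e, gammaTilde_neg]
  linear_combination gammaTilde c a (Complex.I * y) * Complex.I_sq

theorem gammaRight_gap {y : ℝ} (h : |y| < a) : gammaRight c a y = gammaRight c a (-y) := by
  rw [abs_lt] at h
  unfold gammaRight
  rw [if_neg (by rintro ⟨h3, h4⟩; linarith), if_neg (by rintro ⟨h3, h4⟩; linarith)]
  have e : Complex.I * ((-y : ℝ) : ℂ) = -(Complex.I * y) := by push_cast; ring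
  rw [e, gammaTilde_neg]

/-- The boundary values of `w` from the right half plane. -/
noncomputable def wRight (c a y : ℝ) : ℂ :=
  ((Complex.I * y) ^ 2 + (c : ℂ) ^ 2) * gammaRight c a y ^ 2

theorem tendsto_w_right (ha : 0 < a) (hac : a < c) {y : ℝ} (h1 : |y| ≠ a) (h2 : |y| ≠ c) :
    Tendsto (w c a) (𝓝[{z : ℂ | 0 < z.re}] (Complex.I * y)) (𝓝 (wRight c a y)) := by
  have h := tendsto_gammaTilde_right ha hac h1 h2
  have h3 : Tendsto (fun k : ℂ => k ^ 2 + (c : ℂ) ^ 2) (𝓝[{z : ℂ | 0 < z.re}] (Complex.I * y))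
      (𝓝 ((Complex.I * y) ^ 2 + (c : ℂ) ^ 2)) := by
    apply Tendsto.mono_left _ nhdsWithin_le_nhds
    apply ContinuousAt.tendsto (f := fun k : ℂ => k ^ 2 + (c : ℂ) ^ 2)
    fun_prop
  exact (h3.mul (h.pow 2)).congr fun k => (w_eq c a k).symm

theorem wRight_upper (ha : 0 < a) {y : ℝ} (h1 : a < y) (h2 : y < c) :
    wRight c a y = -wRight c a (-y) := by
  unfold wRight
  rw [gammaRight_upper ha h1 h2]
  push_cast
  linear_combination ((Complex.I * y) ^ 2 + (c : ℂ) ^ 2) * gammaRight c a (-y) ^ 2 * Complex.I_sq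

theorem wRight_gap {y : ℝ} (h : |y| < a) : wRight c a y = wRight c a (-y) := by
  unfold wRight
  rw [gammaRight_gap h]
  push_cast
  ring

theorem wRight_eq_w {y : ℝ} (h : -a ≤ y) : wRight c a y = w c a (Complex.I * y) := by
  unfold wRight gammaRight
  rw [if_neg (by rintro ⟨h3, h4⟩; linarith), w_eq]

/-- `w` on the imaginary axis. -/
theorem w_I_mul_eq {y : ℝ} : w c a (Complex.I * y) =
    ((c ^ 2 - y ^ 2 : ℝ) : ℂ) * (((a ^ 2 - y ^ 2) / (c ^ 2 - y ^ 2) : ℝ) : ℂ) ^ (1 / 2 : ℂ) := by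
  unfold w
  congr 1
  · push_cast
    rw [mul_pow, Complex.I_sq]
    ring
  · congr 1
    push_cast
    rw [mul_pow, Complex.I_sq]
    congr 1 <;> ring

theorem w_I_mul_of_nonneg {y : ℝ} (h : 0 ≤ (a ^ 2 - y ^ 2) / (c ^ 2 - y ^ 2)) :
    w c a (Complex.I * y) =
      (((c ^ 2 - y ^ 2) * √((a ^ 2 - y ^ 2) / (c ^ 2 - y ^ 2)) : ℝ) : ℂ) := by
  rw [w_I_mul_eq, Real.sqrt_eq_rpow, Complex.ofReal_mul, Complex.ofReal_cpow h]
  norm_num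

theorem w_I_mul_of_band {y : ℝ} (h1 : a < y) (h2 : y < c) (ha : 0 < a) :
    w c a (Complex.I * y) = wPlus c a y := by
  have hp : 0 < c ^ 2 - y ^ 2 := by nlinarith
  have hn : 0 < y ^ 2 - a ^ 2 := by nlinarith
  have hneg : (a ^ 2 - y ^ 2) / (c ^ 2 - y ^ 2) ≤ 0 :=
    (div_neg_of_neg_of_pos (by linarith) hp).le
  rw [w_I_mul_eq, Complex.ofReal_cpow_of_nonpos hneg]
  have e1 : Complex.exp (Real.pi * Complex.I * (1 / 2)) = Complex.I := by
    rw [show (Real.pi * Complex.I * (1 / 2) : ℂ) = Real.pi / 2 * Complex.I by ring,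
      Complex.exp_pi_div_two_mul_I]
  have e2 : (-(((a ^ 2 - y ^ 2) / (c ^ 2 - y ^ 2) : ℝ) : ℂ)) ^ (1 / 2 : ℂ) =
      ((√((y ^ 2 - a ^ 2) / (c ^ 2 - y ^ 2)) : ℝ) : ℂ) := by
    rw [Real.sqrt_eq_rpow, Complex.ofReal_cpow (by positivity)]
    congr 1
    · rw [← Complex.ofReal_neg]
      congr 1
      rw [← neg_div]
      congr 1
      ring
    · norm_num
  have e3 : √((c ^ 2 - y ^ 2) * (y ^ 2 - a ^ 2)) =
      (c ^ 2 - y ^ 2) * √((y ^ 2 - a ^ 2) / (c ^ 2 - y ^ 2)) := by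
    rw [Real.sqrt_eq_iff_mul_self_eq (by positivity) (by positivity), eq_comm]
    have : √((y ^ 2 - a ^ 2) / (c ^ 2 - y ^ 2)) * √((y ^ 2 - a ^ 2) / (c ^ 2 - y ^ 2)) =
      (y ^ 2 - a ^ 2) / (c ^ 2 - y ^ 2) := Real.mul_self_sqrt (by positivity)
    calc _ = (c ^ 2 - y ^ 2) * (c ^ 2 - y ^ 2) * (√((y ^ 2 - a ^ 2) / (c ^ 2 - y ^ 2)) *
        √((y ^ 2 - a ^ 2) / (c ^ 2 - y ^ 2))) := by ring
      _ = _ := by rw [this]; field_simp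
  rw [e1, e2, wPlus, e3]
  push_cast
  ring

theorem norm_w_sq {k : ℂ} (hk : k ^ 2 + (c : ℂ) ^ 2 ≠ 0) :
    ‖w c a k‖ ^ 2 = ‖k - Complex.I * a‖ * ‖k + Complex.I * a‖ *
      (‖k - Complex.I * c‖ * ‖k + Complex.I * c‖) := by
  rw [← norm_pow, w_sq hk, ← norm_mul, ← norm_mul, ← norm_mul]
  congr 1
  linear_combination (-(a : ℂ) ^ 2 * (k ^ 2 + (c : ℂ) ^ 2) - (c : ℂ) ^ 2 * (k ^ 2 -
    Complex.I ^ 2 * (a : ℂ) ^ 2)) * (-1 : ℂ) * Complex.I_sq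

/-- A lower bound for `w` in the right half plane. -/
theorem le_norm_w_sq (ha : 0 < a) (hac : a < c) {k : ℂ} (hk : 0 < k.re) :
    a * c * (c - a) / 2 * k.re ≤ ‖w c a k‖ ^ 2 := by
  have hc : 0 < c := ha.trans hac
  have hmem : k ∈ bandPlane c a := cutPlane_subset_bandPlane (mem_cutPlane_of_re_ne (ne_of_gt hk))
  rw [norm_w_sq (sq_add_c_sq_ne_zero ha hac hmem)]
  -- p and r stand for the distances to the two nodes in the same vertical half plane as k, q and s
  -- for those to the other two. The near nodes are c - a apart, so one of p, r is at least (c -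
  -- a)/2, and the other is at least Re k.
  have key : ∀ p q r s : ℝ, a ≤ q → c ≤ s → k.re ≤ p → k.re ≤ r → c - a ≤ p + r →
      a * c * (c - a) / 2 * k.re ≤ p * q * (r * s) := by
    intro p q r s h1 h2 h3 h4 h5
    have hp : 0 ≤ p := hk.le.trans h3
    have hr : 0 ≤ r := hk.le.trans h4
    have h6 : (c - a) / 2 * k.re ≤ p * r := by
      rcases le_total p r with h | h
      · have : (c - a) / 2 ≤ r := by linarith
        calc _ = k.re * ((c - a) / 2) := by ring
          _ ≤ p * r := by
            apply mul_le_mul h3 this (by linarith) hp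
      · have : (c - a) / 2 ≤ p := by linarith
        apply mul_le_mul this h4 hk.le hp
    have h7 : a * c ≤ q * s := mul_le_mul h1 h2 hc.le (ha.le.trans h1)
    calc a * c * (c - a) / 2 * k.re = (a * c) * ((c - a) / 2 * k.re) := by ring
      _ ≤ (q * s) * (p * r) := by
        apply mul_le_mul h7 h6 (mul_nonneg (by linarith) hk.le)
        exact mul_nonneg (ha.le.trans h1) (hc.le.trans h2)
      _ = _ := by ring
  have hre : ∀ y : ℝ, k.re ≤ ‖k + Complex.I * y‖ := by
    intro y
    have := Complex.abs_re_le_norm (k + Complex.I * y)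
    simp only [Complex.add_re, Complex.mul_re, Complex.I_re, Complex.ofReal_re, zero_mul,
      Complex.I_im, Complex.ofReal_im, mul_zero, sub_zero, add_zero] at this
    exact (le_abs_self _).trans this
  have hre' : ∀ y : ℝ, k.re ≤ ‖k - Complex.I * y‖ := by
    intro y
    have := hre (-y)
    simpa [sub_eq_add_neg] using this
  have him : ∀ y : ℝ, |k.im + y| ≤ ‖k + Complex.I * y‖ := by
    intro y
    have := Complex.abs_im_le_norm (k + Complex.I * y)
    simpa using this
  have him' : ∀ y : ℝ, |k.im - y| ≤ ‖k - Complex.I * y‖ := by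
    intro y
    have := Complex.abs_im_le_norm (k - Complex.I * y)
    simpa using this
  rcases le_total 0 k.im with h | h
  · apply key _ _ _ _ _ _ (hre' a) (hre' c)
    · have h1 := him' a
      have h2 := him' c
      have h3 := le_abs_self (k.im - a)
      have h4 := neg_abs_le (k.im - c)
      linarith
    · exact le_trans (by rw [abs_of_nonneg (by linarith)]; linarith) (him a)
    · exact le_trans (by rw [abs_of_nonneg (by linarith)]; linarith) (him c)
  · have := key ‖k + Complex.I * a‖ ‖k - Complex.I * a‖ ‖k + Complex.I * c‖ ‖k - Complex.I * c‖
      (le_trans (by rw [abs_of_nonpos (by linarith)]; linarith) (him' a))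
      (le_trans (by rw [abs_of_nonpos (by linarith)]; linarith) (him' c)) (hre a) (hre c)
      (by
        have h1 := him a
        have h2 := him c
        have h3 := neg_abs_le (k.im + a)
        have h4 := le_abs_self (k.im + c)
        linarith)
    linarith

/-- In the first quadrant `w` has nonnegative imaginary part. -/
theorem im_w_nonneg (ha : 0 < a) (hac : a < c) {k : ℂ} (hre : 0 < k.re) (him : 0 ≤ k.im) :
    0 ≤ (w c a k).im := by
  have hmem : k ∈ bandPlane c a := cutPlane_subset_bandPlane (mem_cutPlane_of_re_ne (ne_of_gt hre))
  have hc0 := sq_add_c_sq_ne_zero ha hac hmem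
  have hq := quotient_mem_slitPlane ha hac hmem
  have hqi := im_quotient_nonneg (a := a) (c := c) (by nlinarith) hre.le him
  set q := (k ^ 2 + (a : ℂ) ^ 2) / (k ^ 2 + (c : ℂ) ^ 2) with hqd
  set u := q ^ (1 / 2 : ℂ) with hu
  have hu2 : u ^ 2 = q := by
    rw [hu, ← Complex.cpow_nat_mul]
    norm_num
  have hui : 0 ≤ u.im := by
    rw [hu, Complex.cpow_def_of_ne_zero (Complex.slitPlane_ne_zero hq), Complex.exp_im]
    apply mul_nonneg (Real.exp_pos _).le
    have e : (Complex.log q * (1 / 2)).im = q.arg / 2 := by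
      rw [show Complex.log q * (1 / 2) = Complex.log q / (2 : ℝ) by push_cast; ring,
        Complex.div_ofReal_im, Complex.log_im]
    rw [e]
    have h1 := Complex.arg_nonneg_iff.2 hqi
    have h2 := Complex.arg_le_pi q
    apply Real.sin_nonneg_of_nonneg_of_le_pi <;> linarith [Real.pi_pos]
  -- Solving u² = q for k² + c² gives w = (c² - a²)u/(1 - u²), and Im(u/(1 - u²)) has the sign of Im
  -- u.
  have hd : (1 - u ^ 2) * (k ^ 2 + (c : ℂ) ^ 2) = ((c ^ 2 - a ^ 2 : ℝ) : ℂ) := by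
    rw [hu2, hqd, sub_mul, div_mul_cancel₀ _ hc0]
    push_cast
    ring
  have hd0 : 0 < c ^ 2 - a ^ 2 := by nlinarith
  have hne : 1 - u ^ 2 ≠ 0 := by
    intro h
    rw [h, zero_mul] at hd
    have : c ^ 2 - a ^ 2 = 0 := by exact_mod_cast hd.symm
    linarith
  have hw : w c a k = ((c ^ 2 - a ^ 2 : ℝ) : ℂ) * (u / (1 - u ^ 2)) := by
    rw [← hd, w, ← hqd, ← hu]
    field_simp
  rw [hw, Complex.im_ofReal_mul, Complex.div_im, ← sub_div]
  apply mul_nonneg hd0.le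
  apply div_nonneg _ (Complex.normSq_nonneg _)
  simp only [pow_two, Complex.sub_re, Complex.one_re, Complex.mul_re, Complex.sub_im,
    Complex.one_im, Complex.mul_im]
  nlinarith [mul_nonneg hui (sq_nonneg u.re), mul_nonneg hui (sq_nonneg u.im)]

theorem w_ofReal {x : ℝ} (ha : 0 < a) (hac : a < c) :
    w c a x = (((x ^ 2 + c ^ 2) * √((x ^ 2 + a ^ 2) / (x ^ 2 + c ^ 2)) : ℝ) : ℂ) := by
  have hc : 0 < c := ha.trans hac
  have : 0 ≤ (x ^ 2 + a ^ 2) / (x ^ 2 + c ^ 2) := by positivity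
  unfold w
  rw [Real.sqrt_eq_rpow, Complex.ofReal_mul, Complex.ofReal_cpow this]
  norm_num

end Roots

/-! ### Holomorphy of the Abel integral, including the point at infinity -/

open MeasureTheory Set in
/-- On a star-shaped open set, the integrals along the segments from the origin define a primitive
of a holomorphic function. -/
theorem hasDerivAt_integral_segment {U : Set ℂ} (hU : IsOpen U)
    (hstar : ∀ x ∈ U, ∀ r : ℝ, 0 ≤ r → r ≤ 1 → (r : ℂ) * x ∈ U) {g : ℂ → ℂ}
    (hg : DifferentiableOn ℂ g U) {x : ℂ} (hx : x ∈ U) :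
    HasDerivAt (fun x => ∫ r in (0 : ℝ)..1, x * g (r * x)) (g x) x := by
  obtain ⟨ε, hε, hball⟩ := Metric.nhds_basis_closedBall.mem_iff.1 (hU.mem_nhds hx)
  have hgd : ∀ z ∈ U, HasDerivAt g (deriv g z) z := fun z hz =>
    (hg.differentiableAt (hU.mem_nhds hz)).hasDerivAt
  have hdc : ContinuousOn (deriv g) U := (hg.deriv hU).continuousOn
  let F' : ℂ → ℝ → ℂ := fun z r => g (r * z) + z * (deriv g (r * z) * r)
  have hK : IsCompact (Icc (0 : ℝ) 1 ×ˢ Metric.closedBall x ε) :=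
    isCompact_Icc.prod (isCompact_closedBall x ε)
  have hmaps : MapsTo (fun p : ℝ × ℂ => (p.1 : ℂ) * p.2) (Icc (0 : ℝ) 1 ×ˢ Metric.closedBall x ε)
      U := fun p hp => hstar _ (hball hp.2) _ hp.1.1 hp.1.2
  have hcont : ContinuousOn (fun p : ℝ × ℂ => F' p.2 p.1) (Icc (0 : ℝ) 1 ×ˢ Metric.closedBall x ε) := by
    have h1 : ContinuousOn (fun p : ℝ × ℂ => g ((p.1 : ℂ) * p.2))
        (Icc (0 : ℝ) 1 ×ˢ Metric.closedBall x ε) :=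
      hg.continuousOn.comp (by fun_prop) hmaps
    have h2 : ContinuousOn (fun p : ℝ × ℂ => deriv g ((p.1 : ℂ) * p.2))
        (Icc (0 : ℝ) 1 ×ˢ Metric.closedBall x ε) := hdc.comp (by fun_prop) hmaps
    exact h1.add (continuousOn_snd.mul (h2.mul (by fun_prop)))
  obtain ⟨C, hC⟩ := hK.exists_bound_of_continuousOn hcont
  have hseg : ∀ z ∈ U, ContinuousOn (fun r : ℝ => g (r * z)) (Icc 0 1) := fun z hz =>
    hg.continuousOn.comp (by fun_prop) fun r hr => hstar z hz r hr.1 hr.2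
  have hint : ∀ z ∈ U, IntervalIntegrable (fun r : ℝ => z * g (r * z)) volume 0 1 := by
    intro z hz
    apply ContinuousOn.intervalIntegrable
    rw [uIcc_of_le zero_le_one]
    exact continuousOn_const.mul (hseg z hz)
  have hF'int : IntervalIntegrable (F' x) volume 0 1 := by
    apply ContinuousOn.intervalIntegrable
    rw [uIcc_of_le zero_le_one]
    exact hcont.comp (f := fun r : ℝ => (r, x)) (by fun_prop)
      fun r hr => ⟨hr, Metric.mem_closedBall_self hε.le⟩
  have key := intervalIntegral.hasDerivAt_integral_of_dominated_loc_of_deriv_le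
    (F := fun z (r : ℝ) => z * g (r * z)) (F' := F') (x₀ := x) (μ := volume) (a := 0) (b := 1)
    (bound := fun _ => C) (Metric.closedBall_mem_nhds x hε)
    (by
      filter_upwards [hU.mem_nhds hx] with z hz
      exact (intervalIntegrable_iff.1 (hint z hz)).aestronglyMeasurable)
    (hint x hx)
    (intervalIntegrable_iff.1 hF'int).aestronglyMeasurable
    (by
      refine Eventually.of_forall fun r hr z hz => ?_
      rw [uIoc_of_le zero_le_one] at hr
      exact hC (r, z) ⟨⟨hr.1.le, hr.2⟩, hz⟩)
    intervalIntegrable_const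
    (by
      refine Eventually.of_forall fun r hr z hz => ?_
      rw [uIoc_of_le zero_le_one] at hr
      have h1 := hgd (r * z) (hstar z (hball hz) r hr.1.le hr.2)
      have h2 : HasDerivAt (fun z : ℂ => (r : ℂ) * z) r z := by
        simpa using (hasDerivAt_id z).const_mul (r : ℂ)
      have h3 := (hasDerivAt_id z).mul (h1.comp z h2)
      refine h3.congr_deriv ?_
      simp [F'])
  refine key.2.congr_deriv ?_
  -- The differentiated integrand is the r-derivative of r g(rx), so it integrates to g(x).
  have hftc : ∀ r ∈ uIcc (0 : ℝ) 1, HasDerivAt (fun r : ℝ => (r : ℂ) * g (r * x)) (F' x r) r := by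
    intro r hr
    rw [uIcc_of_le zero_le_one] at hr
    have h1 := hgd (r * x) (hstar x hx r hr.1 hr.2)
    have h2 : HasDerivAt (fun r : ℝ => (r : ℂ) * x) x r := by
      simpa using (Complex.ofRealCLM.hasDerivAt (x := r)).mul_const x
    have h3 : HasDerivAt (fun r : ℝ => g (r * x)) (deriv g (r * x) * x) r :=
      h1.comp r h2
    have h4 := (Complex.ofRealCLM.hasDerivAt (x := r)).mul h3
    refine h4.congr_deriv ?_
    simp only [Complex.ofRealCLM_apply, Complex.ofReal_one, one_mul, F']
    ring
  rw [intervalIntegral.integral_eq_sub_of_hasDerivAt hftc hF'int]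
  simp

section Abel

variable {c a : ℝ}

/-- The primitive `-∫_k^∞ dζ / w` along rays. -/
noncomputable def abelPrim (c a : ℝ) (k : ℂ) : ℂ := -∫ s in Set.Ioi (1 : ℝ), k / w c a ((s : ℂ) * k)

theorem abel_eq (c a : ℝ) (k : ℂ) : abel c a k = abelInfty c a + Gam c a * abelPrim c a k := by
  rw [abel, abelPrim]
  ring

theorem abelPrim_neg (c a : ℝ) (k : ℂ) : abelPrim c a (-k) = -abelPrim c a k := by
  simp only [abelPrim, mul_neg, w_neg, neg_div]
  rw [MeasureTheory.integral_neg]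

theorem mul_mem_cutPlane {k : ℂ} (hk : k ∈ cutPlane c) {s : ℝ} (hs : 1 ≤ s) :
    (s : ℂ) * k ∈ cutPlane c := by
  rintro ⟨h1, h2⟩
  simp only [Complex.re_ofReal_mul, Complex.im_ofReal_mul] at h1 h2
  apply hk
  refine ⟨(mul_eq_zero.1 h1).resolve_left (by linarith), ?_⟩
  rw [abs_mul, abs_of_nonneg (by linarith)] at h2
  nlinarith [abs_nonneg k.im]

theorem abelPrim_conj (ha : 0 < a) (hac : a < c) {k : ℂ} (hk : k ∈ cutPlane c) :
    abelPrim c a ((starRingEnd ℂ) k) = (starRingEnd ℂ) (abelPrim c a k) := by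
  unfold abelPrim
  rw [map_neg, ← integral_conj]
  congr 1
  apply MeasureTheory.setIntegral_congr_fun measurableSet_Ioi
  intro s hs
  have h1 := w_conj ha hac (cutPlane_subset_bandPlane (a := a)
    (mul_mem_cutPlane hk (le_of_lt hs)))
  simp only [map_mul, Complex.conj_ofReal] at h1
  simp only [map_div₀, h1]

/-- The reciprocal of the root in the local coordinate `1 / k` at infinity. -/
noncomputable def invRoot (c a : ℝ) (x : ℂ) : ℂ :=
  ((1 + (c : ℂ) ^ 2 * x ^ 2) *
    ((1 + (a : ℂ) ^ 2 * x ^ 2) / (1 + (c : ℂ) ^ 2 * x ^ 2)) ^ (1 / 2 : ℂ))⁻¹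

theorem inv_quotient_eq {k : ℂ} (hk : k ≠ 0) (u : ℝ) :
    1 + (u : ℂ) ^ 2 * k⁻¹ ^ 2 = (k ^ 2 + (u : ℂ) ^ 2) / k ^ 2 := by
  field_simp

/-- With x = 1/k one has dk/w = -`invRoot`(x) dx, and `invRoot` is holomorphic at x = 0: the
differential is regular at infinity. -/
theorem inv_w_eq {k : ℂ} (hk : k ≠ 0) : (w c a k)⁻¹ = invRoot c a k⁻¹ * k⁻¹ ^ 2 := by
  have hk2 : k ^ 2 ≠ 0 := pow_ne_zero 2 hk
  rw [invRoot, inv_quotient_eq hk, inv_quotient_eq hk, div_div_div_cancel_right₀ hk2, w]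
  rw [mul_inv, mul_inv, inv_div, inv_pow]
  field_simp

/-- The image of the cut plane, with infinity, under `k ↦ 1 / k`. -/
def invCutPlane (c : ℝ) : Set ℂ := {x | ¬ (x.re = 0 ∧ 1 ≤ c * |x.im|)}

theorem isOpen_invCutPlane (c : ℝ) : IsOpen (invCutPlane c) := by
  have : invCutPlane c = {k : ℂ | k.re = 0 ∧ 1 ≤ c * |k.im|}ᶜ := rfl
  rw [this, isOpen_compl_iff]
  apply IsClosed.inter
  · exact isClosed_eq Complex.continuous_re continuous_const
  · exact isClosed_le continuous_const (continuous_const.mul (Complex.continuous_im.abs))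

theorem mul_mem_invCutPlane (hc : 0 < c) {x : ℂ} (hx : x ∈ invCutPlane c) {r : ℝ} (h0 : 0 ≤ r)
    (h1 : r ≤ 1) : (r : ℂ) * x ∈ invCutPlane c := by
  rintro ⟨h2, h3⟩
  simp only [Complex.re_ofReal_mul, Complex.im_ofReal_mul] at h2 h3
  rw [abs_mul, abs_of_nonneg h0] at h3
  have hr : r ≠ 0 := by
    rintro rfl
    simp at h3
    linarith
  refine hx ⟨(mul_eq_zero.1 h2).resolve_left hr, ?_⟩
  nlinarith [mul_nonneg hc.le (abs_nonneg x.im)]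

theorem inv_mem_invCutPlane {k : ℂ} (hc : 0 < c) (hk : k ∈ cutPlane c) :
    k⁻¹ ∈ invCutPlane c := by
  rintro ⟨h1, h2⟩
  have hk0 : k ≠ 0 := by
    rintro rfl
    exact hk (by simp [hc.le])
  rw [Complex.inv_re, div_eq_zero_iff] at h1
  have hre : k.re = 0 := h1.resolve_right (by simpa using hk0)
  refine hk ⟨hre, ?_⟩
  have him : k.im ≠ 0 := fun h => hk0 (Complex.ext hre h)
  rw [Complex.inv_im, Complex.normSq_apply, hre, abs_div, abs_neg] at h2
  have h3 : |0 * 0 + k.im * k.im| = |k.im| * |k.im| := by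
    rw [zero_mul, zero_add, abs_mul]
  rw [h3] at h2
  have h4 : 0 < |k.im| := abs_pos.2 him
  have h5 : c * (|k.im| / (|k.im| * |k.im|)) = c / |k.im| := by field_simp
  rw [h5, le_div_iff₀ h4] at h2
  linarith

theorem inv_mem_cutPlane {x : ℂ} (hx : x ∈ invCutPlane c) (hx0 : x ≠ 0) :
    x⁻¹ ∈ cutPlane c := by
  rintro ⟨h1, h2⟩
  rw [Complex.inv_re, div_eq_zero_iff] at h1
  have hre : x.re = 0 := h1.resolve_right (by simpa using hx0)
  refine hx ⟨hre, ?_⟩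
  have him : x.im ≠ 0 := fun h => hx0 (Complex.ext hre h)
  rw [Complex.inv_im, Complex.normSq_apply, hre, abs_div, abs_neg] at h2
  have h3 : |0 * 0 + x.im * x.im| = |x.im| * |x.im| := by
    rw [zero_mul, zero_add, abs_mul]
  rw [h3] at h2
  have h4 : 0 < |x.im| := abs_pos.2 him
  have h5 : (|x.im| / (|x.im| * |x.im|)) = 1 / |x.im| := by field_simp
  rw [h5, div_le_iff₀ h4] at h2
  linarith

theorem differentiableOn_invRoot (ha : 0 < a) (hac : a < c) :
    DifferentiableOn ℂ (invRoot c a) (invCutPlane c) := by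
  intro x hx
  apply DifferentiableAt.differentiableWithinAt
  have key : 1 + (c : ℂ) ^ 2 * x ^ 2 ≠ 0 ∧
      (1 + (a : ℂ) ^ 2 * x ^ 2) / (1 + (c : ℂ) ^ 2 * x ^ 2) ∈ Complex.slitPlane := by
    by_cases hx0 : x = 0
    · rw [hx0]
      simp
    · have hk := cutPlane_subset_bandPlane (a := a) (inv_mem_cutPlane hx hx0)
      have hx1 : x⁻¹ ≠ 0 := inv_ne_zero hx0
      have h1 := inv_quotient_eq hx1 c
      have h2 := inv_quotient_eq hx1 a
      rw [inv_inv] at h1 h2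
      rw [h1, h2, div_div_div_cancel_right₀ (pow_ne_zero 2 hx1)]
      exact ⟨div_ne_zero (sq_add_c_sq_ne_zero ha hac hk) (pow_ne_zero 2 hx1),
        quotient_mem_slitPlane ha hac hk⟩
  unfold invRoot
  apply DifferentiableAt.inv
  · apply DifferentiableAt.mul (by fun_prop)
    exact DifferentiableAt.cpow_const (DifferentiableAt.div (by fun_prop) (by fun_prop) key.1) key.2
  · apply mul_ne_zero key.1
    rw [Complex.cpow_ne_zero_iff]
    exact Or.inl (Complex.slitPlane_ne_zero key.2)

/-- The primitive of the differential in the local coordinate at infinity. -/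
noncomputable def invPrim (c a : ℝ) (x : ℂ) : ℂ := ∫ r in (0 : ℝ)..1, x * invRoot c a (r * x)

theorem hasDerivAt_invPrim (ha : 0 < a) (hac : a < c) {x : ℂ} (hx : x ∈ invCutPlane c) :
    HasDerivAt (invPrim c a) (invRoot c a x) x :=
  hasDerivAt_integral_segment (isOpen_invCutPlane c)
    (fun _ hx _ h0 h1 => mul_mem_invCutPlane (ha.trans hac) hx h0 h1)
    (differentiableOn_invRoot ha hac) hx

theorem zero_mem_invCutPlane (c : ℝ) : (0 : ℂ) ∈ invCutPlane c := by
  rintro ⟨-, h⟩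
  simp at h
  linarith

theorem ne_zero_of_mem_cutPlane (hc : 0 < c) {k : ℂ} (hk : k ∈ cutPlane c) : k ≠ 0 := by
  rintro rfl
  exact hk (by simp [hc.le])

-- Inversion turns the ray from k to infinity into the segment from 1/k to 0. This yields holomorphy
-- on the cut plane and the vanishing at infinity together.
open MeasureTheory Set in
theorem abelPrim_eq_invPrim (ha : 0 < a) (hac : a < c) {k : ℂ} (hk : k ∈ cutPlane c) :
    abelPrim c a k = -invPrim c a k⁻¹ := by
  have hc := ha.trans hac
  have hk0 := ne_zero_of_mem_cutPlane hc hk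
  have hinv := inv_mem_invCutPlane hc hk
  have hmem : ∀ s : ℝ, 1 ≤ s → ((s⁻¹ : ℝ) : ℂ) * k⁻¹ ∈ invCutPlane c := fun s hs =>
    mul_mem_invCutPlane hc hinv (by positivity) (inv_le_one_of_one_le₀ hs)
  have hd : ∀ s : ℝ, 1 ≤ s → HasDerivAt (fun s : ℝ => -invPrim c a (((s⁻¹ : ℝ) : ℂ) * k⁻¹))
      (k / w c a ((s : ℂ) * k)) s := by
    intro s hs
    have hs0 : s ≠ 0 := by linarith
    have hsC : (s : ℂ) ≠ 0 := by exact_mod_cast hs0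
    have h1 := hasDerivAt_invPrim ha hac (hmem s hs)
    have h2 : HasDerivAt (fun s : ℝ => ((s⁻¹ : ℝ) : ℂ) * k⁻¹) (((-(s ^ 2)⁻¹ : ℝ) : ℂ) * k⁻¹) s := by
      exact ((hasDerivAt_inv hs0).ofReal_comp).mul_const k⁻¹
    have h3 := (h1.comp s h2).neg
    refine h3.congr_deriv ?_
    rw [div_eq_mul_inv, inv_w_eq (mul_ne_zero hsC hk0)]
    have : ((s : ℂ) * k)⁻¹ = ((s⁻¹ : ℝ) : ℂ) * k⁻¹ := by
      rw [mul_inv]; push_cast; rfl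
    rw [this]
    push_cast
    field_simp
  have hlim : Tendsto (fun s : ℝ => -invPrim c a (((s⁻¹ : ℝ) : ℂ) * k⁻¹)) atTop (𝓝 0) := by
    have h0 : ContinuousAt (invPrim c a) 0 :=
      (hasDerivAt_invPrim ha hac (zero_mem_invCutPlane c)).continuousAt
    have h1 : invPrim c a 0 = 0 := by simp [invPrim]
    have h2 : Tendsto (fun s : ℝ => ((s⁻¹ : ℝ) : ℂ) * k⁻¹) atTop (𝓝 0) := by
      have := ((Complex.continuous_ofReal.tendsto 0).comp tendsto_inv_atTop_zero).mul_const k⁻¹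
      simpa [Function.comp_def] using this
    have h3 := (h0.tendsto.comp h2).neg
    rw [h1, neg_zero] at h3
    exact h3
  have hint : IntegrableOn (fun s : ℝ => k / w c a ((s : ℂ) * k)) (Ioi 1) := by
    obtain ⟨C, hC⟩ := (isCompact_Icc (a := (0 : ℝ)) (b := 1)).exists_bound_of_continuousOn
      (f := fun r : ℝ => invRoot c a (r * k⁻¹))
      ((differentiableOn_invRoot ha hac).continuousOn.comp (by fun_prop)
        fun r hr => mul_mem_invCutPlane hc hinv hr.1 hr.2)
    have hb : IntegrableOn (fun s : ℝ => C * ‖k⁻¹‖ * s ^ (-2 : ℝ)) (Ioi 1) :=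
      (integrableOn_Ioi_rpow_of_lt (by norm_num) one_pos).const_mul _
    refine Integrable.mono' hb ?_ ?_
    · apply ContinuousOn.aestronglyMeasurable _ measurableSet_Ioi
      intro s hs
      apply ContinuousAt.continuousWithinAt
      have hm := cutPlane_subset_bandPlane (a := a) (mul_mem_cutPlane hk (le_of_lt hs))
      have hw : ContinuousAt (fun s : ℝ => w c a ((s : ℂ) * k)) s :=
        (differentiableAt_w ha hac hm).continuousAt.comp (f := fun s : ℝ => (s : ℂ) * k)
          (by fun_prop)
      exact continuousAt_const.div hw (w_ne_zero ha hac hm)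
    · filter_upwards [ae_restrict_mem measurableSet_Ioi] with s hs
      have hs0 : 0 < s := one_pos.trans hs
      have hsC : (s : ℂ) ≠ 0 := by exact_mod_cast hs0.ne'
      have e1 : k / w c a ((s : ℂ) * k) =
          invRoot c a (((s⁻¹ : ℝ) : ℂ) * k⁻¹) * k⁻¹ * ((s : ℂ) ^ 2)⁻¹ := by
        rw [div_eq_mul_inv, inv_w_eq (mul_ne_zero hsC hk0)]
        have : ((s : ℂ) * k)⁻¹ = ((s⁻¹ : ℝ) : ℂ) * k⁻¹ := by
          rw [mul_inv]; push_cast; rfl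
        rw [this]
        push_cast
        field_simp
      have e2 : ‖((s : ℂ) ^ 2)⁻¹‖ = s ^ (-2 : ℝ) := by
        rw [norm_inv, norm_pow, Complex.norm_real, Real.norm_of_nonneg hs0.le,
          Real.rpow_neg hs0.le]
        norm_num
      rw [e1, norm_mul, norm_mul, e2]
      have := hC s⁻¹ ⟨by positivity, inv_le_one_of_one_le₀ (le_of_lt hs)⟩
      gcongr
  have := integral_Ioi_of_hasDerivAt_of_tendsto' (fun s hs => hd s hs) hint hlim
  rw [abelPrim, this]
  simp

theorem hasDerivAt_abelPrim (ha : 0 < a) (hac : a < c) {k : ℂ} (hk : k ∈ cutPlane c) :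
    HasDerivAt (abelPrim c a) (w c a k)⁻¹ k := by
  have hc := ha.trans hac
  have hk0 := ne_zero_of_mem_cutPlane hc hk
  have h1 := ((hasDerivAt_invPrim ha hac (inv_mem_invCutPlane hc hk)).comp k
    (hasDerivAt_inv hk0)).neg
  have h2 : HasDerivAt (fun k => -invPrim c a k⁻¹) (w c a k)⁻¹ k := by
    refine h1.congr_deriv ?_
    rw [inv_w_eq hk0]
    field_simp
  refine h2.congr_of_eventuallyEq ?_
  filter_upwards [(isOpen_cutPlane c).mem_nhds hk] with z hz using abelPrim_eq_invPrim ha hac hz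

theorem eventually_cocompact_mem_cutPlane (c : ℝ) : ∀ᶠ k : ℂ in cocompact ℂ, k ∈ cutPlane c := by
  have := (isCompact_closedBall (0 : ℂ) c).compl_mem_cocompact
  filter_upwards [this] with k hk
  rintro ⟨h1, h2⟩
  apply hk
  rw [eq_I_mul_im h1]
  simpa using h2

theorem tendsto_abelPrim_cocompact (ha : 0 < a) (hac : a < c) :
    Tendsto (abelPrim c a) (cocompact ℂ) (𝓝 0) := by
  have h0 : ContinuousAt (invPrim c a) 0 :=
    (hasDerivAt_invPrim ha hac (zero_mem_invCutPlane c)).continuousAt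
  have h1 : invPrim c a 0 = 0 := by simp [invPrim]
  have h2 : Tendsto (fun k : ℂ => k⁻¹) (cocompact ℂ) (𝓝 0) := by
    rw [← Metric.cobounded_eq_cocompact]
    exact tendsto_inv₀_cobounded
  have h3 := (h0.tendsto.comp h2).neg
  rw [h1, neg_zero] at h3
  refine h3.congr' ?_
  filter_upwards [eventually_cocompact_mem_cutPlane c] with k hk
  exact (abelPrim_eq_invPrim ha hac hk).symm

end Abel

/-! ### The Abel integral up to the imaginary axis -/

section Extension

variable {c a : ℝ}

/-- The continuous extension of the primitive from the right half plane to its closure. -/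
noncomputable def abelExt (c a : ℝ) (k : ℂ) : ℂ :=
  abelPrim c a 1 + (k - 1) * ∫ s in (0 : ℝ)..1, (w c a (1 + s * (k - 1)))⁻¹

theorem measurable_w (c a : ℝ) : Measurable (w c a) := by
  unfold w
  fun_prop

theorem re_segment {k : ℂ} {s : ℝ} : (1 + (s : ℂ) * (k - 1)).re = 1 - s + s * k.re := by
  simp
  ring

-- Dominated convergence along the segment from 1 to k. The bound for |w|² is linear in the real
-- part, which is at least 1 - s at parameter s, so the integrand is at most a constant times (1 -
-- s)^(-1/2), uniformly in k and also at the nodes.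
open MeasureTheory Set in
theorem continuousOn_abelExt (ha : 0 < a) (hac : a < c) :
    ContinuousOn (abelExt c a) {k | 0 ≤ k.re} := by
  intro k₀ hk₀
  unfold abelExt
  apply ContinuousWithinAt.add continuousWithinAt_const
  apply ContinuousWithinAt.mul (by fun_prop)
  set A := a * c * (c - a) / 2 with hA
  have hc := ha.trans hac
  have hA0 : 0 < A := by
    have : 0 < c - a := by linarith
    positivity
  have hae : ∀ᵐ s : ℝ ∂volume, s ≠ 1 := by
    rw [ae_iff]
    simp
  apply intervalIntegral.continuousWithinAt_of_dominated_interval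
    (bound := fun s => (√A)⁻¹ * (1 - s) ^ (-(1 / 2) : ℝ))
  · refine Eventually.of_forall fun k => ?_
    apply Measurable.aestronglyMeasurable
    exact ((measurable_w c a).comp (by fun_prop)).inv
  · filter_upwards [self_mem_nhdsWithin] with k hk
    filter_upwards [hae] with s hs1 hs
    rw [uIoc_of_le zero_le_one] at hs
    have hs' : 0 < 1 - s := by
      have := lt_of_le_of_ne hs.2 hs1
      linarith
    have hre : 1 - s ≤ (1 + (s : ℂ) * (k - 1)).re := by
      rw [re_segment]
      have := mul_nonneg hs.1.le hk
      linarith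
    have h1 := le_norm_w_sq ha hac (hs'.trans_le hre)
    have h2 : A * (1 - s) ≤ ‖w c a (1 + s * (k - 1))‖ ^ 2 :=
      (mul_le_mul_of_nonneg_left hre hA0.le).trans h1
    have h3 : √(A * (1 - s)) ≤ ‖w c a (1 + s * (k - 1))‖ := by
      rw [Real.sqrt_le_left (norm_nonneg _)]
      exact h2
    have h4 : (√A)⁻¹ * (1 - s) ^ (-(1 / 2) : ℝ) = (√(A * (1 - s)))⁻¹ := by
      rw [Real.sqrt_mul hA0.le, mul_inv, Real.rpow_neg hs'.le, ← Real.sqrt_eq_rpow]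
    rw [h4, norm_inv]
    apply inv_anti₀ _ h3
    rw [Real.sqrt_pos]
    positivity
  · have := intervalIntegral.intervalIntegrable_rpow' (a := 1) (b := 0) (r := -(1 / 2))
      (by norm_num)
    have := (this.comp_sub_left 1).const_mul (√A)⁻¹
    simpa using this
  · filter_upwards [hae] with s hs1 hs
    rw [uIoc_of_le zero_le_one] at hs
    have hs' : 0 < 1 - s := by
      have := lt_of_le_of_ne hs.2 hs1
      linarith
    have hre : 0 < (1 + (s : ℂ) * (k₀ - 1)).re := by
      rw [re_segment]
      have := mul_nonneg hs.1.le hk₀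
      linarith
    have hm := cutPlane_subset_bandPlane (c := c) (a := a) (mem_cutPlane_of_re_ne (ne_of_gt hre))
    apply ContinuousAt.continuousWithinAt
    have h1 : ContinuousAt (fun k : ℂ => w c a (1 + (s : ℂ) * (k - 1))) k₀ :=
      (differentiableAt_w ha hac hm).continuousAt.comp
        (f := fun k : ℂ => 1 + (s : ℂ) * (k - 1)) (by fun_prop)
    exact h1.inv₀ (w_ne_zero ha hac hm)

open MeasureTheory Set in
theorem abelExt_eq (ha : 0 < a) (hac : a < c) {k : ℂ} (hk : 0 < k.re) :
    abelExt c a k = abelPrim c a k := by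
  have hre : ∀ s ∈ uIcc (0 : ℝ) 1, 0 < (1 + (s : ℂ) * (k - 1)).re := by
    intro s hs
    rw [uIcc_of_le zero_le_one] at hs
    rw [re_segment]
    rcases hs.2.lt_or_eq with h | h
    · have := mul_nonneg hs.1 hk.le
      linarith
    · rw [h]
      linarith
  have hd : ∀ s ∈ uIcc (0 : ℝ) 1, HasDerivAt (fun s : ℝ => abelPrim c a (1 + s * (k - 1)))
      ((k - 1) * (w c a (1 + s * (k - 1)))⁻¹) s := by
    intro s hs
    have h1 := hasDerivAt_abelPrim ha hac (mem_cutPlane_of_re_ne (c := c) (ne_of_gt (hre s hs)))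
    have h2 : HasDerivAt (fun s : ℝ => 1 + (s : ℂ) * (k - 1)) (k - 1) s := by
      simpa using ((Complex.ofRealCLM.hasDerivAt (x := s)).mul_const (k - 1)).const_add 1
    exact (h1.comp s h2).congr_deriv (mul_comm _ _)
  have hint : IntervalIntegrable (fun s : ℝ => (k - 1) * (w c a (1 + s * (k - 1)))⁻¹) volume 0 1 := by
    apply ContinuousOn.intervalIntegrable
    apply ContinuousOn.mul continuousOn_const
    intro s hs
    apply ContinuousAt.continuousWithinAt
    have hm := cutPlane_subset_bandPlane (c := c) (a := a)
      (mem_cutPlane_of_re_ne (ne_of_gt (hre s hs)))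
    have h1 : ContinuousAt (fun s : ℝ => w c a (1 + (s : ℂ) * (k - 1))) s :=
      (differentiableAt_w ha hac hm).continuousAt.comp
        (f := fun s : ℝ => 1 + (s : ℂ) * (k - 1)) (by fun_prop)
    exact h1.inv₀ (w_ne_zero ha hac hm)
  have := intervalIntegral.integral_eq_sub_of_hasDerivAt hd hint
  rw [intervalIntegral.integral_const_mul] at this
  rw [abelExt, this]
  simp

theorem setOf_re_nonneg_eq_closure : {k : ℂ | 0 ≤ k.re} = closure {k : ℂ | 0 < k.re} := by
  rw [Complex.closure_setOfPred_lt_re]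

theorem tendsto_abelExt (ha : 0 < a) (hac : a < c) (y : ℝ) :
    Tendsto (abelPrim c a) (𝓝[{z : ℂ | 0 < z.re}] (Complex.I * y))
      (𝓝 (abelExt c a (Complex.I * y))) := by
  have h := continuousOn_abelExt ha hac (Complex.I * y) (by simp)
  have h1 : Tendsto (abelExt c a) (𝓝[{z : ℂ | 0 < z.re}] (Complex.I * y))
      (𝓝 (abelExt c a (Complex.I * y))) :=
    h.tendsto.mono_left (nhdsWithin_mono _ fun z (hz : 0 < z.re) => hz.le)
  refine h1.congr' ?_
  filter_upwards [self_mem_nhdsWithin] with z hz using abelExt_eq ha hac hz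

/-- The extension agrees with the primitive on the part of the imaginary axis off the segment. -/
theorem abelExt_eq_of_mem_cutPlane (ha : 0 < a) (hac : a < c) {k : ℂ} (hk : k ∈ cutPlane c)
    (h0 : 0 ≤ k.re) : abelExt c a k = abelPrim c a k := by
  rcases h0.lt_or_eq with h | h
  · exact abelExt_eq ha hac h
  · have hk' : k = Complex.I * k.im := eq_I_mul_im h.symm
    have h1 := tendsto_abelExt ha hac k.im
    have := nhdsWithin_right_neBot k.im
    rw [← hk'] at h1 this
    refine tendsto_nhds_unique h1 ?_
    exact (hasDerivAt_abelPrim ha hac hk).continuousAt.tendsto.mono_left nhdsWithin_le_nhds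

theorem abelExt_neg_im (ha : 0 < a) (hac : a < c) (y : ℝ) :
    abelExt c a (Complex.I * (-y : ℝ)) = (starRingEnd ℂ) (abelExt c a (Complex.I * y)) := by
  have h1 := (tendsto_abelExt ha hac (-y)).comp (tendsto_conj_right y)
  have h2 := (Complex.continuous_conj.tendsto _).comp (tendsto_abelExt ha hac y)
  have := nhdsWithin_right_neBot y
  refine tendsto_nhds_unique h1 (h2.congr' ?_)
  filter_upwards [self_mem_nhdsWithin] with z hz
  exact (abelPrim_conj ha hac (mem_cutPlane_of_re_ne (ne_of_gt hz))).symm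

theorem wRight_ne_zero (ha : 0 < a) (hac : a < c) {y : ℝ} (h1 : |y| ≠ a) (h2 : |y| ≠ c) :
    wRight c a y ≠ 0 := by
  apply mul_ne_zero _ (pow_ne_zero 2 (gammaRight_ne_zero ha hac h1 h2))
  apply sq_add_sq_ne_zero_of_re_im
  rintro ⟨-, h3⟩
  rw [abs_of_pos (ha.trans hac)] at h3
  apply h2
  simpa using h3

/-- The extension is differentiable up to the boundary away from the nodes. -/
theorem hasFDerivWithinAt_abelExt (ha : 0 < a) (hac : a < c) {y : ℝ} (h1 : |y| ≠ a)
    (h2 : |y| ≠ c) :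
    HasFDerivWithinAt (abelExt c a) ((wRight c a y)⁻¹ • (1 : ℂ →L[ℝ] ℂ)) {k : ℂ | 0 ≤ k.re}
      (Complex.I * y) := by
  have hopen : IsOpen {k : ℂ | 0 < k.re} := isOpen_lt continuous_const Complex.continuous_re
  have hd : ∀ k ∈ {k : ℂ | 0 < k.re}, HasFDerivAt (abelExt c a)
      ((w c a k)⁻¹ • (1 : ℂ →L[ℝ] ℂ)) k := by
    intro k hk
    have h3 := hasDerivAt_abelPrim ha hac (mem_cutPlane_of_re_ne (c := c) (ne_of_gt hk))
    have h4 : HasDerivAt (abelExt c a) (w c a k)⁻¹ k := by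
      refine h3.congr_of_eventuallyEq ?_
      filter_upwards [hopen.mem_nhds hk] with z hz using abelExt_eq ha hac hz
    exact h4.complexToReal_fderiv
  rw [setOf_re_nonneg_eq_closure]
  -- On a convex open set, continuity up to the boundary and a limit of the derivative give
  -- differentiability within the closure. The criterion is one for real derivatives, hence the
  -- real-linear maps.
  apply hasFDerivWithinAt_closure_of_tendsto_fderiv
  · exact fun k hk => (hd k hk).differentiableAt.differentiableWithinAt
  · exact convex_halfSpace_re_gt 0
  · exact hopen
  · rw [← setOf_re_nonneg_eq_closure]
    intro k hk
    exact (continuousOn_abelExt ha hac k hk).mono fun z (hz : 0 < z.re) => hz.le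
  · have h3 : Tendsto (fun k => (w c a k)⁻¹ • (1 : ℂ →L[ℝ] ℂ))
        (𝓝[{z : ℂ | 0 < z.re}] (Complex.I * y)) (𝓝 ((wRight c a y)⁻¹ • (1 : ℂ →L[ℝ] ℂ))) :=
      ((tendsto_w_right ha hac h1 h2).inv₀ (wRight_ne_zero ha hac h1 h2)).smul_const _
    refine h3.congr' ?_
    filter_upwards [self_mem_nhdsWithin] with z hz using ((hd z hz).fderiv).symm

theorem hasDerivAt_abelExt_I_mul (ha : 0 < a) (hac : a < c) {y : ℝ} (h1 : |y| ≠ a)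
    (h2 : |y| ≠ c) :
    HasDerivAt (fun y : ℝ => abelExt c a (Complex.I * y)) (Complex.I / wRight c a y) y := by
  have h3 := hasFDerivWithinAt_abelExt ha hac h1 h2
  have h4 : HasDerivWithinAt (fun y : ℝ => Complex.I * (y : ℂ)) Complex.I Set.univ y := by
    have := ((Complex.ofRealCLM.hasDerivAt (x := y)).const_mul Complex.I).hasDerivWithinAt
      (s := Set.univ)
    simpa using this
  have h5 := h3.comp_hasDerivWithinAt y h4 (fun z _ => by simp)
  rw [hasDerivWithinAt_univ] at h5
  refine h5.congr_deriv ?_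
  simp
  rw [div_eq_mul_inv, mul_comm]

theorem continuous_abelExt_I_mul (ha : 0 < a) (hac : a < c) :
    Continuous fun y : ℝ => abelExt c a (Complex.I * y) := by
  have h := (continuousOn_abelExt ha hac).comp_continuous (f := fun y : ℝ => Complex.I * (y : ℂ))
    (by fun_prop) (by intro y; simp)
  exact h

end Extension

/-! ### Half periods, and the values of Γ, τ and A(∞) -/

section Periods

variable {c a : ℝ}

/-- The real half period. -/
noncomputable def periodK (c a : ℝ) : ℝ := (abelExt c a (Complex.I * a)).im

/-- The imaginary half period. -/
noncomputable def periodL (c a : ℝ) : ℝ := -(abelExt c a (Complex.I * a)).re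

theorem hasDerivAt_re_im_abelExt (ha : 0 < a) (hac : a < c) {y : ℝ} (h1 : |y| ≠ a)
    (h2 : |y| ≠ c) :
    HasDerivAt (fun y : ℝ => (abelExt c a (Complex.I * y)).re) (Complex.I / wRight c a y).re y ∧
    HasDerivAt (fun y : ℝ => (abelExt c a (Complex.I * y)).im) (Complex.I / wRight c a y).im y := by
  have h := hasDerivAt_abelExt_I_mul ha hac h1 h2
  exact ⟨Complex.reCLM.hasFDerivAt.comp_hasDerivAt y h,
    Complex.imCLM.hasFDerivAt.comp_hasDerivAt y h⟩

/-- The value of `w` in the gap. -/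
noncomputable def gapRoot (c a y : ℝ) : ℝ := (c ^ 2 - y ^ 2) * √((a ^ 2 - y ^ 2) / (c ^ 2 - y ^ 2))

theorem gapRoot_pos (hac : a < c) {y : ℝ} (h : |y| < a) : 0 < gapRoot c a y := by
  have ha : 0 < a := (abs_nonneg y).trans_lt h
  have h1 : y ^ 2 < a ^ 2 := by
    rw [← sq_abs y]
    exact pow_lt_pow_left₀ h (abs_nonneg y) two_ne_zero
  have h2 : a ^ 2 < c ^ 2 := pow_lt_pow_left₀ hac ha.le two_ne_zero
  have h3 : 0 < c ^ 2 - y ^ 2 := by linarith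
  have h4 : 0 < a ^ 2 - y ^ 2 := by linarith
  unfold gapRoot
  positivity

theorem w_gap (hac : a < c) {y : ℝ} (h : |y| < a) :
    w c a (Complex.I * y) = gapRoot c a y := by
  have ha : 0 < a := (abs_nonneg y).trans_lt h
  have h1 : y ^ 2 < a ^ 2 := by
    rw [← sq_abs y]
    exact pow_lt_pow_left₀ h (abs_nonneg y) two_ne_zero
  have h2 : a ^ 2 < c ^ 2 := pow_lt_pow_left₀ hac ha.le two_ne_zero
  have h3 : 0 < c ^ 2 - y ^ 2 := by linarith
  have h4 : 0 < a ^ 2 - y ^ 2 := by linarith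
  exact w_I_mul_of_nonneg (by positivity)

theorem wRight_of_gap (hac : a < c) {y : ℝ} (h : |y| < a) :
    wRight c a y = gapRoot c a y := by
  rw [wRight_eq_w (abs_lt.1 h).1.le, w_gap hac h]

theorem I_div_gap (hac : a < c) {y : ℝ} (h : |y| < a) :
    Complex.I / wRight c a y = ((1 / gapRoot c a y : ℝ) : ℂ) * Complex.I := by
  rw [wRight_of_gap hac h]
  push_cast
  ring

/-- On the axis the derivative is i/w₊. In the gap w is real and only the imaginary part of the
primitive moves; on the upper band w₊ is imaginary and only the real part moves; beyond ic it is the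
imaginary part again. The upper half axis thus traces three sides of a rectangle, with corners -L,
-L + iK, iK and 0. -/
theorem gap_hasDerivAt (ha : 0 < a) (hac : a < c) {y : ℝ} (h : |y| < a) :
    HasDerivAt (fun y : ℝ => (abelExt c a (Complex.I * y)).re) 0 y ∧
    HasDerivAt (fun y : ℝ => (abelExt c a (Complex.I * y)).im) (1 / gapRoot c a y) y := by
  have h1 := hasDerivAt_re_im_abelExt ha hac h.ne (h.trans hac).ne
  rw [I_div_gap hac h] at h1
  simpa only [Complex.re_ofReal_mul, Complex.I_re, mul_zero, Complex.im_ofReal_mul, Complex.I_im,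
    mul_one] using h1


theorem eq_of_hasDerivAt_zero {D : Set ℝ} (hD : Convex ℝ D) {f : ℝ → ℝ} (hf : ContinuousOn f D)
    (hf' : ∀ x ∈ interior D, HasDerivAt f 0 x) {x y : ℝ} (hx : x ∈ D) (hy : y ∈ D) : f x = f y := by
  have h1 := monotoneOn_of_deriv_nonneg hD hf
    (fun x hx => (hf' x hx).differentiableAt.differentiableWithinAt)
    (fun x hx => (hf' x hx).deriv.ge)
  have h2 := antitoneOn_of_deriv_nonpos hD hf
    (fun x hx => (hf' x hx).differentiableAt.differentiableWithinAt)
    (fun x hx => (hf' x hx).deriv.le)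
  rcases le_total x y with h | h
  · exact le_antisymm (h1 hx hy h) (h2 hx hy h)
  · exact le_antisymm (h2 hy hx h) (h1 hy hx h)

theorem continuous_re_abelExt (ha : 0 < a) (hac : a < c) :
    Continuous fun y : ℝ => (abelExt c a (Complex.I * y)).re :=
  Complex.continuous_re.comp (continuous_abelExt_I_mul ha hac)

theorem continuous_im_abelExt (ha : 0 < a) (hac : a < c) :
    Continuous fun y : ℝ => (abelExt c a (Complex.I * y)).im :=
  Complex.continuous_im.comp (continuous_abelExt_I_mul ha hac)

theorem re_abelExt_neg (ha : 0 < a) (hac : a < c) (y : ℝ) :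
    (abelExt c a (Complex.I * (-y : ℝ))).re = (abelExt c a (Complex.I * y)).re := by
  rw [abelExt_neg_im ha hac, Complex.conj_re]

theorem im_abelExt_neg (ha : 0 < a) (hac : a < c) (y : ℝ) :
    (abelExt c a (Complex.I * (-y : ℝ))).im = -(abelExt c a (Complex.I * y)).im := by
  rw [abelExt_neg_im ha hac, Complex.conj_im]

/-- In the gap the real part of the extension is constant. -/
theorem re_abelExt_gap (ha : 0 < a) (hac : a < c) {y : ℝ} (h : |y| ≤ a) :
    (abelExt c a (Complex.I * y)).re = -periodL c a := by
  rw [periodL, neg_neg]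
  refine eq_of_hasDerivAt_zero (convex_Icc (-a) a)
    (continuous_re_abelExt ha hac).continuousOn ?_ (abs_le.1 h) ⟨by linarith, le_rfl⟩
  intro x hx
  rw [interior_Icc] at hx
  exact (gap_hasDerivAt ha hac (abs_lt.2 hx)).1

theorem strictMonoOn_im_abelExt_gap (ha : 0 < a) (hac : a < c) :
    StrictMonoOn (fun y : ℝ => (abelExt c a (Complex.I * y)).im) (Set.Icc (-a) a) := by
  apply strictMonoOn_of_deriv_pos (convex_Icc (-a) a) (continuous_im_abelExt ha hac).continuousOn
  intro x hx
  rw [interior_Icc] at hx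
  rw [(gap_hasDerivAt ha hac (abs_lt.2 hx)).2.deriv]
  have := gapRoot_pos hac (abs_lt.2 hx)
  positivity

theorem im_abelExt_zero (ha : 0 < a) (hac : a < c) :
    (abelExt c a (Complex.I * (0 : ℝ))).im = 0 := by
  have := im_abelExt_neg ha hac 0
  rw [neg_zero] at this
  linarith

theorem periodK_pos (ha : 0 < a) (hac : a < c) : 0 < periodK c a := by
  have h0 : (0 : ℝ) ∈ Set.Icc (-a) a := ⟨by linarith, ha.le⟩
  have h1 : a ∈ Set.Icc (-a) a := ⟨by linarith, le_rfl⟩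
  have := strictMonoOn_im_abelExt_gap ha hac h0 h1 ha
  simp only [im_abelExt_zero ha hac] at this
  exact this

theorem im_abelExt_neg_a (ha : 0 < a) (hac : a < c) :
    (abelExt c a (Complex.I * (-a : ℝ))).im = -periodK c a :=
  im_abelExt_neg ha hac a

theorem abs_im_abelExt_gap (ha : 0 < a) (hac : a < c) {y : ℝ} (h : |y| < a) :
    |(abelExt c a (Complex.I * y)).im| < periodK c a := by
  have hm := strictMonoOn_im_abelExt_gap ha hac
  have hy := abs_lt.1 h
  have hy' : y ∈ Set.Icc (-a) a := ⟨hy.1.le, hy.2.le⟩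
  rw [abs_lt]
  constructor
  · have := hm (a := -a) ⟨le_rfl, by linarith⟩ hy' hy.1
    simp only [im_abelExt_neg_a ha hac] at this
    exact this
  · exact hm hy' (b := a) ⟨by linarith, le_rfl⟩ hy.2

theorem im_abelExt_gap_ne_zero (ha : 0 < a) (hac : a < c) {y : ℝ} (h : |y| < a) (h0 : y ≠ 0) :
    (abelExt c a (Complex.I * y)).im ≠ 0 := by
  have hm := strictMonoOn_im_abelExt_gap ha hac
  have hy := abs_lt.1 h
  intro h1
  have h2 : (abelExt c a (Complex.I * y)).im = (abelExt c a (Complex.I * (0 : ℝ))).im := by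
    rw [h1, im_abelExt_zero ha hac]
  exact h0 (hm.injOn ⟨hy.1.le, hy.2.le⟩ ⟨by linarith, ha.le⟩ h2)

theorem integral_inv_gapRoot_symm (ha : 0 < a) (hac : a < c) :
    ∫ y in (-a)..a, 1 / gapRoot c a y = 2 * periodK c a := by
  have hd : ∀ x ∈ Set.Ioo (-a) a, HasDerivAt (fun y : ℝ => (abelExt c a (Complex.I * y)).im)
      (1 / gapRoot c a x) x := fun x hx => (gap_hasDerivAt ha hac (abs_lt.2 hx)).2
  -- The integrand is unbounded at ±a. Its integrability comes for free, as it is the nonnegative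
  -- derivative of a continuous function.
  have hint := intervalIntegral.integrableOn_deriv_of_nonneg
    (continuous_im_abelExt ha hac).continuousOn hd (fun x hx => by
      have := gapRoot_pos hac (abs_lt.2 hx)
      positivity)
  rw [intervalIntegral.integral_eq_sub_of_hasDerivAt_of_le (by linarith)
    (continuous_im_abelExt ha hac).continuousOn hd
    ((intervalIntegrable_iff_integrableOn_Ioc_of_le (by linarith)).2 hint)]
  rw [im_abelExt_neg_a ha hac, periodK]
  ring

theorem Gam_eq (ha : 0 < a) (hac : a < c) : Gam c a = Complex.I / (4 * periodK c a) := by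
  have h1 : ∫ s in (-a)..a, (-Complex.I) / w c a (-Complex.I * (s : ℂ)) =
      ∫ s in (-a)..a, ((1 / gapRoot c a s : ℝ) : ℂ) * (-Complex.I) := by
    apply intervalIntegral.integral_congr_Ioo_of_le (by linarith)
    intro s hs
    simp only [neg_mul, w_neg, w_gap hac (abs_lt.2 hs)]
    push_cast
    ring
  rw [Gam, h1, intervalIntegral.integral_mul_const, intervalIntegral.integral_ofReal,
    integral_inv_gapRoot_symm ha hac]
  have hK : (periodK c a : ℂ) ≠ 0 := by exact_mod_cast (periodK_pos ha hac).ne'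
  have hI := Complex.I_ne_zero
  push_cast
  field_simp
  linear_combination -4 * Complex.I_sq

/-- `|w|` on the bands. -/
noncomputable def bandRoot (c a y : ℝ) : ℝ := √((c ^ 2 - y ^ 2) * (y ^ 2 - a ^ 2))

theorem bandRoot_pos (ha : 0 < a) {y : ℝ} (h1 : a < y) (h2 : y < c) : 0 < bandRoot c a y := by
  have : 0 < c ^ 2 - y ^ 2 := by nlinarith
  have : 0 < y ^ 2 - a ^ 2 := by nlinarith
  unfold bandRoot
  positivity

theorem I_div_wPlus (y : ℝ) : Complex.I / wPlus c a y = ((1 / bandRoot c a y : ℝ) : ℂ) := by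
  rw [wPlus, bandRoot, div_mul_eq_div_div, div_self Complex.I_ne_zero]
  push_cast
  rfl

theorem band_hasDerivAt (ha : 0 < a) (hac : a < c) {y : ℝ} (h1 : a < y) (h2 : y < c) :
    HasDerivAt (fun y : ℝ => (abelExt c a (Complex.I * y)).re) (1 / bandRoot c a y) y ∧
    HasDerivAt (fun y : ℝ => (abelExt c a (Complex.I * y)).im) 0 y := by
  have hy : |y| = y := abs_of_pos (ha.trans h1)
  have h := hasDerivAt_re_im_abelExt ha hac (y := y) (by rw [hy]; exact h1.ne')
    (by rw [hy]; exact h2.ne)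
  rw [wRight_eq_w (by linarith), w_I_mul_of_band h1 h2 ha, I_div_wPlus] at h
  simpa only [Complex.ofReal_re, Complex.ofReal_im] using h

theorem im_abelExt_band (ha : 0 < a) (hac : a < c) {y : ℝ} (h1 : a ≤ y) (h2 : y ≤ c) :
    (abelExt c a (Complex.I * y)).im = periodK c a := by
  refine eq_of_hasDerivAt_zero (convex_Icc a c)
    (continuous_im_abelExt ha hac).continuousOn ?_ ⟨h1, h2⟩ ⟨le_rfl, hac.le⟩
  intro x hx
  rw [interior_Icc] at hx
  exact (band_hasDerivAt ha hac hx.1 hx.2).2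

theorem strictMonoOn_re_abelExt_band (ha : 0 < a) (hac : a < c) :
    StrictMonoOn (fun y : ℝ => (abelExt c a (Complex.I * y)).re) (Set.Icc a c) := by
  apply strictMonoOn_of_deriv_pos (convex_Icc a c) (continuous_re_abelExt ha hac).continuousOn
  intro x hx
  rw [interior_Icc] at hx
  rw [(band_hasDerivAt ha hac hx.1 hx.2).1.deriv]
  have := bandRoot_pos ha hx.1 hx.2
  positivity

/-- The value of `w` on the imaginary axis above the segment. -/
noncomputable def outerRoot (c a y : ℝ) : ℝ := (y ^ 2 - c ^ 2) * √((a ^ 2 - y ^ 2) / (c ^ 2 - y ^ 2))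

theorem w_outer (ha : 0 < a) (hac : a < c) {y : ℝ} (h : c < y) :
    w c a (Complex.I * y) = ((-outerRoot c a y : ℝ) : ℂ) ∧ 0 < outerRoot c a y := by
  have h1 : c ^ 2 - y ^ 2 < 0 := by nlinarith
  have h2 : a ^ 2 - y ^ 2 < 0 := by nlinarith
  have h3 : 0 < (a ^ 2 - y ^ 2) / (c ^ 2 - y ^ 2) := div_pos_of_neg_of_neg h2 h1
  refine ⟨?_, ?_⟩
  · rw [w_I_mul_of_nonneg h3.le, outerRoot]
    congr 1
    ring
  · have : 0 < y ^ 2 - c ^ 2 := by linarith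
    unfold outerRoot
    positivity

theorem outer_hasDerivAt (ha : 0 < a) (hac : a < c) {y : ℝ} (h : c < y) :
    HasDerivAt (fun y : ℝ => (abelExt c a (Complex.I * y)).re) 0 y ∧
    HasDerivAt (fun y : ℝ => (abelExt c a (Complex.I * y)).im) (-(1 / outerRoot c a y)) y := by
  have hy : |y| = y := abs_of_pos ((ha.trans hac).trans h)
  have h1 := hasDerivAt_re_im_abelExt ha hac (y := y) (by rw [hy]; exact (hac.trans h).ne')
    (by rw [hy]; exact h.ne')
  have e : Complex.I / wRight c a y = ((-(1 / outerRoot c a y) : ℝ) : ℂ) * Complex.I := by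
    rw [wRight_eq_w (by linarith), (w_outer ha hac h).1]
    push_cast
    ring
  rw [e] at h1
  simpa only [Complex.re_ofReal_mul, Complex.I_re, mul_zero, Complex.im_ofReal_mul, Complex.I_im,
    mul_one] using h1

theorem I_mul_mem_cutPlane {y : ℝ} (h : c < |y|) : Complex.I * y ∈ cutPlane c := by
  rintro ⟨-, h1⟩
  simp at h1
  linarith

theorem tendsto_abelExt_atTop (ha : 0 < a) (hac : a < c) :
    Tendsto (fun y : ℝ => abelExt c a (Complex.I * y)) atTop (𝓝 0) := by
  have h1 : Tendsto (fun y : ℝ => Complex.I * (y : ℂ)) atTop (cocompact ℂ) := by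
    rw [← Metric.cobounded_eq_cocompact, ← tendsto_norm_atTop_iff_cobounded]
    simpa using tendsto_abs_atTop_atTop
  have h2 := (tendsto_abelPrim_cocompact ha hac).comp h1
  refine h2.congr' ?_
  filter_upwards [eventually_gt_atTop c] with y hy
  exact (abelExt_eq_of_mem_cutPlane ha hac
    (I_mul_mem_cutPlane (hy.trans_le (le_abs_self y))) (by simp)).symm

theorem re_abelExt_outer (ha : 0 < a) (hac : a < c) {y : ℝ} (h : c ≤ y) :
    (abelExt c a (Complex.I * y)).re = 0 := by
  have hconst : ∀ x ∈ Set.Ici c, (abelExt c a (Complex.I * x)).re =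
      (abelExt c a (Complex.I * y)).re := by
    intro x hx
    refine eq_of_hasDerivAt_zero (f := fun y : ℝ => (abelExt c a (Complex.I * y)).re)
      (convex_Ici c) (continuous_re_abelExt ha hac).continuousOn ?_ hx h
    intro x hx
    rw [interior_Ici] at hx
    exact (outer_hasDerivAt ha hac hx).1
  have h1 := (Complex.continuous_re.tendsto 0).comp (tendsto_abelExt_atTop ha hac)
  rw [Complex.zero_re] at h1
  refine tendsto_nhds_unique (tendsto_const_nhds.congr' ?_) h1
  filter_upwards [eventually_ge_atTop c] with x hx
  exact (hconst x hx).symm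

theorem periodL_pos (ha : 0 < a) (hac : a < c) : 0 < periodL c a := by
  have h0 : a ∈ Set.Icc a c := ⟨le_rfl, hac.le⟩
  have h1 : c ∈ Set.Icc a c := ⟨hac.le, le_rfl⟩
  have := strictMonoOn_re_abelExt_band ha hac h0 h1 hac
  simp only [re_abelExt_outer ha hac le_rfl] at this
  rw [periodL]
  linarith

theorem re_abelExt_band (ha : 0 < a) (hac : a < c) {y : ℝ} (h1 : a < y) (h2 : y ≤ c) :
    -periodL c a < (abelExt c a (Complex.I * y)).re ∧ (abelExt c a (Complex.I * y)).re ≤ 0 := by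
  have hm := strictMonoOn_re_abelExt_band ha hac
  constructor
  · rw [periodL, neg_neg]
    exact hm ⟨le_rfl, hac.le⟩ ⟨h1.le, h2⟩ h1
  · rw [← re_abelExt_outer ha hac le_rfl]
    exact hm.monotoneOn ⟨h1.le, h2⟩ ⟨hac.le, le_rfl⟩ h2

theorem integral_inv_bandRoot (ha : 0 < a) (hac : a < c) :
    ∫ y in a..c, 1 / bandRoot c a y = periodL c a := by
  have hd : ∀ x ∈ Set.Ioo a c, HasDerivAt (fun y : ℝ => (abelExt c a (Complex.I * y)).re)
      (1 / bandRoot c a x) x := fun x hx => (band_hasDerivAt ha hac hx.1 hx.2).1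
  have hint := intervalIntegral.integrableOn_deriv_of_nonneg
    (continuous_re_abelExt ha hac).continuousOn hd (fun x hx => by
      have := bandRoot_pos ha hx.1 hx.2
      positivity)
  rw [intervalIntegral.integral_eq_sub_of_hasDerivAt_of_le hac.le
    (continuous_re_abelExt ha hac).continuousOn hd
    ((intervalIntegrable_iff_integrableOn_Ioc_of_le hac.le).2 hint)]
  rw [re_abelExt_outer ha hac le_rfl, periodL]
  ring

/-- The imaginary part of the modulus `τ`. -/
noncomputable def tauIm (c a : ℝ) : ℝ := periodL c a / (2 * periodK c a)

theorem tauIm_pos (ha : 0 < a) (hac : a < c) : 0 < tauIm c a := by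
  have := periodL_pos ha hac
  have := periodK_pos ha hac
  unfold tauIm
  positivity

theorem tau_eq (ha : 0 < a) (hac : a < c) : tau c a = Complex.I * tauIm c a := by
  have hK : (periodK c a : ℂ) ≠ 0 := by exact_mod_cast (periodK_pos ha hac).ne'
  rw [tau, Gam_eq ha hac]
  simp only [I_div_wPlus]
  rw [intervalIntegral.integral_ofReal, integral_inv_bandRoot ha hac, tauIm]
  push_cast
  field_simp
  norm_num

-- The primitive is iK at ic and 0 at infinity, so the integral is -iK, and Γ = i/(4K).
open MeasureTheory in
theorem abelInfty_eq (ha : 0 < a) (hac : a < c) : abelInfty c a = 1 / 4 := by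
  have hd : ∀ x ∈ Set.Ioi c, HasDerivAt (fun y : ℝ => (abelExt c a (Complex.I * y)).im)
      (-(1 / outerRoot c a x)) x := fun x hx => (outer_hasDerivAt ha hac hx).2
  have hcont : ContinuousWithinAt (fun y : ℝ => (abelExt c a (Complex.I * y)).im) (Set.Ici c) c :=
    (continuous_im_abelExt ha hac).continuousWithinAt
  have hlim : Tendsto (fun y : ℝ => (abelExt c a (Complex.I * y)).im) atTop (𝓝 0) := by
    have := (Complex.continuous_im.tendsto 0).comp (tendsto_abelExt_atTop ha hac)
    rwa [Complex.zero_im] at this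
  have hint := integrableOn_Ioi_deriv_of_nonpos hcont hd (fun x hx => by
      have := (w_outer ha hac hx).2
      have : 0 < 1 / outerRoot c a x := by positivity
      linarith) hlim
  have h1 := integral_Ioi_of_hasDerivAt_of_tendsto hcont hd hint hlim
  rw [im_abelExt_band ha hac hac.le le_rfl] at h1
  have h2 : ∫ s in Set.Ioi c, Complex.I / w c a (Complex.I * (s : ℂ)) =
      ∫ s in Set.Ioi c, ((-(1 / outerRoot c a s) : ℝ) : ℂ) * Complex.I := by
    apply setIntegral_congr_fun measurableSet_Ioi
    intro s hs
    simp only [(w_outer ha hac hs).1]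
    push_cast
    ring
  have h3 : ∫ s in Set.Ioi c, ((-(1 / outerRoot c a s) : ℝ) : ℂ) =
      ((∫ s in Set.Ioi c, -(1 / outerRoot c a s) : ℝ) : ℂ) := integral_ofReal
  rw [abelInfty, h2, integral_mul_const, h3, h1, Gam_eq ha hac]
  have hK : (periodK c a : ℂ) ≠ 0 := by exact_mod_cast (periodK_pos ha hac).ne'
  push_cast
  field_simp
  linear_combination -(periodK c a : ℂ) * Complex.I_sq

end Periods

/-! ### The centred Abel map B = A - 1/4: range and jumps -/

section ReducedAbel

variable {c a : ℝ}

/-- The Abel map based at infinity. -/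
noncomputable def abelRed (c a : ℝ) (k : ℂ) : ℂ := Gam c a * abelPrim c a k

/-- Boundary values of the Abel map based at infinity, from the right half plane. -/
noncomputable def abelRight (c a y : ℝ) : ℂ := Gam c a * abelExt c a (Complex.I * y)

theorem abel_eq_abelRed (ha : 0 < a) (hac : a < c) (k : ℂ) :
    abel c a k = 1 / 4 + abelRed c a k := by
  rw [abel_eq, abelInfty_eq ha hac, abelRed]

theorem abelRed_neg (c a : ℝ) (k : ℂ) : abelRed c a (-k) = -abelRed c a k := by
  rw [abelRed, abelPrim_neg, abelRed]
  ring

theorem Gam_ne_zero (ha : 0 < a) (hac : a < c) : Gam c a ≠ 0 := by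
  have hK : (periodK c a : ℂ) ≠ 0 := by exact_mod_cast (periodK_pos ha hac).ne'
  rw [Gam_eq ha hac]
  exact div_ne_zero Complex.I_ne_zero (mul_ne_zero (by norm_num) hK)

theorem Gam_mul (ha : 0 < a) (hac : a < c) (z : ℂ) :
    Gam c a * z = ((-z.im / (4 * periodK c a) : ℝ) : ℂ) +
      ((z.re / (4 * periodK c a) : ℝ) : ℂ) * Complex.I := by
  have hK : (periodK c a : ℂ) ≠ 0 := by exact_mod_cast (periodK_pos ha hac).ne'
  rw [Gam_eq ha hac]
  conv_lhs => rw [← Complex.re_add_im z]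
  push_cast
  field_simp
  linear_combination (z.im : ℂ) * Complex.I_sq

theorem re_Gam_mul (ha : 0 < a) (hac : a < c) (z : ℂ) :
    (Gam c a * z).re = -z.im / (4 * periodK c a) := by
  rw [Gam_mul ha hac]
  simp [-Complex.ofReal_div, -Complex.ofReal_neg]

theorem im_Gam_mul (ha : 0 < a) (hac : a < c) (z : ℂ) :
    (Gam c a * z).im = z.re / (4 * periodK c a) := by
  rw [Gam_mul ha hac]
  simp [-Complex.ofReal_div, -Complex.ofReal_neg]

theorem differentiableOn_abelRed (ha : 0 < a) (hac : a < c) :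
    DifferentiableOn ℂ (abelRed c a) (cutPlane c) := fun _ hk =>
  ((hasDerivAt_abelPrim ha hac hk).differentiableAt.const_mul _).differentiableWithinAt

theorem tendsto_abelRed_cocompact (ha : 0 < a) (hac : a < c) :
    Tendsto (abelRed c a) (cocompact ℂ) (𝓝 0) := by
  have := (tendsto_abelPrim_cocompact ha hac).const_mul (Gam c a)
  rwa [mul_zero] at this

theorem re_I_div (z : ℂ) : (Complex.I / z).re = z.im / Complex.normSq z := by
  simp [Complex.div_re]

/-- The y-derivative is Re(i/w) = Im w/|w|², and Im w ≥ 0 in the first quadrant. With the value 0 at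
infinity this bounds the real part from above, and with the values on the positive real axis from
below. -/
theorem re_abelPrim_first_quadrant (ha : 0 < a) (hac : a < c) {x : ℝ} (hx : 0 < x) :
    MonotoneOn (fun y : ℝ => (abelPrim c a (x + Complex.I * y)).re) (Set.Ici 0) := by
  have hd : ∀ y : ℝ, HasDerivAt (fun y : ℝ => (abelPrim c a (x + Complex.I * y)).re)
      ((w c a (x + Complex.I * y)).im / Complex.normSq (w c a (x + Complex.I * y))) y := by
    intro y
    have hk : (x + Complex.I * y : ℂ) ∈ cutPlane c := mem_cutPlane_of_re_ne (by simp [hx.ne'])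
    have h1 : HasDerivAt (fun y : ℝ => (x + Complex.I * y : ℂ)) Complex.I y := by
      have := ((Complex.ofRealCLM.hasDerivAt (x := y)).const_mul Complex.I).const_add (x : ℂ)
      refine this.congr_deriv ?_
      simp
    have h2 := (hasDerivAt_abelPrim ha hac hk).comp y h1
    have h3 := Complex.reCLM.hasFDerivAt.comp_hasDerivAt y h2
    refine h3.congr_deriv ?_
    rw [← re_I_div, div_eq_inv_mul]
    rfl
  apply monotoneOn_of_deriv_nonneg (convex_Ici 0)
  · exact fun y _ => (hd y).continuousAt.continuousWithinAt
  · exact fun y _ => (hd y).differentiableAt.differentiableWithinAt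
  · intro y hy
    rw [interior_Ici] at hy
    rw [(hd y).deriv]
    refine div_nonneg (im_w_nonneg ha hac (by simpa using hx) ?_) (Complex.normSq_nonneg _)
    simpa using (le_of_lt hy)

theorem re_abelPrim_nonpos (ha : 0 < a) (hac : a < c) {x y : ℝ} (hx : 0 < x) (hy : 0 ≤ y) :
    (abelPrim c a (x + Complex.I * y)).re ≤ 0 := by
  have h1 : Tendsto (fun y : ℝ => (x : ℂ) + Complex.I * (y : ℂ)) atTop (cocompact ℂ) := by
    rw [← Metric.cobounded_eq_cocompact, ← tendsto_norm_atTop_iff_cobounded]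
    refine tendsto_atTop_mono (fun y => ?_) tendsto_id
    have := Complex.abs_im_le_norm ((x : ℂ) + Complex.I * (y : ℂ))
    simp only [Complex.add_im, Complex.ofReal_im, Complex.mul_im, Complex.I_re, Complex.I_im,
      Complex.ofReal_re, zero_mul, zero_add, one_mul] at this
    exact (le_abs_self y).trans this
  have h2 := (Complex.continuous_re.tendsto 0).comp ((tendsto_abelPrim_cocompact ha hac).comp h1)
  rw [Complex.zero_re] at h2
  refine ge_of_tendsto h2 ?_
  filter_upwards [eventually_ge_atTop y] with z hz
  exact re_abelPrim_first_quadrant ha hac hx hy (hy.trans hz) hz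

/-- On the positive axis w > 0, so the primitive increases strictly from its boundary value at the
origin, whose real part is -L. -/
theorem neg_periodL_lt_re_abelPrim_ofReal (ha : 0 < a) (hac : a < c) {x : ℝ} (hx : 0 < x) :
    -periodL c a < (abelPrim c a x).re := by
  have hm : StrictMonoOn (fun x : ℝ => (abelExt c a x).re) (Set.Ici 0) := by
    apply strictMonoOn_of_deriv_pos (convex_Ici 0)
    · refine Complex.continuous_re.comp_continuousOn
        ((continuousOn_abelExt ha hac).comp Complex.continuous_ofReal.continuousOn ?_)
      intro x hx
      simpa using hx
    · intro x hx
      rw [interior_Ici] at hx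
      have hx' : (0 : ℝ) < x := hx
      have hk : (x : ℂ) ∈ cutPlane c := mem_cutPlane_of_re_ne (by simp [hx'.ne'])
      have h2 := Complex.reCLM.hasFDerivAt.comp_hasDerivAt x
        ((hasDerivAt_abelPrim ha hac hk).comp_ofReal)
      have h3 : HasDerivAt (fun x : ℝ => (abelExt c a x).re)
          ((x ^ 2 + c ^ 2) * √((x ^ 2 + a ^ 2) / (x ^ 2 + c ^ 2)))⁻¹ x := by
        refine (h2.congr_deriv ?_).congr_of_eventuallyEq ?_
        · rw [w_ofReal ha hac, ← Complex.ofReal_inv]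
          rfl
        · filter_upwards [lt_mem_nhds hx'] with z hz
          simp [abelExt_eq ha hac (k := z) (by simpa using hz)]
      rw [h3.deriv]
      positivity
  have h0 := re_abelExt_gap ha hac (y := 0) (by simpa using ha.le)
  have := hm (Set.mem_Ici.2 le_rfl) hx.le hx
  simp only [abelExt_eq ha hac (k := x) (by simpa using hx)] at this
  rw [← h0]
  simpa using this

theorem re_abelPrim_of_re_pos (ha : 0 < a) (hac : a < c) {k : ℂ} (hk : 0 < k.re) :
    -periodL c a < (abelPrim c a k).re ∧ (abelPrim c a k).re ≤ 0 := by
  have key : ∀ k : ℂ, 0 < k.re → 0 ≤ k.im →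
      -periodL c a < (abelPrim c a k).re ∧ (abelPrim c a k).re ≤ 0 := by
    intro k hk hk'
    have he : k = k.re + Complex.I * k.im := by
      rw [mul_comm]; exact (Complex.re_add_im k).symm
    rw [he]
    refine ⟨(neg_periodL_lt_re_abelPrim_ofReal ha hac hk).trans_le ?_,
      re_abelPrim_nonpos ha hac hk hk'⟩
    have := re_abelPrim_first_quadrant ha hac hk (Set.mem_Ici.2 le_rfl) hk' hk'
    simpa using this
  rcases le_total 0 k.im with h | h
  · exact key k hk h
  · have h1 := key ((starRingEnd ℂ) k) (by simpa using hk) (by simpa using h)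
    rw [abelPrim_conj ha hac (mem_cutPlane_of_re_ne hk.ne')] at h1
    simpa using h1

theorem abs_re_abelPrim_lt (ha : 0 < a) (hac : a < c) {k : ℂ} (hk : k ∈ cutPlane c) :
    |(abelPrim c a k).re| < periodL c a := by
  have hL := periodL_pos ha hac
  rcases lt_trichotomy k.re 0 with h | h | h
  · have := re_abelPrim_of_re_pos ha hac (k := -k) (by simpa using h)
    rw [abelPrim_neg, Complex.neg_re] at this
    rw [abs_lt]
    constructor <;> linarith
  · have key : ∀ y : ℝ, c < y → (abelPrim c a (Complex.I * y)).re = 0 := by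
      intro y hy
      rw [← abelExt_eq_of_mem_cutPlane ha hac (I_mul_mem_cutPlane (hy.trans_le (le_abs_self y)))
        (by simp), re_abelExt_outer ha hac hy.le]
    have hy : c < |k.im| := by
      by_contra hcon
      exact hk ⟨h, not_lt.1 hcon⟩
    have h0 : (abelPrim c a k).re = 0 := by
      rw [eq_I_mul_im h]
      rcases lt_abs.1 hy with h1 | h1
      · exact key _ h1
      · have := key _ h1
        rw [Complex.ofReal_neg, mul_neg, abelPrim_neg, Complex.neg_re] at this
        linarith
    rw [h0, abs_zero]
    exact hL
  · have := re_abelPrim_of_re_pos ha hac h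
    rw [abs_lt]
    constructor <;> linarith

/-- Zeros of θ₃ have imaginary part in Im τ/2 + (Im τ)ℤ, so this strict bound keeps the theta
denominators from vanishing off the segment. -/
theorem abs_im_abelRed_lt (ha : 0 < a) (hac : a < c) {k : ℂ} (hk : k ∈ cutPlane c) :
    |(abelRed c a k).im| < tauIm c a / 2 := by
  have hK := periodK_pos ha hac
  rw [abelRed, im_Gam_mul ha hac, abs_div, abs_of_pos (by positivity : 0 < 4 * periodK c a), tauIm,
    div_div, div_lt_div_iff₀ (by positivity) (by positivity)]
  have := abs_re_abelPrim_lt ha hac hk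
  nlinarith

theorem re_abelRight_neg (ha : 0 < a) (hac : a < c) (y : ℝ) :
    (abelRight c a (-y)).re = -(abelRight c a y).re := by
  rw [abelRight, abelRight, re_Gam_mul ha hac, re_Gam_mul ha hac, im_abelExt_neg ha hac]
  ring

theorem im_abelRight_neg (ha : 0 < a) (hac : a < c) (y : ℝ) :
    (abelRight c a (-y)).im = (abelRight c a y).im := by
  rw [abelRight, abelRight, im_Gam_mul ha hac, im_Gam_mul ha hac, re_abelExt_neg ha hac]

theorem im_abelRight_gap (ha : 0 < a) (hac : a < c) {y : ℝ} (h : |y| ≤ a) :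
    (abelRight c a y).im = -(tauIm c a / 2) := by
  rw [abelRight, im_Gam_mul ha hac, re_abelExt_gap ha hac h, tauIm]
  field_simp
  norm_num

theorem abs_re_abelRight_gap (ha : 0 < a) (hac : a < c) {y : ℝ} (h : |y| < a) :
    |(abelRight c a y).re| < 1 / 4 := by
  have hK := periodK_pos ha hac
  rw [abelRight, re_Gam_mul ha hac, abs_div, abs_neg, abs_of_pos (by positivity : 0 < 4 * periodK c a),
    div_lt_div_iff₀ (by positivity) (by norm_num)]
  have := abs_im_abelExt_gap ha hac h
  linarith

theorem re_abelRight_gap_ne_zero (ha : 0 < a) (hac : a < c) {y : ℝ} (h : |y| < a) (h0 : y ≠ 0) :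
    (abelRight c a y).re ≠ 0 := by
  have hK := periodK_pos ha hac
  rw [abelRight, re_Gam_mul ha hac]
  exact div_ne_zero (neg_ne_zero.2 (im_abelExt_gap_ne_zero ha hac h h0)) (by positivity)

theorem abelRight_zero (ha : 0 < a) (hac : a < c) :
    abelRight c a 0 = -(Complex.I * tauIm c a / 2) := by
  apply Complex.ext
  · rw [abelRight, re_Gam_mul ha hac, im_abelExt_zero ha hac]
    simp
  · rw [im_abelRight_gap ha hac (by simpa using ha.le)]
    simp

theorem re_abelRight_band (ha : 0 < a) (hac : a < c) {y : ℝ} (h1 : a ≤ y) (h2 : y ≤ c) :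
    (abelRight c a y).re = -(1 / 4) := by
  have hK := periodK_pos ha hac
  rw [abelRight, re_Gam_mul ha hac, im_abelExt_band ha hac h1 h2]
  field_simp

theorem im_abelRight_band (ha : 0 < a) (hac : a < c) {y : ℝ} (h1 : a < y) (h2 : y ≤ c) :
    |(abelRight c a y).im| < tauIm c a / 2 := by
  have hK := periodK_pos ha hac
  have hL := periodL_pos ha hac
  obtain ⟨h3, h4⟩ := re_abelExt_band ha hac h1 h2
  rw [abelRight, im_Gam_mul ha hac, tauIm, abs_div, abs_of_pos (by positivity : 0 < 4 * periodK c a),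
    div_div, div_lt_div_iff₀ (by positivity) (by positivity), abs_of_nonpos h4]
  nlinarith

theorem abs_re_abelRight_le (ha : 0 < a) (hac : a < c) {y : ℝ} (h : |y| ≤ c) :
    |(abelRight c a y).re| ≤ 1 / 4 := by
  rcases lt_or_ge |y| a with h1 | h1
  · exact (abs_re_abelRight_gap ha hac h1).le
  · rcases abs_cases y with ⟨h2, -⟩ | ⟨h2, -⟩
    · rw [h2] at h h1
      rw [re_abelRight_band ha hac h1 h, abs_neg]
      norm_num
    · rw [h2] at h h1
      have := re_abelRight_band ha hac h1 h
      rw [re_abelRight_neg ha hac] at this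
      rw [← abs_neg, this, abs_neg]
      norm_num

/-- Jump of the Abel map over the gap. -/
theorem abelRight_gap (ha : 0 < a) (hac : a < c) {y : ℝ} (h : |y| ≤ a) :
    abelRight c a y = -abelRight c a (-y) - Complex.I * tauIm c a := by
  apply Complex.ext
  · simp [re_abelRight_neg ha hac]
  · simp [im_abelRight_neg ha hac, im_abelRight_gap ha hac h]
    ring

/-- Jump of the Abel map over the upper band. -/
theorem abelRight_upper (ha : 0 < a) (hac : a < c) {y : ℝ} (h1 : a ≤ y) (h2 : y ≤ c) :
    abelRight c a y = -(1 / 2) - -abelRight c a (-y) := by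
  apply Complex.ext
  · simp [re_abelRight_neg ha hac, re_abelRight_band ha hac h1 h2]
    norm_num
  · simp [im_abelRight_neg ha hac]

/-- Jump of the Abel map over the lower band. -/
theorem abelRight_lower (ha : 0 < a) (hac : a < c) {y : ℝ} (h1 : a ≤ -y) (h2 : -y ≤ c) :
    abelRight c a y = 1 / 2 - -abelRight c a (-y) := by
  have := abelRight_upper ha hac h1 h2
  rw [neg_neg] at this
  linear_combination -this

theorem tendsto_abelRed_right (ha : 0 < a) (hac : a < c) (y : ℝ) :
    Tendsto (abelRed c a) (𝓝[{k | 0 < k.re}] (Complex.I * y)) (𝓝 (abelRight c a y)) :=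
  (tendsto_abelExt ha hac y).const_mul _

theorem tendsto_neg_left (y : ℝ) :
    Tendsto (fun k : ℂ => -k) (𝓝[{k | k.re < 0}] (Complex.I * y))
      (𝓝[{k | 0 < k.re}] (Complex.I * (-y : ℝ))) := by
  apply tendsto_nhdsWithin_of_tendsto_nhds_of_eventually_within
  · have : Tendsto (fun k : ℂ => -k) (𝓝 (Complex.I * y)) (𝓝 (-(Complex.I * y))) :=
      (continuous_neg.tendsto _)
    rw [Complex.ofReal_neg, mul_neg]
    exact this.mono_left nhdsWithin_le_nhds
  · filter_upwards [self_mem_nhdsWithin] with k hk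
    simpa using hk

theorem tendsto_abelRed_left (ha : 0 < a) (hac : a < c) (y : ℝ) :
    Tendsto (abelRed c a) (𝓝[{k | k.re < 0}] (Complex.I * y)) (𝓝 (-abelRight c a (-y))) := by
  have := ((tendsto_abelRed_right ha hac (-y)).comp (tendsto_neg_left y)).neg
  refine this.congr fun k => ?_
  simp [abelRed_neg]

/-- On approach within the cut plane the Abel map accumulates only at its two boundary values. -/
theorem tendsto_abelRed_cutPlane (ha : 0 < a) (hac : a < c) (y : ℝ) :
    Tendsto (abelRed c a) (𝓝[cutPlane c] (Complex.I * y))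
      (𝓝 (abelRight c a y) ⊔ 𝓝 (-abelRight c a (-y))) := by
  have key : ∀ y : ℝ, Tendsto (abelRed c a) (𝓝[cutPlane c ∩ {k | 0 ≤ k.re}] (Complex.I * y))
      (𝓝 (abelRight c a y)) := by
    intro y
    have h1 := (continuousOn_abelExt ha hac (Complex.I * y) (by simp)).const_smul (Gam c a)
    refine (Tendsto.mono_left h1 (nhdsWithin_mono _ Set.inter_subset_right)).congr' ?_
    filter_upwards [self_mem_nhdsWithin] with k hk
    rw [Pi.smul_apply, abelExt_eq_of_mem_cutPlane ha hac hk.1 hk.2]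
    rfl
  have hsub : cutPlane c ⊆ (cutPlane c ∩ {k | 0 ≤ k.re}) ∪ (cutPlane c ∩ {k | k.re ≤ 0}) := by
    intro k hk
    rcases le_total 0 k.re with h | h
    · exact Or.inl ⟨hk, h⟩
    · exact Or.inr ⟨hk, h⟩
  refine Tendsto.mono_left ?_ (nhdsWithin_mono _ hsub)
  rw [nhdsWithin_union]
  refine Tendsto.sup_sup (key y) ?_
  have hn : Tendsto (fun k : ℂ => -k) (𝓝[cutPlane c ∩ {k | k.re ≤ 0}] (Complex.I * y))
      (𝓝[cutPlane c ∩ {k | 0 ≤ k.re}] (Complex.I * (-y : ℝ))) := by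
    apply tendsto_nhdsWithin_of_tendsto_nhds_of_eventually_within
    · have : Tendsto (fun k : ℂ => -k) (𝓝 (Complex.I * y)) (𝓝 (-(Complex.I * y))) :=
        (continuous_neg.tendsto _)
      rw [Complex.ofReal_neg, mul_neg]
      exact this.mono_left nhdsWithin_le_nhds
    · filter_upwards [self_mem_nhdsWithin] with k hk
      exact ⟨neg_mem_cutPlane hk.1, by simpa using hk.2⟩
  refine ((key (-y)).comp hn).neg.congr fun k => ?_
  simp [abelRed_neg]

/-- Near the origin the Abel map moves at least linearly away from its boundary value. -/
theorem isBigO_sub_abelRight_zero (ha : 0 < a) (hac : a < c) :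
    (fun k : ℂ => k) =O[𝓝[{k | 0 < k.re}] 0] fun k => abelRed c a k - abelRight c a 0 := by
  have hc := ha.trans hac
  -- The one-sided derivative at the origin is 1/w₊(0), which is not zero.
  have h := hasFDerivWithinAt_abelExt ha hac (y := 0) (by simpa using ha.ne)
    (by simpa using hc.ne)
  have hw := wRight_ne_zero ha hac (y := 0) (by simpa using ha.ne) (by simpa using hc.ne)
  have ho := h.isLittleO
  simp only [Complex.ofReal_zero, mul_zero, sub_zero] at ho
  have ho' := ho.mono (nhdsWithin_mono (0 : ℂ) (fun k (hk : 0 < k.re) => hk.le :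
    {k : ℂ | 0 < k.re} ⊆ {k : ℂ | 0 ≤ k.re}))
  have h1 : (fun k : ℂ => k) =O[𝓝[{k | 0 < k.re}] 0] fun k => (wRight c a 0)⁻¹ * k := by
    refine ((isBigO_refl (fun k => (wRight c a 0)⁻¹ * k) _).const_mul_left (wRight c a 0)).congr_left
      fun k => ?_
    field_simp
  have h2 : (fun k : ℂ => k) =O[𝓝[{k | 0 < k.re}] 0]
      fun k => abelExt c a k - abelExt c a 0 := by
    refine h1.trans ?_
    have h3 := (ho'.trans_isBigO h1).right_isBigO_add
    refine h3.congr_right fun k => ?_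
    simp [mul_comm]
  refine h2.trans ?_
  refine ((isBigO_refl (fun k => abelRed c a k - abelRight c a 0) _).const_mul_left
    (Gam c a)⁻¹).congr' ?_ EventuallyEq.rfl
  filter_upwards [self_mem_nhdsWithin] with k hk
  have hG := Gam_ne_zero ha hac
  rw [abelExt_eq ha hac hk, abelRed, abelRight]
  simp only [Complex.ofReal_zero, mul_zero]
  field_simp

end ReducedAbel

/-! ### Growth of γ at the nodes, at infinity and at the origin -/

section QuarticRoot

variable {c a : ℝ}

theorem mem_nodes_iff (ha : 0 < a) (hac : a < c) {κ : ℂ} :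
    κ ∈ nodes c a ↔ ∃ y : ℝ, (|y| = a ∨ |y| = c) ∧ κ = Complex.I * y := by
  have hc := ha.trans hac
  simp only [nodes, Set.mem_insert_iff, Set.mem_singleton_iff]
  constructor
  · rintro (h | h | h | h)
    · exact ⟨c, Or.inr (abs_of_pos hc), h⟩
    · exact ⟨a, Or.inl (abs_of_pos ha), h⟩
    · exact ⟨-a, Or.inl (by rw [abs_neg, abs_of_pos ha]), by simp [h]⟩
    · exact ⟨-c, Or.inr (by rw [abs_neg, abs_of_pos hc]), by simp [h]⟩
  · rintro ⟨y, h | h, rfl⟩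
    · rcases eq_or_eq_neg_of_abs_eq h with rfl | rfl <;> simp
    · rcases eq_or_eq_neg_of_abs_eq h with rfl | rfl <;> simp

theorem I_mul_notMem_cutPlane {y : ℝ} (h : |y| ≤ c) : Complex.I * y ∉ cutPlane c := by
  simp [cutPlane, h]

/-- The point κ has to be excluded: for r > 0 the real power of zero with exponent -r is zero by
convention. -/
theorem isBigO_one_norm_rpow_neg {κ : ℂ} {s : Set ℂ} (hκ : κ ∉ s) {r : ℝ} (hr : 0 ≤ r) :
    (fun _ : ℂ => (1 : ℝ)) =O[𝓝[s] κ] fun k => ‖k - κ‖ ^ (-r) := by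
  refine IsBigO.of_bound 1 ?_
  have h1 : ∀ᶠ k in 𝓝[s] κ, ‖k - κ‖ < 1 := by
    refine nhdsWithin_le_nhds ?_
    filter_upwards [Metric.ball_mem_nhds κ one_pos] with k hk
    simpa [dist_eq_norm] using hk
  filter_upwards [h1, self_mem_nhdsWithin] with k hk hks
  have h0 : 0 < ‖k - κ‖ := norm_pos_iff.2 (sub_ne_zero.2 fun h => hκ (h ▸ hks))
  rw [norm_one, one_mul, Real.norm_of_nonneg (by positivity)]
  exact Real.one_le_rpow_of_pos_of_le_one_of_nonpos h0 hk.le (by linarith)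

theorem norm_gammaTilde (c a : ℝ) (k : ℂ) :
    ‖gammaTilde c a k‖ =
      ‖k ^ 2 + (a : ℂ) ^ 2‖ ^ (1 / 4 : ℝ) * ‖k ^ 2 + (c : ℂ) ^ 2‖ ^ (-(1 / 4) : ℝ) := by
  have : (1 / 4 : ℂ) = ((1 / 4 : ℝ) : ℂ) := by push_cast; rfl
  rw [gammaTilde, this, Complex.norm_cpow_real, norm_div,
    Real.div_rpow (norm_nonneg _) (norm_nonneg _), Real.rpow_neg (norm_nonneg _), div_eq_mul_inv]

theorem norm_gammaTilde_inv (c a : ℝ) (k : ℂ) :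
    ‖(gammaTilde c a k)⁻¹‖ =
      ‖k ^ 2 + (a : ℂ) ^ 2‖ ^ (-(1 / 4) : ℝ) * ‖k ^ 2 + (c : ℂ) ^ 2‖ ^ (1 / 4 : ℝ) := by
  rw [norm_inv, norm_gammaTilde, mul_inv, Real.rpow_neg (norm_nonneg _),
    Real.rpow_neg (norm_nonneg _), inv_inv]

theorem sq_add_sq_eq_mul {p y : ℝ} (h : |y| = p) (k : ℂ) :
    k ^ 2 + (p : ℂ) ^ 2 = (k - Complex.I * y) * (k + Complex.I * y) := by
  have h2 : (p : ℂ) ^ 2 = (y : ℂ) ^ 2 := by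
    rw [← h, ← Complex.ofReal_pow, sq_abs, Complex.ofReal_pow]
  rw [h2]
  linear_combination (y : ℂ) ^ 2 * Complex.I_sq

theorem isBigO_norm_sq_add_sq_rpow {p y r : ℝ} (hp : 0 < p) (h : |y| = p) :
    (fun k : ℂ => ‖k ^ 2 + (p : ℂ) ^ 2‖ ^ r) =O[𝓝 (Complex.I * y)]
      fun k => ‖k - Complex.I * y‖ ^ r := by
  have h1 : (fun k : ℂ => ‖k + Complex.I * y‖ ^ r) =O[𝓝 (Complex.I * y)] fun _ => (1 : ℝ) := by
    have : ContinuousAt (fun k : ℂ => ‖k + Complex.I * y‖ ^ r) (Complex.I * y) := by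
      apply ContinuousAt.rpow_const (by fun_prop)
      left
      have hy : y ≠ 0 := by
        rintro rfl
        simp at h
        linarith
      rw [norm_ne_zero_iff, ← two_mul]
      simp [hy]
    exact this.isBigO_one ℝ
  refine (h1.mul (isBigO_refl (fun k : ℂ => ‖k - Complex.I * y‖ ^ r) _)).congr (fun k => ?_)
    fun k => one_mul _
  rw [sq_add_sq_eq_mul h, norm_mul, Real.mul_rpow (norm_nonneg _) (norm_nonneg _), mul_comm]

theorem isBigO_one_norm_sq_add_sq_rpow {p y r : ℝ} (hp : 0 < p) (h : |y| ≠ p) :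
    (fun k : ℂ => ‖k ^ 2 + (p : ℂ) ^ 2‖ ^ r) =O[𝓝 (Complex.I * y)] fun _ => (1 : ℝ) := by
  have : ContinuousAt (fun k : ℂ => ‖k ^ 2 + (p : ℂ) ^ 2‖ ^ r) (Complex.I * y) := by
    apply ContinuousAt.rpow_const (by fun_prop)
    left
    rw [norm_ne_zero_iff]
    apply sq_add_sq_ne_zero_of_re_im
    simpa [abs_of_pos hp] using h
  exact this.isBigO_one ℝ

theorem isBigO_gammaTilde_inner (ha : 0 < a) (hac : a < c) {y : ℝ} (h : |y| = a) :
    gammaTilde c a =O[𝓝 (Complex.I * y)] fun k => ‖k - Complex.I * y‖ ^ (1 / 4 : ℝ) := by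
  have h1 := isBigO_norm_sq_add_sq_rpow (r := 1 / 4) ha h
  have h2 := isBigO_one_norm_sq_add_sq_rpow (r := -(1 / 4)) (ha.trans hac)
    (by rw [h]; exact hac.ne : |y| ≠ c)
  rw [← isBigO_norm_left]
  exact (h1.mul h2).congr (fun k => (norm_gammaTilde c a k).symm) fun k => mul_one _

theorem isBigO_gammaTilde_outer (ha : 0 < a) (hac : a < c) {y : ℝ} (h : |y| = c) :
    gammaTilde c a =O[𝓝 (Complex.I * y)] fun k => ‖k - Complex.I * y‖ ^ (-(1 / 4) : ℝ) := by
  have h1 := isBigO_norm_sq_add_sq_rpow (r := -(1 / 4)) (ha.trans hac) h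
  have h2 := isBigO_one_norm_sq_add_sq_rpow (r := 1 / 4) ha
    (by rw [h]; exact hac.ne' : |y| ≠ a)
  rw [← isBigO_norm_left]
  exact (h2.mul h1).congr (fun k => (norm_gammaTilde c a k).symm) fun k => one_mul _

theorem isBigO_gammaTilde_inv_inner (ha : 0 < a) (hac : a < c) {y : ℝ} (h : |y| = a) :
    (fun k => (gammaTilde c a k)⁻¹) =O[𝓝 (Complex.I * y)]
      fun k => ‖k - Complex.I * y‖ ^ (-(1 / 4) : ℝ) := by
  have h1 := isBigO_norm_sq_add_sq_rpow (r := -(1 / 4)) ha h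
  have h2 := isBigO_one_norm_sq_add_sq_rpow (r := 1 / 4) (ha.trans hac)
    (by rw [h]; exact hac.ne : |y| ≠ c)
  rw [← isBigO_norm_left]
  exact (h1.mul h2).congr (fun k => (norm_gammaTilde_inv c a k).symm) fun k => mul_one _

theorem isBigO_gammaTilde_inv_outer (ha : 0 < a) (hac : a < c) {y : ℝ} (h : |y| = c) :
    (fun k => (gammaTilde c a k)⁻¹) =O[𝓝 (Complex.I * y)]
      fun k => ‖k - Complex.I * y‖ ^ (1 / 4 : ℝ) := by
  have h1 := isBigO_norm_sq_add_sq_rpow (r := 1 / 4) (ha.trans hac) h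
  have h2 := isBigO_one_norm_sq_add_sq_rpow (r := -(1 / 4)) ha
    (by rw [h]; exact hac.ne' : |y| ≠ a)
  rw [← isBigO_norm_left]
  exact (h2.mul h1).congr (fun k => (norm_gammaTilde_inv c a k).symm) fun k => one_mul _

theorem isBigO_one_norm_sub_rpow (κ : ℂ) {r : ℝ} (hr : 0 ≤ r) :
    (fun k : ℂ => ‖k - κ‖ ^ r) =O[𝓝 κ] fun _ => (1 : ℝ) := by
  have : ContinuousAt (fun k : ℂ => ‖k - κ‖ ^ r) κ :=
    ContinuousAt.rpow_const (by fun_prop) (Or.inr hr)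
  exact this.isBigO_one ℝ

theorem isBigO_gammaTilde_node (ha : 0 < a) (hac : a < c) {y : ℝ} (h : |y| = a ∨ |y| = c) :
    gammaTilde c a =O[𝓝[cutPlane c] (Complex.I * y)]
      fun k => ‖k - Complex.I * y‖ ^ (-(1 / 4) : ℝ) := by
  rcases h with h | h
  · refine ((isBigO_gammaTilde_inner ha hac h).mono nhdsWithin_le_nhds).trans ?_
    refine ((isBigO_one_norm_sub_rpow _ (by norm_num)).mono nhdsWithin_le_nhds).trans ?_
    exact isBigO_one_norm_rpow_neg (I_mul_notMem_cutPlane (by rw [h]; exact hac.le)) (by norm_num)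
  · exact (isBigO_gammaTilde_outer ha hac h).mono nhdsWithin_le_nhds

theorem isBigO_gammaTilde_inv_node (ha : 0 < a) (hac : a < c) {y : ℝ} (h : |y| = a ∨ |y| = c) :
    (fun k => (gammaTilde c a k)⁻¹) =O[𝓝[cutPlane c] (Complex.I * y)]
      fun k => ‖k - Complex.I * y‖ ^ (-(1 / 4) : ℝ) := by
  rcases h with h | h
  · exact (isBigO_gammaTilde_inv_inner ha hac h).mono nhdsWithin_le_nhds
  · refine ((isBigO_gammaTilde_inv_outer ha hac h).mono nhdsWithin_le_nhds).trans ?_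
    refine ((isBigO_one_norm_sub_rpow _ (by norm_num)).mono nhdsWithin_le_nhds).trans ?_
    exact isBigO_one_norm_rpow_neg (I_mul_notMem_cutPlane h.le) (by norm_num)

/-- |w|² is the product of the distances to the four nodes, hence locally bounded everywhere. -/
theorem isBigO_w_one (ha : 0 < a) (hac : a < c) (κ : ℂ) :
    w c a =O[𝓝[cutPlane c] κ] fun _ => (1 : ℝ) := by
  refine IsBigO.of_pow (n := 2) two_ne_zero ?_
  have h : ContinuousAt (fun k : ℂ => ‖k - Complex.I * a‖ * ‖k + Complex.I * a‖ *
      (‖k - Complex.I * c‖ * ‖k + Complex.I * c‖)) κ := by fun_prop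
  have h2 := (h.isBigO_one ℝ).mono (nhdsWithin_le_nhds (s := cutPlane c))
  rw [← isBigO_norm_left]
  refine h2.congr' ?_ (Eventually.of_forall fun k => by simp)
  filter_upwards [self_mem_nhdsWithin] with k hk
  rw [Pi.pow_apply, norm_pow, norm_w_sq (sq_add_c_sq_ne_zero ha hac (cutPlane_subset_bandPlane hk))]

theorem tendsto_inv_sq_cocompact :
    Tendsto (fun k : ℂ => (k ^ 2)⁻¹) (cocompact ℂ) (𝓝 0) := by
  have h := (tendsto_inv₀_cobounded (α := ℂ)).pow 2
  rw [Metric.cobounded_eq_cocompact, zero_pow two_ne_zero] at h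
  exact h.congr fun k => inv_pow _ _

theorem tendsto_sq_add_div_sq_cocompact (p : ℂ) :
    Tendsto (fun k : ℂ => (k ^ 2 + p) / k ^ 2) (cocompact ℂ) (𝓝 1) := by
  have h := (tendsto_inv_sq_cocompact.const_mul p).const_add 1
  rw [mul_zero, add_zero] at h
  refine h.congr' ?_
  filter_upwards [(isCompact_singleton (x := (0 : ℂ))).compl_mem_cocompact] with k hk
  have hk' : k ≠ 0 := hk
  field_simp

theorem tendsto_gammaTilde_cocompact (c a : ℝ) :
    Tendsto (gammaTilde c a) (cocompact ℂ) (𝓝 1) := by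
  have h := (tendsto_sq_add_div_sq_cocompact ((a : ℂ) ^ 2)).div
    (tendsto_sq_add_div_sq_cocompact ((c : ℂ) ^ 2)) one_ne_zero
  rw [div_one] at h
  have h2 : Tendsto (fun k : ℂ => (k ^ 2 + (a : ℂ) ^ 2) / (k ^ 2 + (c : ℂ) ^ 2)) (cocompact ℂ)
      (𝓝 1) := by
    refine h.congr' ?_
    filter_upwards [(isCompact_singleton (x := (0 : ℂ))).compl_mem_cocompact] with k hk
    have hk' : k ≠ 0 := hk
    simp only [Pi.div_apply]
    rw [div_div_div_cancel_right₀ (pow_ne_zero 2 hk')]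
  have h3 : ContinuousAt (fun z : ℂ => z ^ (1 / 4 : ℂ)) 1 :=
    continuousAt_cpow_const (by simp)
  have h4 := h3.tendsto.comp h2
  rwa [Complex.one_cpow] at h4

theorem tendsto_w_div_sq_cocompact (c a : ℝ) :
    Tendsto (fun k => w c a k / k ^ 2) (cocompact ℂ) (𝓝 1) := by
  have h := (tendsto_sq_add_div_sq_cocompact ((c : ℂ) ^ 2)).mul
    ((tendsto_gammaTilde_cocompact c a).pow 2)
  rw [one_pow, one_mul] at h
  refine h.congr fun k => ?_
  rw [w_eq]
  ring

theorem ofReal_sqrt_ne_zero (ha : 0 < a) (hac : a < c) : ((√(c / a) : ℝ) : ℂ) ≠ 0 := by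
  have hc := ha.trans hac
  have : 0 < √(c / a) := by positivity
  exact_mod_cast this.ne'

theorem gam_neg (c a : ℝ) (k : ℂ) : gam c a (-k) = gam c a k := by
  rw [gam, gammaTilde_neg, gam]

theorem gam_ne_zero (ha : 0 < a) (hac : a < c) {k : ℂ} (hk : k ∈ bandPlane c a) :
    gam c a k ≠ 0 :=
  mul_ne_zero (gammaTilde_ne_zero ha hac hk) (ofReal_sqrt_ne_zero ha hac)

theorem differentiableAt_gam (ha : 0 < a) (hac : a < c) {k : ℂ} (hk : k ∈ bandPlane c a) :
    DifferentiableAt ℂ (gam c a) k :=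
  (differentiableAt_gammaTilde ha hac hk).mul_const _

theorem zero_mem_bandPlane (ha : 0 < a) : (0 : ℂ) ∈ bandPlane c a := by
  have := mem_bandPlane_of_lt (c := c) (a := a) (y := 0) (by simpa using ha)
  simpa using this

theorem gam_zero (ha : 0 < a) (hac : a < c) : gam c a 0 = 1 := by
  have hc := ha.trans hac
  have h1 : ((a : ℂ) ^ 2 / (c : ℂ) ^ 2) ^ (1 / 4 : ℂ) = ((√(a / c) : ℝ) : ℂ) := by
    have h2 : ((a : ℂ) ^ 2 / (c : ℂ) ^ 2) = (((a / c) ^ 2 : ℝ) : ℂ) := by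
      push_cast
      ring
    have h3 : (1 / 4 : ℂ) = ((1 / 4 : ℝ) : ℂ) := by push_cast; rfl
    rw [h2, h3, ← Complex.ofReal_cpow (by positivity), ← Real.rpow_natCast,
      ← Real.rpow_mul (by positivity), Real.sqrt_eq_rpow]
    norm_num
  rw [gam, gammaTilde]
  simp only [ne_eq, OfNat.ofNat_ne_zero, not_false_eq_true, zero_pow, zero_add]
  rw [h1, ← Complex.ofReal_mul, ← Real.sqrt_mul (by positivity)]
  have : a / c * (c / a) = 1 := by field_simp
  rw [this]
  simp

/-- `γ - γ⁻¹` vanishes to second order at the origin. -/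
theorem isLittleO_gam_sub_inv (ha : 0 < a) (hac : a < c) :
    (fun k => gam c a k - (gam c a k)⁻¹) =o[𝓝 0] fun k : ℂ => k := by
  have hd := differentiableAt_gam ha hac (zero_mem_bandPlane (c := c) ha)
  -- γ is even with γ(0) = 1, and γ - γ⁻¹ = (γ - 1)(γ + 1)/γ.
  have h0 : deriv (gam c a) 0 = 0 := by
    have h1 : deriv (fun k => gam c a (-k)) 0 = -deriv (gam c a) (-0) := deriv_comp_neg _ _
    simp only [gam_neg, neg_zero] at h1
    have : 2 * deriv (gam c a) 0 = 0 := by linear_combination h1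
    simpa using this
  have h2 := hd.hasDerivAt.isLittleO
  rw [h0] at h2
  simp only [gam_zero ha hac, sub_zero, smul_zero] at h2
  have h3 : (fun k => (gam c a k + 1) / gam c a k) =O[𝓝 0] fun _ => (1 : ℂ) := by
    have hne := gam_ne_zero ha hac (zero_mem_bandPlane (c := c) ha)
    exact (ContinuousAt.div (hd.continuousAt.add continuousAt_const) hd.continuousAt hne).isBigO_one ℂ
  refine (h2.mul_isBigO h3).congr' ?_ (Eventually.of_forall fun k => mul_one _)
  filter_upwards [(isOpen_bandPlane c a).mem_nhds (zero_mem_bandPlane ha)] with k hk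
  have := gam_ne_zero ha hac hk
  field_simp
  ring

/-- The boundary value of `γ` from the right half plane. -/
noncomputable def gamRight (c a y : ℝ) : ℂ := gammaRight c a y * (√(c / a) : ℝ)

theorem gamRight_ne_zero (ha : 0 < a) (hac : a < c) {y : ℝ} (h1 : |y| ≠ a) (h2 : |y| ≠ c) :
    gamRight c a y ≠ 0 :=
  mul_ne_zero (gammaRight_ne_zero ha hac h1 h2) (ofReal_sqrt_ne_zero ha hac)

theorem gamRight_upper (ha : 0 < a) {y : ℝ} (h1 : a < y) (h2 : y < c) :
    gamRight c a y = Complex.I * gamRight c a (-y) := by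
  rw [gamRight, gammaRight_upper ha h1 h2, gamRight]
  ring

theorem gamRight_lower (ha : 0 < a) {y : ℝ} (h1 : a < -y) (h2 : -y < c) :
    gamRight c a y = -Complex.I * gamRight c a (-y) := by
  have := gamRight_upper ha h1 h2
  rw [neg_neg] at this
  rw [this, ← mul_assoc, neg_mul, Complex.I_mul_I]
  ring

theorem gamRight_gap {y : ℝ} (h : |y| < a) : gamRight c a y = gamRight c a (-y) := by
  rw [gamRight, gammaRight_gap h, gamRight]

theorem tendsto_gam_right (ha : 0 < a) (hac : a < c) {y : ℝ} (h1 : |y| ≠ a) (h2 : |y| ≠ c) :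
    Tendsto (gam c a) (𝓝[{z : ℂ | 0 < z.re}] (Complex.I * y)) (𝓝 (gamRight c a y)) :=
  (tendsto_gammaTilde_right ha hac h1 h2).mul_const _

theorem gamRight_zero (ha : 0 < a) (hac : a < c) : gamRight c a 0 = 1 := by
  rw [gamRight, gammaRight, if_neg (by rintro ⟨-, h⟩; linarith)]
  have := gam_zero ha hac
  rw [gam] at this
  simpa using this

theorem isBigO_gam_node (ha : 0 < a) (hac : a < c) {y : ℝ} (h : |y| = a ∨ |y| = c) :
    gam c a =O[𝓝[cutPlane c] (Complex.I * y)]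
      fun k => ‖k - Complex.I * y‖ ^ (-(1 / 4) : ℝ) := by
  refine ((isBigO_gammaTilde_node ha hac h).const_mul_left
    ((√(c / a) : ℝ) : ℂ)).congr_left fun k => ?_
  exact mul_comm _ _

theorem isBigO_gam_inv_node (ha : 0 < a) (hac : a < c) {y : ℝ} (h : |y| = a ∨ |y| = c) :
    (fun k => (gam c a k)⁻¹) =O[𝓝[cutPlane c] (Complex.I * y)]
      fun k => ‖k - Complex.I * y‖ ^ (-(1 / 4) : ℝ) := by
  refine ((isBigO_gammaTilde_inv_node ha hac h).const_mul_left
    (((√(c / a) : ℝ) : ℂ))⁻¹).congr_left fun k => ?_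
  rw [gam, mul_inv, mul_comm]

theorem tendsto_gam_cocompact (c a : ℝ) :
    Tendsto (gam c a) (cocompact ℂ) (𝓝 (√(c / a) : ℝ)) := by
  have := (tendsto_gammaTilde_cocompact c a).mul_const (((√(c / a) : ℝ) : ℂ))
  rwa [one_mul] at this

end QuarticRoot

/-! ### Theta quotients and the algebra of the jump matrix -/

section ThetaQuotient

variable {t Λ : ℝ}

theorem re_im_of_theta_eq_zero (ht : 0 < t) {z : ℂ} (hz : theta z (Complex.I * t) = 0) :
    ∃ m n : ℤ, z.re = 1 / 2 + m ∧ z.im = t / 2 + n * t := by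
  obtain ⟨m, n, h⟩ := exists_int_of_theta_eq_zero ht hz
  refine ⟨m, n, ?_, ?_⟩
  · rw [h]; simp
  · rw [h]; simp

/-- The zeros lie on the horizontal lines Im z ∈ t/2 + tℤ and on the vertical lines Re z ∈ 1/2 + ℤ.
Horizontal strips serve in the cut plane; vertical ones serve on the gap, where Im B₊ takes the
critical value -t/2. -/
theorem theta_ne_zero_of_abs_im_lt (ht : 0 < t) {z : ℂ} (hz : |z.im| < t / 2) :
    theta z (Complex.I * t) ≠ 0 := by
  intro h
  obtain ⟨m, n, -, h2⟩ := re_im_of_theta_eq_zero ht h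
  rw [abs_lt] at hz
  have h3 : (n : ℝ) < 0 := by nlinarith
  have h4 : (-1 : ℝ) < n := by nlinarith
  have h5 : n < 0 := by exact_mod_cast h3
  have h6 : -1 < n := by exact_mod_cast h4
  omega

theorem theta_ne_zero_of_abs_re_lt (ht : 0 < t) {z : ℂ} (hz : |z.re| < 1 / 2) :
    theta z (Complex.I * t) ≠ 0 := by
  intro h
  obtain ⟨m, n, h1, -⟩ := re_im_of_theta_eq_zero ht h
  rw [abs_lt] at hz
  have h3 : (m : ℝ) < 0 := by linarith
  have h4 : (-1 : ℝ) < m := by linarith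
  have h5 : m < 0 := by exact_mod_cast h3
  have h6 : -1 < m := by exact_mod_cast h4
  omega

theorem theta_half_sub_ne_zero (ht : 0 < t) {z : ℂ} (hz : |z.re| < 1) (h0 : z.re ≠ 0) :
    theta (1 / 2 - z) (Complex.I * t) ≠ 0 := by
  intro h
  obtain ⟨m, n, h1, -⟩ := re_im_of_theta_eq_zero ht h
  rw [abs_lt] at hz
  simp at h1
  have h3 : (m : ℝ) < 1 := by linarith
  have h4 : (-1 : ℝ) < m := by linarith
  have h5 : m < 1 := by exact_mod_cast h3
  have h6 : -1 < m := by exact_mod_cast h4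
  have h7 : m = 0 := by omega
  subst h7
  apply h0
  simpa using h1

theorem theta_sub_half (z τ : ℂ) : theta (z - 1 / 2) τ = theta (1 / 2 - z) τ := by
  rw [← theta_neg]
  congr 1
  ring

theorem theta_neg_sub_half (z τ : ℂ) : theta (-z - 1 / 2) τ = theta (1 / 2 - z) τ := by
  rw [← theta_add_one]
  congr 1
  ring

/-- `θ₃(z - Λ/(2π) | i t) / θ₃(z | i t)`. -/
noncomputable def thetaQuot (t Λ : ℝ) (z : ℂ) : ℂ :=
  theta (z - lamTilde Λ) (Complex.I * t) / theta z (Complex.I * t)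

theorem thetaQuot_add_one (t Λ : ℝ) (z : ℂ) : thetaQuot t Λ (z + 1) = thetaQuot t Λ z := by
  rw [thetaQuot, thetaQuot, theta_add_one, show z + 1 - lamTilde Λ = z - lamTilde Λ + 1 by ring,
    theta_add_one]

theorem thetaQuot_add_tau (t Λ : ℝ) (z : ℂ) :
    thetaQuot t Λ (z + Complex.I * t) = Complex.exp (Complex.I * Λ) * thetaQuot t Λ z := by
  rw [thetaQuot, thetaQuot, theta_add_tau,
    show z + Complex.I * t - lamTilde Λ = z - lamTilde Λ + Complex.I * t by ring, theta_add_tau,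
    mul_div_mul_comm, ← Complex.exp_sub]
  congr 2
  have hpi : (Real.pi : ℂ) ≠ 0 := by exact_mod_cast Real.pi_ne_zero
  rw [lamTilde]
  push_cast
  field_simp
  ring

theorem thetaQuot_sub_tau (t Λ : ℝ) (z : ℂ) :
    thetaQuot t Λ (z - Complex.I * t) = Complex.exp (-(Complex.I * Λ)) * thetaQuot t Λ z := by
  have h := thetaQuot_add_tau t Λ (z - Complex.I * t)
  rw [sub_add_cancel] at h
  rw [h, ← mul_assoc, ← Complex.exp_add]
  simp

theorem differentiableAt_thetaQuot (ht : 0 < t) (Λ : ℝ) {z : ℂ}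
    (hz : theta z (Complex.I * t) ≠ 0) : DifferentiableAt ℂ (thetaQuot t Λ) z := by
  have h := differentiable_theta ht
  have h1 : DifferentiableAt ℂ (fun z => theta (z - lamTilde Λ) (Complex.I * t)) z :=
    (h (z - lamTilde Λ)).comp z (differentiableAt_id.sub_const _)
  exact h1.div (h z) hz

/-- The matrix `M^mod` in terms of the values of `γ` and of the Abel map. -/
noncomputable def matPhi (t Λ : ℝ) (g b : ℂ) : Matrix (Fin 2) (Fin 2) ℂ :=
  !![(g + g⁻¹) * thetaQuot t Λ b, (g - g⁻¹) * thetaQuot t Λ (-b - 1 / 2);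
     (g - g⁻¹) * thetaQuot t Λ (b - 1 / 2), (g + g⁻¹) * thetaQuot t Λ (-b)]

theorem matPhi_neg (t Λ : ℝ) (g b : ℂ) : matPhi t Λ g (-b) = sigma1 * matPhi t Λ g b * sigma1 := by
  ext i j
  fin_cases i <;> fin_cases j <;> simp [matPhi, sigma1, Matrix.mul_apply, Fin.sum_univ_two]

/-- Modulo the period 1, b ↦ -1/2 - b exchanges the arguments of the two columns, while g ↦ ig turns
g ± g⁻¹ into i(g ∓ g⁻¹). -/
theorem matPhi_upper (t Λ : ℝ) (g b : ℂ) :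
    matPhi t Λ (Complex.I * g) (-(1 / 2) - b) =
      matPhi t Λ g b * !![0, Complex.I; Complex.I, 0] := by
  have h1 : thetaQuot t Λ (-(1 / 2) - b) = thetaQuot t Λ (-b - 1 / 2) := by
    congr 1
    ring
  have h2 : thetaQuot t Λ (-(-(1 / 2) - b) - 1 / 2) = thetaQuot t Λ b := by
    congr 1
    ring
  have h3 : thetaQuot t Λ (-(1 / 2) - b - 1 / 2) = thetaQuot t Λ (-b) := by
    rw [← thetaQuot_add_one]
    congr 1
    ring
  have h4 : thetaQuot t Λ (-(-(1 / 2) - b)) = thetaQuot t Λ (b - 1 / 2) := by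
    rw [← thetaQuot_add_one t Λ (b - 1 / 2)]
    congr 1
    ring
  rw [matPhi, matPhi, h1, h2, h3, h4]
  ext i j
  fin_cases i <;> fin_cases j <;> simp [Matrix.mul_apply, Fin.sum_univ_two] <;> ring

theorem matPhi_lower (t Λ : ℝ) (g b : ℂ) :
    matPhi t Λ (-Complex.I * g) (1 / 2 - b) =
      matPhi t Λ g b * !![0, -Complex.I; -Complex.I, 0] := by
  have h1 : thetaQuot t Λ (1 / 2 - b) = thetaQuot t Λ (-b - 1 / 2) := by
    rw [← thetaQuot_add_one t Λ (-b - 1 / 2)]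
    congr 1
    ring
  have h2 : thetaQuot t Λ (-(1 / 2 - b) - 1 / 2) = thetaQuot t Λ b := by
    rw [← thetaQuot_add_one]
    congr 1
    ring
  have h3 : thetaQuot t Λ (1 / 2 - b - 1 / 2) = thetaQuot t Λ (-b) := by
    congr 1
    ring
  have h4 : thetaQuot t Λ (-(1 / 2 - b)) = thetaQuot t Λ (b - 1 / 2) := by
    congr 1
    ring
  rw [matPhi, matPhi, h1, h2, h3, h4]
  ext i j
  fin_cases i <;> fin_cases j <;> simp [Matrix.mul_apply, Fin.sum_univ_two] <;> ring

/-- The first column depends on b and the second on -b, so the translation by -τ multiplies them by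
inverse exponentials. -/
theorem matPhi_gap (t Λ : ℝ) (g b : ℂ) :
    matPhi t Λ g (b - Complex.I * t) =
      matPhi t Λ g b * !![Complex.exp (-(Complex.I * Λ)), 0; 0, Complex.exp (Complex.I * Λ)] := by
  have e2 : -(b - Complex.I * t) - 1 / 2 = -b - 1 / 2 + Complex.I * t := by ring
  have e3 : b - Complex.I * t - 1 / 2 = b - 1 / 2 - Complex.I * t := by ring
  have e4 : -(b - Complex.I * t) = -b + Complex.I * t := by ring
  ext i j
  fin_cases i <;> fin_cases j <;>
    simp only [matPhi, Matrix.mul_apply, Fin.sum_univ_two, Matrix.of_apply, Matrix.cons_val_zero,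
      Matrix.cons_val_one, Matrix.cons_val', Matrix.cons_val_fin_one, Fin.zero_eta, Fin.mk_one,
      e2, e3] <;> simp only [e4, thetaQuot_add_tau, thetaQuot_sub_tau] <;> ring

theorem tendsto_matrix_iff {X : Type*} {l : Filter X} {f : X → Matrix (Fin 2) (Fin 2) ℂ}
    {P : Matrix (Fin 2) (Fin 2) ℂ} :
    Tendsto f l (𝓝 P) ↔ ∀ i j, Tendsto (fun k => f k i j) l (𝓝 (P i j)) := by
  refine Iff.trans (tendsto_pi_nhds (f := f) (g := P)) (forall_congr' fun i => ?_)
  exact tendsto_pi_nhds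

/-- The order of vanishing of `θ₃` at its zero. -/
theorem isBigO_sub_theta_half (ht : 0 < t) :
    (fun z => z - (1 / 2 + Complex.I * t / 2)) =O[𝓝 (1 / 2 + Complex.I * t / 2)]
      fun z => theta z (Complex.I * t) := by
  obtain ⟨d, hd, h⟩ := exists_hasDerivAt_theta_half ht
  have h1 := (h.isTheta_sub hd).isBigO_symm.comp_tendsto
    (tendsto_id.prodMk tendsto_const_pure)
  refine h1.congr (fun _ => rfl) fun z => ?_
  simp only [Function.comp_apply, id_eq, theta_half_eq_zero, sub_zero]

end ThetaQuotient

/-! ### Holomorphy, jumps and singularities of the matrix model -/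

section MatrixModel

variable {c a Λ : ℝ}

theorem mu_eq (ha : 0 < a) (hac : a < c) (Λ : ℝ) (k : ℂ) :
    mu c a Λ k = thetaQuot (tauIm c a) Λ (abelRed c a k) := by
  rw [mu, thetaQuot, abel_eq_abelRed ha hac, tau_eq ha hac]
  congr 2 <;> ring

theorem nu_eq (ha : 0 < a) (hac : a < c) (Λ : ℝ) (k : ℂ) :
    nu c a Λ k = thetaQuot (tauIm c a) Λ (-abelRed c a k - 1 / 2) := by
  rw [nu, thetaQuot, abel_eq_abelRed ha hac, tau_eq ha hac]
  congr 2 <;> ring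

theorem matMod_eq (ha : 0 < a) (hac : a < c) (Λ : ℝ) (k : ℂ) :
    matMod c a Λ k = matPhi (tauIm c a) Λ (gam c a k) (abelRed c a k) := by
  rw [matMod, matPhi, mu_eq ha hac, nu_eq ha hac, mu_eq ha hac, nu_eq ha hac, abelRed_neg, neg_neg]

theorem theta_abelRed_ne_zero (ha : 0 < a) (hac : a < c) {k : ℂ} (hk : k ∈ cutPlane c) :
    theta (abelRed c a k) (Complex.I * tauIm c a) ≠ 0 :=
  theta_ne_zero_of_abs_im_lt (tauIm_pos ha hac) (abs_im_abelRed_lt ha hac hk)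

theorem theta_half_sub_abelRed_ne_zero (ha : 0 < a) (hac : a < c) {k : ℂ} (hk : k ∈ cutPlane c) :
    theta (1 / 2 - abelRed c a k) (Complex.I * tauIm c a) ≠ 0 := by
  apply theta_ne_zero_of_abs_im_lt (tauIm_pos ha hac)
  have := abs_im_abelRed_lt ha hac hk
  rw [← abs_neg] at this
  simpa using this

/-- The four theta quotients of the matrix model are regular at `b`. -/
theorem differentiableAt_thetaQuot_of_ne_zero {t : ℝ} (ht : 0 < t) (Λ : ℝ) {b : ℂ}
    (h1 : theta b (Complex.I * t) ≠ 0) :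
    DifferentiableAt ℂ (thetaQuot t Λ) b ∧ DifferentiableAt ℂ (fun b => thetaQuot t Λ (-b)) b := by
  refine ⟨differentiableAt_thetaQuot ht Λ h1, ?_⟩
  have h2 : DifferentiableAt ℂ (thetaQuot t Λ) (-b) :=
    differentiableAt_thetaQuot ht Λ (by rwa [theta_neg])
  exact h2.comp b differentiableAt_id.neg

theorem differentiableAt_thetaQuot_half_of_ne_zero {t : ℝ} (ht : 0 < t) (Λ : ℝ) {b : ℂ}
    (h1 : theta (1 / 2 - b) (Complex.I * t) ≠ 0) :
    DifferentiableAt ℂ (fun b => thetaQuot t Λ (-b - 1 / 2)) b ∧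
      DifferentiableAt ℂ (fun b => thetaQuot t Λ (b - 1 / 2)) b := by
  constructor
  · have h2 : DifferentiableAt ℂ (thetaQuot t Λ) (-b - 1 / 2) :=
      differentiableAt_thetaQuot ht Λ (by rwa [theta_neg_sub_half])
    exact h2.comp b (differentiableAt_id.neg.sub_const _)
  · have h2 : DifferentiableAt ℂ (thetaQuot t Λ) (b - 1 / 2) :=
      differentiableAt_thetaQuot ht Λ (by rwa [theta_sub_half])
    exact h2.comp b (differentiableAt_id.sub_const _)

theorem differentiableOn_matMod (ha : 0 < a) (hac : a < c) (Λ : ℝ) (i j : Fin 2) :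
    DifferentiableOn ℂ (fun k => matMod c a Λ k i j) (cutPlane c) := by
  intro k hk
  have ht := tauIm_pos ha hac
  have hg := differentiableAt_gam ha hac (cutPlane_subset_bandPlane (a := a) hk)
  have hgi := hg.inv (gam_ne_zero ha hac (cutPlane_subset_bandPlane hk))
  have hb := (differentiableOn_abelRed ha hac).differentiableAt ((isOpen_cutPlane c).mem_nhds hk)
  obtain ⟨h1, h2⟩ := differentiableAt_thetaQuot_of_ne_zero ht Λ (theta_abelRed_ne_zero ha hac hk)
  obtain ⟨h3, h4⟩ := differentiableAt_thetaQuot_half_of_ne_zero ht Λ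
    (theta_half_sub_abelRed_ne_zero ha hac hk)
  apply DifferentiableAt.differentiableWithinAt
  simp only [matMod_eq ha hac, matPhi]
  fin_cases i <;> fin_cases j
  · exact (hg.add hgi).mul (h1.comp k hb)
  · exact (hg.sub hgi).mul (h3.comp k hb)
  · exact (hg.sub hgi).mul (h4.comp k hb)
  · exact (hg.add hgi).mul (h2.comp k hb)

theorem matMod_symm (ha : 0 < a) (hac : a < c) (Λ : ℝ) (k : ℂ) :
    matMod c a Λ (-k) = sigma1 * matMod c a Λ k * sigma1 := by
  rw [matMod_eq ha hac, matMod_eq ha hac, gam_neg, abelRed_neg, matPhi_neg]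

theorem re_abelRight_ne_zero (ha : 0 < a) (hac : a < c) {y : ℝ} (h : |y| ≤ c) (h0 : y ≠ 0) :
    (abelRight c a y).re ≠ 0 := by
  rcases lt_or_ge |y| a with h1 | h1
  · exact re_abelRight_gap_ne_zero ha hac h1 h0
  · rcases abs_cases y with ⟨h2, -⟩ | ⟨h2, -⟩
    · rw [h2] at h h1
      rw [re_abelRight_band ha hac h1 h]
      norm_num
    · rw [h2] at h h1
      have := re_abelRight_band ha hac h1 h
      rw [re_abelRight_neg ha hac] at this
      intro h3
      rw [h3] at this
      norm_num at this

theorem theta_abelRight_ne_zero (ha : 0 < a) (hac : a < c) {y : ℝ} (h : |y| ≤ c) :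
    theta (abelRight c a y) (Complex.I * tauIm c a) ≠ 0 :=
  theta_ne_zero_of_abs_re_lt (tauIm_pos ha hac)
    ((abs_re_abelRight_le ha hac h).trans_lt (by norm_num))

theorem theta_half_sub_abelRight_ne_zero (ha : 0 < a) (hac : a < c) {y : ℝ} (h : |y| ≤ c)
    (h0 : y ≠ 0) : theta (1 / 2 - abelRight c a y) (Complex.I * tauIm c a) ≠ 0 :=
  theta_half_sub_ne_zero (tauIm_pos ha hac)
    ((abs_re_abelRight_le ha hac h).trans_lt (by norm_num)) (re_abelRight_ne_zero ha hac h h0)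

theorem isBigO_theta_half_sub_abelRed (ha : 0 < a) (hac : a < c) :
    (fun k : ℂ => k) =O[𝓝[{k | 0 < k.re}] 0]
      fun k => theta (1 / 2 - abelRed c a k) (Complex.I * tauIm c a) := by
  have ht := tauIm_pos ha hac
  have h0 : Tendsto (fun k => 1 / 2 - abelRed c a k) (𝓝[{k : ℂ | 0 < k.re}] 0)
      (𝓝 (1 / 2 + Complex.I * tauIm c a / 2)) := by
    have := (tendsto_abelRed_right ha hac 0).const_sub (1 / 2)
    rw [abelRight_zero ha hac, Complex.ofReal_zero, mul_zero] at this
    convert this using 2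
    ring
  refine ((isBigO_sub_abelRight_zero ha hac).trans ?_).trans
    ((isBigO_sub_theta_half ht).comp_tendsto h0)
  refine (isBigO_refl _ _).neg_left.congr_left fun k => ?_
  rw [abelRight_zero ha hac, Function.comp_apply]
  ring

/-- Near the origin B leaves its limit -τ/2 at linear rate and the zero of θ₃ is simple, so the
denominator vanishes to first order at most. The factor γ - γ⁻¹ = o(k) is smaller. -/
theorem tendsto_mul_theta_quotient_zero (ha : 0 < a) (hac : a < c) {f : ℂ → ℂ} {p : ℂ}
    (hf : Tendsto f (𝓝[{k | 0 < k.re}] 0) (𝓝 p)) :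
    Tendsto (fun k => (gam c a k - (gam c a k)⁻¹) *
      (f k / theta (1 / 2 - abelRed c a k) (Complex.I * tauIm c a)))
      (𝓝[{k | 0 < k.re}] 0) (𝓝 0) := by
  have h1 := ((isLittleO_gam_sub_inv ha hac).mono
    (nhdsWithin_le_nhds (s := {k : ℂ | 0 < k.re}))).trans_isBigO
      (isBigO_theta_half_sub_abelRed ha hac)
  have h2 := h1.tendsto_div_nhds_zero.mul hf
  rw [zero_mul] at h2
  refine h2.congr fun k => ?_
  ring

theorem tendsto_matMod_right (ha : 0 < a) (hac : a < c) (Λ : ℝ) {y : ℝ} (h1 : |y| < c)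
    (h2 : |y| ≠ a) :
    Tendsto (matMod c a Λ) (𝓝[{k | 0 < k.re}] (Complex.I * y))
      (𝓝 (matPhi (tauIm c a) Λ (gamRight c a y) (abelRight c a y))) := by
  have ht := tauIm_pos ha hac
  have hg := tendsto_gam_right ha hac h2 h1.ne
  have hgi := hg.inv₀ (gamRight_ne_zero ha hac h2 h1.ne)
  have hb := tendsto_abelRed_right ha hac y
  obtain ⟨q1, q2⟩ := differentiableAt_thetaQuot_of_ne_zero ht Λ
    (theta_abelRight_ne_zero ha hac h1.le)
  have key : Tendsto (fun k => (gam c a k - (gam c a k)⁻¹) *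
        thetaQuot (tauIm c a) Λ (-abelRed c a k - 1 / 2)) (𝓝[{k | 0 < k.re}] (Complex.I * y))
        (𝓝 ((gamRight c a y - (gamRight c a y)⁻¹) *
          thetaQuot (tauIm c a) Λ (-abelRight c a y - 1 / 2))) ∧
      Tendsto (fun k => (gam c a k - (gam c a k)⁻¹) *
        thetaQuot (tauIm c a) Λ (abelRed c a k - 1 / 2)) (𝓝[{k | 0 < k.re}] (Complex.I * y))
        (𝓝 ((gamRight c a y - (gamRight c a y)⁻¹) *
          thetaQuot (tauIm c a) Λ (abelRight c a y - 1 / 2))) := by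
    -- The origin is the only point of the segment where θ₃(1/2 - B₊) vanishes. The claimed limit is
    -- still correct there, since γ₊(0) = 1 makes the coefficient zero.
    by_cases h0 : y = 0
    · subst h0
      have hth := (differentiable_theta ht).continuous
      rw [gamRight_zero ha hac, inv_one, sub_self, zero_mul, zero_mul]
      rw [Complex.ofReal_zero, mul_zero] at hb ⊢
      constructor
      · have h3 := (hth.tendsto _).comp ((hb.neg.sub_const (1 / 2)).sub_const (lamTilde Λ))
        refine (tendsto_mul_theta_quotient_zero ha hac h3).congr fun k => ?_
        rw [thetaQuot, theta_neg_sub_half]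
        rfl
      · have h3 := (hth.tendsto _).comp ((hb.sub_const (1 / 2)).sub_const (lamTilde Λ))
        refine (tendsto_mul_theta_quotient_zero ha hac h3).congr fun k => ?_
        rw [thetaQuot, theta_sub_half]
        rfl
    · obtain ⟨q3, q4⟩ := differentiableAt_thetaQuot_half_of_ne_zero ht Λ
        (theta_half_sub_abelRight_ne_zero ha hac h1.le h0)
      exact ⟨(hg.sub hgi).mul (q3.continuousAt.tendsto.comp hb),
        (hg.sub hgi).mul (q4.continuousAt.tendsto.comp hb)⟩
  rw [tendsto_matrix_iff]
  intro i j
  simp only [matMod_eq ha hac, matPhi]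
  fin_cases i <;> fin_cases j
  · exact (hg.add hgi).mul (q1.continuousAt.tendsto.comp hb)
  · exact key.1
  · exact key.2
  · exact (hg.add hgi).mul (q2.continuousAt.tendsto.comp hb)

theorem tendsto_matMod_left (ha : 0 < a) (hac : a < c) (Λ : ℝ) {y : ℝ} (h1 : |y| < c)
    (h2 : |y| ≠ a) :
    Tendsto (matMod c a Λ) (𝓝[{k | k.re < 0}] (Complex.I * y))
      (𝓝 (matPhi (tauIm c a) Λ (gamRight c a (-y)) (-abelRight c a (-y)))) := by
  have h := (tendsto_matMod_right ha hac Λ (y := -y) (by rwa [abs_neg]) (by rwa [abs_neg])).comp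
    (tendsto_neg_left y)
  have h3 : Continuous fun X : Matrix (Fin 2) (Fin 2) ℂ => sigma1 * X * sigma1 := by fun_prop
  have h4 := (h3.tendsto _).comp h
  rw [← matPhi_neg] at h4
  refine h4.congr fun k => ?_
  simp only [Function.comp_apply]
  rw [← matMod_symm ha hac, neg_neg]

theorem matMod_jump (ha : 0 < a) (hac : a < c) (Λ : ℝ) {y : ℝ} (h1 : |y| < c) (h2 : |y| ≠ a) :
    ∃ P Q : Matrix (Fin 2) (Fin 2) ℂ, HasBoundaryValues (matMod c a Λ) y P Q ∧
      P = Q * vMod a Λ y := by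
  refine ⟨_, _, ⟨tendsto_matMod_right ha hac Λ h1 h2, tendsto_matMod_left ha hac Λ h1 h2⟩, ?_⟩
  obtain ⟨h3, h4⟩ := abs_lt.1 h1
  unfold vMod
  split_ifs with h5 h6
  · rw [gamRight_upper ha h5 h4, abelRight_upper ha hac h5.le h4.le, matPhi_upper]
  · rw [gamRight_lower ha (y := y) (by linarith) (by linarith),
      abelRight_lower ha hac (y := y) (by linarith) (by linarith), matPhi_lower]
  · have h7 : |y| < a := lt_of_le_of_ne (abs_le.2 ⟨by linarith, by linarith⟩) h2
    rw [gamRight_gap h7, abelRight_gap ha hac h7.le, matPhi_gap]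

/-- At a point of the segment B has up to two limits, one from each side; boundedness only needs f
to be continuous at both. -/
theorem isBigO_comp_abelRed_node (ha : 0 < a) (hac : a < c) {y : ℝ} {f : ℂ → ℂ}
    (h1 : ContinuousAt f (abelRight c a y)) (h2 : ContinuousAt f (-abelRight c a (-y))) :
    (fun k => f (abelRed c a k)) =O[𝓝[cutPlane c] (Complex.I * y)] fun _ => (1 : ℝ) := by
  have h := (h1.isBigO_one ℝ).sup (h2.isBigO_one ℝ)
  exact h.comp_tendsto (tendsto_abelRed_cutPlane ha hac y)

theorem isBigO_matMod_node (ha : 0 < a) (hac : a < c) (Λ : ℝ) {κ : ℂ} (hκ : κ ∈ nodes c a)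
    (i j : Fin 2) :
    (fun k => matMod c a Λ k i j) =O[𝓝[cutPlane c] κ] fun k => ‖k - κ‖ ^ (-(1 / 4) : ℝ) := by
  obtain ⟨y, hy, rfl⟩ := (mem_nodes_iff ha hac).1 hκ
  have ht := tauIm_pos ha hac
  have hyc : |y| ≤ c := by rcases hy with h | h <;> rw [h]; exact hac.le
  have hyc' : |(-y)| ≤ c := by rwa [abs_neg]
  have hy0 : y ≠ 0 := by
    rintro rfl
    rcases hy with h | h <;> simp at h <;> linarith
  obtain ⟨q1, q2⟩ := differentiableAt_thetaQuot_of_ne_zero ht Λ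
    (theta_abelRight_ne_zero ha hac hyc)
  obtain ⟨q3, q4⟩ := differentiableAt_thetaQuot_half_of_ne_zero ht Λ
    (theta_half_sub_abelRight_ne_zero ha hac hyc hy0)
  have e1 : theta (-abelRight c a (-y)) (Complex.I * tauIm c a) ≠ 0 := by
    rw [theta_neg]
    exact theta_abelRight_ne_zero ha hac hyc'
  have e2 : theta (1 / 2 - -abelRight c a (-y)) (Complex.I * tauIm c a) ≠ 0 := by
    rw [← theta_neg_sub_half, neg_neg, theta_sub_half]
    exact theta_half_sub_abelRight_ne_zero ha hac hyc' (neg_ne_zero.2 hy0)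
  obtain ⟨r1, r2⟩ := differentiableAt_thetaQuot_of_ne_zero ht Λ e1
  obtain ⟨r3, r4⟩ := differentiableAt_thetaQuot_half_of_ne_zero ht Λ e2
  have g1 := isBigO_gam_node ha hac hy
  have g2 := isBigO_gam_inv_node ha hac hy
  have key : ∀ {f g : ℂ → ℂ}, ContinuousAt f (abelRight c a y) →
      ContinuousAt f (-abelRight c a (-y)) →
      (g =O[𝓝[cutPlane c] (Complex.I * y)] fun k => ‖k - Complex.I * y‖ ^ (-(1 / 4) : ℝ)) →
      (fun k => g k * f (abelRed c a k)) =O[𝓝[cutPlane c] (Complex.I * y)]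
        fun k => ‖k - Complex.I * y‖ ^ (-(1 / 4) : ℝ) := by
    intro f g hf hf' hg
    exact (hg.mul (isBigO_comp_abelRed_node ha hac hf hf')).congr_right fun k => mul_one _
  simp only [matMod_eq ha hac, matPhi]
  fin_cases i <;> fin_cases j
  · exact key q1.continuousAt r1.continuousAt (g1.add g2)
  · exact key q3.continuousAt r3.continuousAt (g1.sub g2)
  · exact key q4.continuousAt r4.continuousAt (g1.sub g2)
  · exact key q2.continuousAt r2.continuousAt (g1.add g2)

theorem tendsto_mu_cocompact (ha : 0 < a) (hac : a < c) (Λ : ℝ) :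
    Tendsto (mu c a Λ) (cocompact ℂ) (𝓝 (thetaQuot (tauIm c a) Λ 0)) := by
  have ht := tauIm_pos ha hac
  have h := (differentiableAt_thetaQuot ht Λ (z := 0)
    (theta_ne_zero_of_abs_im_lt ht (by simpa using ht))).continuousAt.tendsto.comp
      (tendsto_abelRed_cocompact ha hac)
  exact h.congr fun k => (mu_eq ha hac Λ k).symm

theorem tendsto_nu_cocompact (ha : 0 < a) (hac : a < c) (Λ : ℝ) :
    Tendsto (nu c a Λ) (cocompact ℂ) (𝓝 (thetaQuot (tauIm c a) Λ (-(1 / 2)))) := by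
  have ht := tauIm_pos ha hac
  have h1 := ((tendsto_abelRed_cocompact ha hac).neg.sub_const (1 / 2))
  rw [neg_zero, zero_sub] at h1
  have h := (differentiableAt_thetaQuot ht Λ (z := -(1 / 2))
    (theta_ne_zero_of_abs_im_lt ht (by simpa using ht))).continuousAt.tendsto.comp h1
  exact h.congr fun k => (nu_eq ha hac Λ k).symm

theorem tendsto_neg_cocompact : Tendsto (fun k : ℂ => -k) (cocompact ℂ) (cocompact ℂ) :=
  (Homeomorph.neg ℂ).isClosedEmbedding.tendsto_cocompact

theorem tendsto_matMod_cocompact (ha : 0 < a) (hac : a < c) (Λ : ℝ) :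
    Tendsto (matMod c a Λ) (cocompact ℂ)
      (𝓝 (matPhi (tauIm c a) Λ (√(c / a) : ℝ) 0)) := by
  have hg := tendsto_gam_cocompact c a
  have hgi := hg.inv₀ (ofReal_sqrt_ne_zero ha hac)
  have hm := tendsto_mu_cocompact ha hac Λ
  have hn := tendsto_nu_cocompact ha hac Λ
  have e : thetaQuot (tauIm c a) Λ (0 - 1 / 2) = thetaQuot (tauIm c a) Λ (-(1 / 2)) := by
    congr 1
    ring
  rw [tendsto_matrix_iff]
  intro i j
  simp only [matMod, matPhi, neg_zero, e]
  fin_cases i <;> fin_cases j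
  · exact (hg.add hgi).mul hm
  · exact (hg.sub hgi).mul hn
  · exact (hg.sub hgi).mul (hn.comp tendsto_neg_cocompact)
  · exact (hg.add hgi).mul (hm.comp tendsto_neg_cocompact)

end MatrixModel

/-! ### The jump-free principle and the determinant -/

section Liouville

variable {c a : ℝ}

theorem dense_cutPlane (c : ℝ) : Dense (cutPlane c) := by
  have h : Dense {k : ℂ | k.re ≠ 0} := by
    have h1 : Dense ({0}ᶜ : Set ℝ) := dense_compl_singleton 0
    exact h1.preimage Complex.isOpenMap_re
  exact h.mono fun k hk => mem_cutPlane_of_re_ne hk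

/-- An even function without jumps, with weak singularities at finitely many points of the cut and
of growth `o(k²)`, is constant. -/
theorem exists_eq_const {f : ℂ → ℂ} (hf : DifferentiableOn ℂ f (cutPlane c))
    (heven : ∀ k ∈ cutPlane c, f (-k) = f k) {S : Set ℝ} (hS : S.Finite) (hcS : c ∈ S)
    (hcS' : -c ∈ S) (hb : ∀ y, |y| < c → y ∉ S → ∃ p, HasBoundaryValues f y p p)
    (hs : ∀ y ∈ S, f =O[𝓝[cutPlane c] (Complex.I * y)]
      fun k => ‖k - Complex.I * y‖ ^ (-(1 / 2) : ℝ))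
    (ho : f =o[cocompact ℂ] fun k => k ^ 2) : ∃ C, ∀ k ∈ cutPlane c, f k = C := by
  obtain ⟨F, hF, hFf⟩ := exists_entire_extension hf hS hcS hcS' hb hs
  have hFe : ∀ k, F (-k) = F k := by
    have : (fun k => F (-k)) = F := by
      refine Continuous.ext_on (dense_cutPlane c) (hF.continuous.comp continuous_neg)
        hF.continuous fun k hk => ?_
      rw [hFf hk, hFf (neg_mem_cutPlane hk), heven k hk]
    exact fun k => congrFun this k
  have hFo : F =o[cocompact ℂ] fun k => k ^ 2 := by
    refine ho.congr' ?_ EventuallyEq.rfl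
    filter_upwards [eventually_cocompact_mem_cutPlane c] with k hk
    exact (hFf hk).symm
  refine ⟨F 0, fun k hk => ?_⟩
  rw [← hFf hk, even_entire_eq_of_isLittleO_sq hF hFe hFo]

/-- The heights of the nodes. -/
def nodeHeights (c a : ℝ) : Set ℝ := {c, a, -a, -c}

theorem finite_nodeHeights (c a : ℝ) : (nodeHeights c a).Finite := by
  simp [nodeHeights]

theorem abs_of_mem_nodeHeights (ha : 0 < a) (hac : a < c) {y : ℝ} (hy : y ∈ nodeHeights c a) :
    |y| = a ∨ |y| = c := by
  have hc := ha.trans hac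
  rcases hy with rfl | rfl | rfl | rfl
  · exact Or.inr (abs_of_pos hc)
  · exact Or.inl (abs_of_pos ha)
  · exact Or.inl (by rw [abs_neg, abs_of_pos ha])
  · exact Or.inr (by rw [abs_neg, abs_of_pos hc])

theorem abs_ne_of_notMem_nodeHeights {y : ℝ} (hy : y ∉ nodeHeights c a) : |y| ≠ a := by
  intro h
  apply hy
  rcases eq_or_eq_neg_of_abs_eq h with rfl | rfl <;> simp [nodeHeights]

theorem isLittleO_sq_of_isBigO_one {f : ℂ → ℂ} (h : f =O[cocompact ℂ] fun _ => (1 : ℝ)) :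
    f =o[cocompact ℂ] fun k : ℂ => k ^ 2 := by
  refine h.trans_isLittleO ?_
  rw [isLittleO_const_left]
  right
  have h1 := (tendsto_pow_atTop (α := ℝ) two_ne_zero).comp (tendsto_norm_cocompact_atTop (E := ℂ))
  exact h1.congr fun k => (norm_pow k 2).symm

theorem isBigO_mul_quarter {κ : ℂ} {l : Filter ℂ} {f g : ℂ → ℂ}
    (hf : f =O[l] fun k => ‖k - κ‖ ^ (-(1 / 4) : ℝ))
    (hg : g =O[l] fun k => ‖k - κ‖ ^ (-(1 / 4) : ℝ)) :
    (fun k => f k * g k) =O[l] fun k => ‖k - κ‖ ^ (-(1 / 2) : ℝ) := by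
  refine (hf.mul hg).congr_right fun k => ?_
  rw [← Real.rpow_add' (norm_nonneg _) (by norm_num)]
  norm_num

theorem det_vMod (a Λ y : ℝ) : (vMod a Λ y).det = 1 := by
  unfold vMod
  split_ifs
  · simp [Matrix.det_fin_two]
  · simp [Matrix.det_fin_two]
  · simp [Matrix.det_fin_two, ← Complex.exp_add]

/-- The jump matrices and σ₁² have determinant 1, two singularities of order -1/4 multiply to -1/2,
and M has a limit at infinity. -/
theorem exists_det_matMod_eq_const (ha : 0 < a) (hac : a < c) (Λ : ℝ) :
    ∃ C, ∀ k ∈ cutPlane c, (matMod c a Λ k).det = C := by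
  have hc := ha.trans hac
  have hdet : Continuous fun X : Matrix (Fin 2) (Fin 2) ℂ => X.det := by fun_prop
  apply exists_eq_const (S := nodeHeights c a)
  · simp only [Matrix.det_fin_two]
    exact ((differentiableOn_matMod ha hac Λ 0 0).mul (differentiableOn_matMod ha hac Λ 1 1)).sub
      ((differentiableOn_matMod ha hac Λ 0 1).mul (differentiableOn_matMod ha hac Λ 1 0))
  · intro k _
    rw [matMod_symm ha hac, Matrix.det_mul, Matrix.det_mul, sigma1, Matrix.det_fin_two_of]
    ring
  · exact finite_nodeHeights c a
  · simp [nodeHeights]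
  · simp [nodeHeights]
  · intro y hy hyS
    obtain ⟨P, Q, ⟨h1, h2⟩, h3⟩ := matMod_jump ha hac Λ hy (abs_ne_of_notMem_nodeHeights hyS)
    refine ⟨Q.det, ?_, (hdet.tendsto Q).comp h2⟩
    have h4 := (hdet.tendsto P).comp h1
    rwa [h3, Matrix.det_mul, det_vMod, mul_one] at h4
  · intro y hy
    have hκ := (mem_nodes_iff ha hac).2 ⟨y, abs_of_mem_nodeHeights ha hac hy, rfl⟩
    have h := isBigO_matMod_node ha hac Λ hκ
    simp only [Matrix.det_fin_two]
    exact (isBigO_mul_quarter (h 0 0) (h 1 1)).sub (isBigO_mul_quarter (h 0 1) (h 1 0))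
  · apply isLittleO_sq_of_isBigO_one
    exact ((hdet.tendsto _).comp (tendsto_matMod_cocompact ha hac Λ)).isBigO_one ℝ

/-- The constant is read off in the limit k → 0 from the right: γ = 1 removes the off-diagonal
entries, and B = -τ/2. -/
theorem det_matMod (ha : 0 < a) (hac : a < c) (Λ : ℝ) {k : ℂ} (hk : k ∈ cutPlane c) :
    (matMod c a Λ k).det =
      4 * (theta (tau c a / 2 - lamTilde Λ) (tau c a) *
        theta (-(tau c a / 2) - lamTilde Λ) (tau c a)) / theta (tau c a / 2) (tau c a) ^ 2 := by
  have hc := ha.trans hac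
  obtain ⟨C, hC⟩ := exists_det_matMod_eq_const ha hac Λ
  have hdet : Continuous fun X : Matrix (Fin 2) (Fin 2) ℂ => X.det := by fun_prop
  have h1 := (hdet.tendsto _).comp
    (tendsto_matMod_right ha hac Λ (y := 0) (by simpa using hc) (by simpa using ha.ne))
  have h2 : Tendsto (fun k => (matMod c a Λ k).det) (𝓝[{k | 0 < k.re}] (Complex.I * (0 : ℝ)))
      (𝓝 C) := by
    refine tendsto_const_nhds.congr' ?_
    filter_upwards [self_mem_nhdsWithin] with z hz
    exact (hC z (mem_cutPlane_of_re_ne (ne_of_gt hz))).symm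
  have := nhdsWithin_right_neBot 0
  rw [hC k hk, tendsto_nhds_unique h2 h1, gamRight_zero ha hac, abelRight_zero ha hac, tau_eq ha hac]
  simp only [matPhi, inv_one, sub_self, zero_mul, Matrix.det_fin_two_of, mul_zero, sub_zero, neg_neg,
    thetaQuot, theta_neg]
  ring

theorem det_matMod_eq_zero_iff (ha : 0 < a) (hac : a < c) (Λ : ℝ) {k : ℂ} (hk : k ∈ cutPlane c) :
    (matMod c a Λ k).det = 0 ↔ ∃ n : ℤ, Λ = Real.pi * (2 * n + 1) := by
  have ht := tauIm_pos ha hac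
  set t := tauIm c a with htdef
  have hpi := Real.pi_pos
  have h0 : theta (Complex.I * t / 2) (Complex.I * t) ≠ 0 := by
    apply theta_ne_zero_of_abs_re_lt ht
    simp
  have hlam : lamTilde Λ = ((Λ / (2 * Real.pi) : ℝ) : ℂ) := rfl
  rw [det_matMod ha hac Λ hk, tau_eq ha hac, ← htdef]
  constructor
  · intro h
    rw [div_eq_zero_iff, or_iff_left (pow_ne_zero 2 h0), mul_eq_zero,
      or_iff_right (by norm_num), mul_eq_zero] at h
    -- τ/2 is purely imaginary, so the real part of a zero says -Λ/(2π) ∈ 1/2 + ℤ.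
    have key : ∀ z : ℂ, z.re = 0 → theta (z - lamTilde Λ) (Complex.I * t) = 0 →
        ∃ n : ℤ, Λ = Real.pi * (2 * n + 1) := by
      intro z hz h1
      obtain ⟨m, -, h2, -⟩ := re_im_of_theta_eq_zero ht h1
      rw [Complex.sub_re, hz, hlam, Complex.ofReal_re] at h2
      refine ⟨-m - 1, ?_⟩
      field_simp at h2
      push_cast
      linarith
    rcases h with h | h
    · exact key _ (by simp) h
    · exact key _ (by simp) h
  · rintro ⟨n, hn⟩
    have h1 : theta (-(Complex.I * t / 2) - lamTilde Λ) (Complex.I * t) = 0 := by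
      have h2 : -(Complex.I * t / 2) - lamTilde Λ = -(1 / 2 + Complex.I * t / 2 + n) := by
        have hpi' : (Real.pi : ℂ) ≠ 0 := by exact_mod_cast hpi.ne'
        rw [hlam, hn]
        push_cast
        field_simp
        ring
      rw [h2, theta_neg]
      have h3 : ∀ z : ℂ, theta (z + n) (Complex.I * t) = theta z (Complex.I * t) := by
        intro z
        have hp : Function.Periodic (fun z => theta z (Complex.I * t)) 1 :=
          fun z => theta_add_one z _
        have := hp.int_mul n z
        simpa using this
      rw [h3, theta_half_eq_zero]
    rw [h1]
    simp

end Liouville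

/-! ### Uniqueness for the vector problem -/

section Uniqueness

variable {c a Λ : ℝ} {m n : ℂ → Fin 2 → ℂ}

theorem IsVectorModelSolution.differentiableOn_apply (hm : IsVectorModelSolution c a Λ m)
    (i : Fin 2) : DifferentiableOn ℂ (fun k => m k i) (cutPlane c) :=
  differentiableOn_pi.1 hm.holomorphic i

theorem IsVectorModelSolution.neg_apply (hm : IsVectorModelSolution c a Λ m) {k : ℂ}
    (hk : k ∈ cutPlane c) : m (-k) 0 = m k 1 ∧ m (-k) 1 = m k 0 := by
  rw [hm.symmetric k hk]
  simp [sigma1, Matrix.vecMul, dotProduct, Fin.sum_univ_two]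

theorem IsVectorModelSolution.tendsto_apply (hm : IsVectorModelSolution c a Λ m) (i : Fin 2) :
    Tendsto (fun k => m k i) (cocompact ℂ) (𝓝 1) := by
  have := tendsto_pi_nhds.1 hm.normalized i
  fin_cases i <;> simpa using this

theorem IsVectorModelSolution.isBigO_apply (ha : 0 < a) (hac : a < c)
    (hm : IsVectorModelSolution c a Λ m) {y : ℝ} (hy : y ∈ nodeHeights c a) (i : Fin 2) :
    (fun k => m k i) =O[𝓝[cutPlane c] (Complex.I * y)]
      fun k => ‖k - Complex.I * y‖ ^ (-(1 / 4) : ℝ) :=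
  isBigO_pi.1 (hm.singular _ ((mem_nodes_iff ha hac).2
    ⟨y, abs_of_mem_nodeHeights ha hac hy, rfl⟩)) i

theorem IsVectorModelSolution.jump_apply (hm : IsVectorModelSolution c a Λ m) {y : ℝ}
    (h1 : |y| < c) (h2 : |y| ≠ a) : ∃ p q : Fin 2 → ℂ,
      (∀ i, HasBoundaryValues (fun k => m k i) y (p i) (q i)) ∧ p = Matrix.vecMul q (vMod a Λ y) := by
  obtain ⟨p, q, ⟨h3, h4⟩, h5⟩ := hm.jump y h1 h2
  exact ⟨p, q, fun i => ⟨tendsto_pi_nhds.1 h3 i, tendsto_pi_nhds.1 h4 i⟩, h5⟩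

theorem hasBoundaryValues_w (ha : 0 < a) (hac : a < c) {y : ℝ} (h1 : |y| ≠ a) (h2 : |y| ≠ c) :
    HasBoundaryValues (w c a) y (wRight c a y) (wRight c a (-y)) := by
  refine ⟨tendsto_w_right ha hac h1 h2, ?_⟩
  refine ((tendsto_w_right ha hac (y := -y) (by rwa [abs_neg]) (by rwa [abs_neg])).comp
    (tendsto_neg_left y)).congr fun k => ?_
  simp [w_neg]

/-- The symmetric bilinear form in two solutions that is free of jumps after multiplication
by `w`. -/
theorem hasBoundaryValues_symm_form (ha : 0 < a) (hac : a < c)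
    (hm : IsVectorModelSolution c a Λ m) (hn : IsVectorModelSolution c a Λ n) {y : ℝ}
    (h1 : |y| < c) (h2 : |y| ≠ a) :
    ∃ p, HasBoundaryValues (fun k => (m k 0 * n k 1 + m k 1 * n k 0) * w c a k) y p p := by
  obtain ⟨p, q, hpq, hp⟩ := hm.jump_apply h1 h2
  obtain ⟨p', q', hpq', hp'⟩ := hn.jump_apply h1 h2
  have hw := hasBoundaryValues_w ha hac h2 h1.ne
  refine ⟨(q 0 * q' 1 + q 1 * q' 0) * wRight c a (-y), ?_,
    ((((hpq 0).2.mul (hpq' 1).2).add ((hpq 1).2.mul (hpq' 0).2)).mul hw.2)⟩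
  have h3 := ((((hpq 0).1.mul (hpq' 1).1).add ((hpq 1).1.mul (hpq' 0).1)).mul hw.1)
  convert h3 using 2
  obtain ⟨h4, h5⟩ := abs_lt.1 h1
  rw [hp, hp']
  unfold vMod
  -- On a band the swap with factors ±i multiplies the form by -1, and w changes sign too; in the
  -- gap the exponentials cancel.
  split_ifs with h6 h7
  · rw [wRight_upper ha h6 h5]
    simp [Matrix.vecMul, dotProduct, Fin.sum_univ_two]
    linear_combination (q 0 * q' 1 + q 1 * q' 0) * wRight c a (-y) * Complex.I_sq
  · have h8 := wRight_upper (c := c) ha (y := -y) (by linarith) (by linarith)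
    rw [neg_neg] at h8
    rw [h8]
    simp [Matrix.vecMul, dotProduct, Fin.sum_univ_two]
    linear_combination -(q 0 * q' 1 + q 1 * q' 0) * wRight c a y * Complex.I_sq
  · have h7 : |y| < a := lt_of_le_of_ne (abs_le.2 ⟨by linarith, by linarith⟩) h2
    have h9 : Complex.exp (-(Complex.I * Λ)) * Complex.exp (Complex.I * Λ) = 1 := by
      rw [← Complex.exp_add]
      simp
    rw [wRight_gap h7]
    simp only [Matrix.vecMul, dotProduct, Fin.sum_univ_two, Matrix.of_apply, Matrix.cons_val_zero,
      Matrix.cons_val_one, mul_zero, add_zero, zero_add]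
    linear_combination -(q 0 * q' 1 + q 1 * q' 0) * wRight c a (-y) * h9

/-- For two solutions the symmetric form is a monic quadratic polynomial, up to a factor two. -/
theorem exists_symm_form_eq (ha : 0 < a) (hac : a < c)
    (hm : IsVectorModelSolution c a Λ m) (hn : IsVectorModelSolution c a Λ n) :
    ∃ C, ∀ k ∈ cutPlane c, (m k 0 * n k 1 + m k 1 * n k 0) * w c a k = 2 * k ^ 2 + C := by
  have hc := ha.trans hac
  have hq : ∀ y : ℝ, HasBoundaryValues (fun k : ℂ => 2 * k ^ 2) y (2 * (Complex.I * y) ^ 2)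
      (2 * (Complex.I * y) ^ 2) := by
    intro y
    have h : Continuous fun k : ℂ => 2 * k ^ 2 := by fun_prop
    exact ⟨(h.tendsto _).mono_left nhdsWithin_le_nhds, (h.tendsto _).mono_left nhdsWithin_le_nhds⟩
  -- Normalization gives form → 2 and w/k² → 1, so subtracting 2k² leaves o(k²).
  obtain ⟨C, hC⟩ := exists_eq_const (S := nodeHeights c a)
    (f := fun k => (m k 0 * n k 1 + m k 1 * n k 0) * w c a k - 2 * k ^ 2) (by
      refine DifferentiableOn.sub ?_ (by fun_prop)
      exact (((hm.differentiableOn_apply 0).mul (hn.differentiableOn_apply 1)).add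
        ((hm.differentiableOn_apply 1).mul (hn.differentiableOn_apply 0))).mul
          fun k hk => (differentiableAt_w ha hac
            (cutPlane_subset_bandPlane hk)).differentiableWithinAt)
    (by
      intro k hk
      rw [(hm.neg_apply hk).1, (hm.neg_apply hk).2, (hn.neg_apply hk).1, (hn.neg_apply hk).2, w_neg]
      ring)
    (finite_nodeHeights c a) (by simp [nodeHeights]) (by simp [nodeHeights])
    (by
      intro y hy hyS
      obtain ⟨p, h1, h2⟩ := hasBoundaryValues_symm_form ha hac hm hn hy
        (abs_ne_of_notMem_nodeHeights hyS)
      exact ⟨_, h1.sub (hq y).1, h2.sub (hq y).2⟩)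
    (by
      intro y hy
      have hyc : |y| ≤ c := by
        rcases abs_of_mem_nodeHeights ha hac hy with h | h <;> rw [h]
        exact hac.le
      refine IsBigO.sub ?_ ?_
      · refine (((isBigO_mul_quarter (hm.isBigO_apply ha hac hy 0)
          (hn.isBigO_apply ha hac hy 1)).add (isBigO_mul_quarter (hm.isBigO_apply ha hac hy 1)
          (hn.isBigO_apply ha hac hy 0))).mul (isBigO_w_one ha hac _)).congr_right
            fun k => mul_one _
      · have h : Continuous fun k : ℂ => 2 * k ^ 2 := by fun_prop
        refine ((h.continuousAt.isBigO_one ℝ).mono nhdsWithin_le_nhds).trans ?_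
        exact isBigO_one_norm_rpow_neg (I_mul_notMem_cutPlane hyc) (by norm_num))
    (by
      have h1 := ((((hm.tendsto_apply 0).mul (hn.tendsto_apply 1)).add ((hm.tendsto_apply 1).mul
        (hn.tendsto_apply 0))).mul (tendsto_w_div_sq_cocompact c a)).sub_const 2
      rw [isLittleO_iff_tendsto']
      · have e : ((1 : ℂ) * 1 + 1 * 1) * 1 - 2 = 0 := by norm_num
        rw [e] at h1
        refine h1.congr' ?_
        filter_upwards [(isCompact_singleton (x := (0 : ℂ))).compl_mem_cocompact] with k hk
        have hk' : k ≠ 0 := hk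
        field_simp
      · filter_upwards [(isCompact_singleton (x := (0 : ℂ))).compl_mem_cocompact] with k hk h0
        exact absurd (pow_eq_zero_iff two_ne_zero |>.1 h0) hk)
  exact ⟨C, fun k hk => by linear_combination hC k hk⟩

/-- Two solutions are linearly dependent at every point. -/
theorem wronskian_eq_zero (ha : 0 < a) (hac : a < c)
    (hm : IsVectorModelSolution c a Λ m) (hn : IsVectorModelSolution c a Λ n) {k : ℂ}
    (hk : k ∈ cutPlane c) : m k 0 * n k 1 - m k 1 * n k 0 = 0 := by
  have hc := ha.trans hac
  have hid : ∀ y : ℝ, HasBoundaryValues (fun k : ℂ => k) y (Complex.I * y) (Complex.I * y) :=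
    fun y => ⟨tendsto_id.mono_left nhdsWithin_le_nhds, tendsto_id.mono_left nhdsWithin_le_nhds⟩
  -- The Wronskian itself is odd; the factor k makes it even and later forces the constant to be
  -- zero, through the limit at the origin.
  have hW : ∀ y : ℝ, |y| < c → |y| ≠ a →
      ∃ p, HasBoundaryValues (fun k => k * (m k 0 * n k 1 - m k 1 * n k 0)) y
        (Complex.I * y * p) (Complex.I * y * p) := by
    intro y h1 h2
    obtain ⟨p, q, hpq, hp⟩ := hm.jump_apply h1 h2
    obtain ⟨p', q', hpq', hp'⟩ := hn.jump_apply h1 h2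
    refine ⟨q 0 * q' 1 - q 1 * q' 0, ?_,
      (hid y).2.mul (((hpq 0).2.mul (hpq' 1).2).sub ((hpq 1).2.mul (hpq' 0).2))⟩
    have h3 := (hid y).1.mul (((hpq 0).1.mul (hpq' 1).1).sub ((hpq 1).1.mul (hpq' 0).1))
    convert h3 using 3
    have h4 := det_vMod a Λ y
    rw [Matrix.det_fin_two] at h4
    rw [hp, hp']
    simp only [Matrix.vecMul, dotProduct, Fin.sum_univ_two]
    linear_combination -(q 0 * q' 1 - q 1 * q' 0) * h4
  obtain ⟨C, hC⟩ := exists_eq_const (S := nodeHeights c a)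
    (f := fun k => k * (m k 0 * n k 1 - m k 1 * n k 0)) (by
      exact differentiableOn_id.mul
        (((hm.differentiableOn_apply 0).mul (hn.differentiableOn_apply 1)).sub
        ((hm.differentiableOn_apply 1).mul (hn.differentiableOn_apply 0))))
    (by
      intro k hk
      rw [(hm.neg_apply hk).1, (hm.neg_apply hk).2, (hn.neg_apply hk).1, (hn.neg_apply hk).2]
      ring)
    (finite_nodeHeights c a) (by simp [nodeHeights]) (by simp [nodeHeights])
    (by
      intro y hy hyS
      obtain ⟨p, h⟩ := hW y hy (abs_ne_of_notMem_nodeHeights hyS)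
      exact ⟨_, h⟩)
    (by
      intro y hy
      have h : ContinuousAt (fun k : ℂ => k) (Complex.I * y) := continuousAt_id
      refine (((h.isBigO_one ℝ).mono nhdsWithin_le_nhds).mul
        ((isBigO_mul_quarter (hm.isBigO_apply ha hac hy 0)
          (hn.isBigO_apply ha hac hy 1)).sub (isBigO_mul_quarter (hm.isBigO_apply ha hac hy 1)
          (hn.isBigO_apply ha hac hy 0)))).congr_right fun k => one_mul _)
    (by
      have h1 := ((hm.tendsto_apply 0).mul (hn.tendsto_apply 1)).sub ((hm.tendsto_apply 1).mul
        (hn.tendsto_apply 0))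
      have h2 : (fun k : ℂ => k) =o[cocompact ℂ] fun k => k ^ 2 := by
        rw [isLittleO_iff_tendsto']
        · have h3 := tendsto_inv₀_cobounded (α := ℂ)
          rw [Metric.cobounded_eq_cocompact] at h3
          refine h3.congr' ?_
          filter_upwards [(isCompact_singleton (x := (0 : ℂ))).compl_mem_cocompact] with k hk
          have hk' : k ≠ 0 := hk
          field_simp
        · filter_upwards [(isCompact_singleton (x := (0 : ℂ))).compl_mem_cocompact] with k hk h0
          exact absurd (pow_eq_zero_iff two_ne_zero |>.1 h0) hk
      exact (h2.mul_isBigO (h1.isBigO_one ℂ)).congr_right fun k => mul_one _)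
  have hC0 : C = 0 := by
    obtain ⟨p, h, -⟩ := hW 0 (by simpa using hc) (by simpa using ha.ne)
    have := nhdsWithin_right_neBot 0
    rw [Complex.ofReal_zero, mul_zero, zero_mul] at h
    rw [Complex.ofReal_zero, mul_zero] at this
    refine tendsto_nhds_unique (tendsto_const_nhds.congr' ?_) h
    filter_upwards [self_mem_nhdsWithin] with z hz
    exact (hC z (mem_cutPlane_of_re_ne (ne_of_gt hz))).symm
  have h := hC k hk
  rw [hC0] at h
  exact (mul_eq_zero.1 h).resolve_left (ne_zero_of_mem_cutPlane hc hk)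

theorem isPreconnected_cutPlane (c : ℝ) : IsPreconnected (cutPlane c) := by
  have hu : cutPlane c =
      (({k : ℂ | 0 < k.re} ∪ {k | c < k.im}) ∪ {k | k.re < 0}) ∪ {k | k.im < -c} := by
    ext k
    simp only [cutPlane, Set.mem_ofPred_eq, Set.mem_union, not_and_or, not_le, lt_abs]
    constructor
    · rintro (h | h | h)
      · rcases lt_or_gt_of_ne h with h | h
        · exact Or.inl (Or.inr h)
        · exact Or.inl (Or.inl (Or.inl h))
      · exact Or.inl (Or.inl (Or.inr h))
      · exact Or.inr (by linarith)
    · rintro (((h | h) | h) | h)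
      · exact Or.inl (ne_of_gt h)
      · exact Or.inr (Or.inl h)
      · exact Or.inl (ne_of_lt h)
      · exact Or.inr (Or.inr (by linarith))
  rw [hu]
  refine IsPreconnected.union (⟨1, -(c + 1)⟩ : ℂ) (Or.inl (Or.inl (by simp))) (by simp)
    (IsPreconnected.union (⟨-1, c + 1⟩ : ℂ) (Or.inr (by simp)) (by simp)
      (IsPreconnected.union (⟨1, c + 1⟩ : ℂ) (by simp) (by simp)
        (convex_halfSpace_re_gt 0).isPreconnected (convex_halfSpace_im_gt c).isPreconnected)
      (convex_halfSpace_re_lt 0).isPreconnected) (convex_halfSpace_im_lt (-c)).isPreconnected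

/-- With zero Wronskian, (m₁n₂ + m₂n₁)² = 4 m₁m₂n₁n₂. Multiplied by w² this is an identity between
quadratics in k², which equates the three constants. Equal forms and zero Wronskian then give m₁(m₂
- n₂) = 0. -/
theorem IsVectorModelSolution.unique (ha : 0 < a) (hac : a < c)
    (hm : IsVectorModelSolution c a Λ m) (hn : IsVectorModelSolution c a Λ n) :
    Set.EqOn m n (cutPlane c) := by
  have hc := ha.trans hac
  obtain ⟨α, hα⟩ := exists_symm_form_eq ha hac hm hm
  obtain ⟨β, hβ⟩ := exists_symm_form_eq ha hac hn hn
  obtain ⟨δ, hδ⟩ := exists_symm_form_eq ha hac hm hn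
  have hW : ∀ k ∈ cutPlane c, m k 0 * n k 1 - m k 1 * n k 0 = 0 :=
    fun k hk => wronskian_eq_zero ha hac hm hn hk
  have hpoly : ∀ k ∈ cutPlane c, (2 * k ^ 2 + δ) ^ 2 = (2 * k ^ 2 + α) * (2 * k ^ 2 + β) := by
    intro k hk
    rw [← hα k hk, ← hβ k hk, ← hδ k hk]
    linear_combination w c a k ^ 2 * (m k 0 * n k 1 - m k 1 * n k 0) * hW k hk
  -- Two sample points are enough to compare the coefficients.
  have hp1 := hpoly 1 (mem_cutPlane_of_re_ne (by simp))
  have hp2 := hpoly 2 (mem_cutPlane_of_re_ne (by simp))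
  have hδ' : 2 * δ = α + β := by linear_combination (1 / 6) * hp2 - (1 / 6) * hp1
  have hαβ : α = β := by
    have h1 : (α - β) ^ 2 = 0 := by
      linear_combination 4 * hp1 - (2 * δ + α + β + 8) * hδ'
    exact sub_eq_zero.1 (pow_eq_zero_iff two_ne_zero |>.1 h1)
  have hδα : δ = α := by
    rw [← hαβ] at hδ'
    linear_combination (1 / 2) * hδ'
  have hprod : ∀ k ∈ cutPlane c, m k 0 * (m k 1 - n k 1) = 0 := by
    intro k hk
    have hw := w_ne_zero ha hac (cutPlane_subset_bandPlane (a := a) hk)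
    have h1 := hα k hk
    have h2 := hδ k hk
    rw [hδα] at h2
    have h3 : w c a k * (m k 0 * (m k 1 - n k 1)) = 0 := by
      linear_combination (1 / 2) * h1 - (1 / 2) * h2 - (1 / 2) * w c a k * hW k hk
    exact (mul_eq_zero.1 h3).resolve_left hw
  have hone : Set.EqOn (fun k => m k 1) (fun k => n k 1) (cutPlane c) := by
    -- m₁ → 1 at infinity, so m₁ ≠ 0 near some point; the identity theorem on the connected cut
    -- plane does the rest, and k ↦ -k supplies the other component.
    have hev : ∀ᶠ k in cocompact ℂ, m k 0 ≠ 0 ∧ k ∈ cutPlane c :=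
      ((hm.tendsto_apply 0).eventually_ne one_ne_zero).and (eventually_cocompact_mem_cutPlane c)
    obtain ⟨z, hz, hzc⟩ := hev.exists
    refine ((hm.differentiableOn_apply 1).analyticOnNhd
      (isOpen_cutPlane c)).eqOn_of_preconnected_of_eventuallyEq
      ((hn.differentiableOn_apply 1).analyticOnNhd (isOpen_cutPlane c))
      (isPreconnected_cutPlane c) hzc ?_
    have hcont := ((hm.differentiableOn_apply 0).differentiableAt
      ((isOpen_cutPlane c).mem_nhds hzc)).continuousAt
    filter_upwards [hcont.eventually_ne hz, (isOpen_cutPlane c).mem_nhds hzc] with k hk hkc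
    exact sub_eq_zero.1 ((mul_eq_zero.1 (hprod k hkc)).resolve_left hk)
  intro k hk
  funext i
  fin_cases i
  · have h1 := hone (neg_mem_cutPlane hk)
    simp only [(hm.neg_apply hk).2, (hn.neg_apply hk).2] at h1
    exact h1
  · exact hone hk

theorem cutPlane_right_subset : {k : ℂ | 0 < k.re} ⊆ cutPlane c :=
  fun _ hk => mem_cutPlane_of_re_ne (ne_of_gt hk)

theorem cutPlane_left_subset : {k : ℂ | k.re < 0} ⊆ cutPlane c :=
  fun _ hk => mem_cutPlane_of_re_ne (ne_of_lt hk)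

theorem IsVectorModelSolution.congr (hm : IsVectorModelSolution c a Λ m)
    (h : Set.EqOn n m (cutPlane c)) : IsVectorModelSolution c a Λ n where
  holomorphic := hm.holomorphic.congr h
  jump y h1 h2 := by
    obtain ⟨p, q, ⟨h3, h4⟩, h5⟩ := hm.jump y h1 h2
    refine ⟨p, q, ⟨h3.congr' ?_, h4.congr' ?_⟩, h5⟩
    · filter_upwards [self_mem_nhdsWithin] with k hk using (h (cutPlane_right_subset hk)).symm
    · filter_upwards [self_mem_nhdsWithin] with k hk using (h (cutPlane_left_subset hk)).symm
  symmetric k hk := by rw [h hk, h (neg_mem_cutPlane hk), hm.symmetric k hk]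
  normalized := by
    refine hm.normalized.congr' ?_
    filter_upwards [eventually_cocompact_mem_cutPlane c] with k hk using (h hk).symm
  singular κ hκ := by
    refine (hm.singular κ hκ).congr' ?_ EventuallyEq.rfl
    filter_upwards [self_mem_nhdsWithin] with k hk using (h hk).symm

end Uniqueness

/-! ### The row (1,1)M, and the zeros of the denominator of m^mod -/

section VectorModel

variable {c a Λ : ℝ}

/-- Left multiplication by a constant row respects the jump, and (1,1)σ₁ = (1,1) turns the matrix
symmetry into the vector one. -/
theorem IsVectorModelSolution.of_rowMod (ha : 0 < a) (hac : a < c) {μ ν : ℝ}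
    (hμ : (μ : ℂ) = thetaQuot (tauIm c a) Λ 0) (hν : (ν : ℂ) = thetaQuot (tauIm c a) Λ (-(1 / 2)))
    (hμ0 : 0 < μ) (hν0 : 0 < ν) : IsVectorModelSolution c a Λ (rowMod c a Λ μ ν) := by
  have hc := ha.trans hac
  set s : ℂ := ((√(a * c) / ((c + a) * μ + (c - a) * ν) : ℝ) : ℂ) with hs
  have happ : ∀ k i, rowMod c a Λ μ ν k i = s * (matMod c a Λ k 0 i + matMod c a Λ k 1 i) := by
    intro k i
    simp [rowMod, hs, Matrix.vecMul, dotProduct, Fin.sum_univ_two]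
  have hcont : Continuous fun X : Matrix (Fin 2) (Fin 2) ℂ => s • Matrix.vecMul ![1, 1] X := by
    fun_prop
  constructor
  · rw [differentiableOn_pi]
    intro i
    simp only [happ]
    exact ((differentiableOn_matMod ha hac Λ 0 i).add
      (differentiableOn_matMod ha hac Λ 1 i)).const_mul s
  · intro y h1 h2
    obtain ⟨P, Q, ⟨h3, h4⟩, h5⟩ := matMod_jump ha hac Λ h1 h2
    refine ⟨_, _, ⟨(hcont.tendsto _).comp h3, (hcont.tendsto _).comp h4⟩, ?_⟩
    rw [h5, ← Matrix.vecMul_vecMul, Matrix.smul_vecMul]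
  · intro k _
    have h : Matrix.vecMul ![1, 1] sigma1 = (![1, 1] : Fin 2 → ℂ) := by
      ext i
      fin_cases i <;> simp [sigma1, Matrix.vecMul, dotProduct, Fin.sum_univ_two]
    rw [rowMod, matMod_symm ha hac, rowMod, Matrix.smul_vecMul, ← Matrix.vecMul_vecMul,
      ← Matrix.vecMul_vecMul, h]
  · have h := (hcont.tendsto _).comp (tendsto_matMod_cocompact ha hac Λ)
    have e : s • Matrix.vecMul ![1, 1] (matPhi (tauIm c a) Λ (√(c / a) : ℝ) 0) = ![1, 1] := by
      have e0 : thetaQuot (tauIm c a) Λ (0 - 1 / 2) = thetaQuot (tauIm c a) Λ (-(1 / 2)) := by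
        congr 1
        ring
      have hD : 0 < (c + a) * μ + (c - a) * ν := by
        have : 0 < c - a := by linarith
        positivity
      have hsc : √c ^ 2 = c := Real.sq_sqrt hc.le
      have hsa : √a ^ 2 = a := Real.sq_sqrt ha.le
      have hsc0 : 0 < √c := by positivity
      have hsa0 : 0 < √a := by positivity
      -- The constant comes from √(c/a) ± √(a/c) = (c ± a)/√(ac).
      have key : √(a * c) / ((c + a) * μ + (c - a) * ν) *
          ((√(c / a) + (√(c / a))⁻¹) * μ + (√(c / a) - (√(c / a))⁻¹) * ν) = 1 := by
        rw [Real.sqrt_mul ha.le, Real.sqrt_div hc.le]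
        field_simp
        rw [hsc, hsa]
        ring
      have key' := congrArg (fun x : ℝ => (x : ℂ)) key
      push_cast at key'
      ext i
      fin_cases i
      · simp only [matPhi, ← hμ, ← hν, hs, neg_zero, e0]
        simp
        linear_combination key'
      · simp only [matPhi, ← hμ, ← hν, hs, neg_zero, e0]
        simp
        linear_combination key'
    rw [e] at h
    exact h
  · intro κ hκ
    rw [isBigO_pi]
    intro i
    simp only [happ]
    exact ((isBigO_matMod_node ha hac Λ hκ 0 i).add
      (isBigO_matMod_node ha hac Λ hκ 1 i)).const_mul_left s

/-- The denominator of the first entry of the vector model solution. -/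
noncomputable def thetaDouble (c a : ℝ) (b : ℂ) : ℂ :=
  theta (2 * b) (Complex.I * ((2 * tauIm c a : ℝ) : ℂ))

/-- The companion of `thetaDouble`, shifted by half a period. -/
noncomputable def thetaDoubleShift (c a : ℝ) (b : ℂ) : ℂ :=
  theta (1 / 2 - 2 * b) (Complex.I * ((2 * tauIm c a : ℝ) : ℂ))

theorem two_tauIm_pos (ha : 0 < a) (hac : a < c) : 0 < 2 * tauIm c a := by
  have := tauIm_pos ha hac
  positivity

theorem continuous_thetaDouble (ha : 0 < a) (hac : a < c) : Continuous (thetaDouble c a) :=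
  (differentiable_theta (two_tauIm_pos ha hac)).continuous.comp (by fun_prop)

theorem continuous_thetaDoubleShift (ha : 0 < a) (hac : a < c) :
    Continuous (thetaDoubleShift c a) :=
  (differentiable_theta (two_tauIm_pos ha hac)).continuous.comp (by fun_prop)

theorem differentiable_thetaDouble (ha : 0 < a) (hac : a < c) :
    Differentiable ℂ (thetaDouble c a) :=
  (differentiable_theta (two_tauIm_pos ha hac)).comp (by fun_prop)

theorem differentiable_thetaDoubleShift (ha : 0 < a) (hac : a < c) :
    Differentiable ℂ (thetaDoubleShift c a) :=
  (differentiable_theta (two_tauIm_pos ha hac)).comp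
    (f := fun b => 1 / 2 - 2 * b) (by fun_prop)

theorem thetaDouble_neg (b : ℂ) : thetaDouble c a (-b) = thetaDouble c a b := by
  rw [thetaDouble, mul_neg, theta_neg, thetaDouble]

theorem thetaDoubleShift_neg (b : ℂ) : thetaDoubleShift c a (-b) = thetaDoubleShift c a b := by
  rw [thetaDoubleShift, thetaDoubleShift, ← theta_neg_sub_half, ← theta_sub_half]
  congr 1
  ring

theorem thetaDouble_add_half (b : ℂ) : thetaDouble c a (b + 1 / 2) = thetaDouble c a b := by
  rw [thetaDouble, show 2 * (b + 1 / 2) = 2 * b + 1 by ring, theta_add_one, thetaDouble]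

theorem thetaDoubleShift_add_half (b : ℂ) :
    thetaDoubleShift c a (b + 1 / 2) = thetaDoubleShift c a b := by
  rw [thetaDoubleShift, ← theta_add_one, thetaDoubleShift]
  congr 1
  ring

/-- The shift by 1/2 makes the two multipliers differ by exp(πi), so only the square of the ratio is
free of jumps. -/
theorem thetaDouble_ratio_sub_tau (b : ℂ) :
    thetaDouble c a (b - Complex.I * tauIm c a) / thetaDoubleShift c a (b - Complex.I * tauIm c a) =
      -(thetaDouble c a b / thetaDoubleShift c a b) := by
  have h1 : thetaDouble c a (b - Complex.I * tauIm c a) =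
      theta (-(2 * b) + Complex.I * ((2 * tauIm c a : ℝ) : ℂ))
        (Complex.I * ((2 * tauIm c a : ℝ) : ℂ)) := by
    rw [thetaDouble, ← theta_neg]
    congr 1
    push_cast
    ring
  have h2 : thetaDoubleShift c a (b - Complex.I * tauIm c a) =
      theta (1 / 2 - 2 * b + Complex.I * ((2 * tauIm c a : ℝ) : ℂ))
        (Complex.I * ((2 * tauIm c a : ℝ) : ℂ)) := by
    rw [thetaDoubleShift]
    congr 1
    push_cast
    ring
  rw [h1, h2, theta_add_tau, theta_add_tau, mul_div_mul_comm, ← Complex.exp_sub, theta_neg]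
  have h3 : -Real.pi * Complex.I * (Complex.I * ((2 * tauIm c a : ℝ) : ℂ) + 2 * -(2 * b)) -
      -Real.pi * Complex.I * (Complex.I * ((2 * tauIm c a : ℝ) : ℂ) + 2 * (1 / 2 - 2 * b)) =
        Real.pi * Complex.I := by ring
  rw [h3, Complex.exp_pi_mul_I, thetaDouble, thetaDoubleShift]
  ring

theorem thetaDouble_abelRed_ne_zero (ha : 0 < a) (hac : a < c) {k : ℂ} (hk : k ∈ cutPlane c) :
    thetaDouble c a (abelRed c a k) ≠ 0 := by
  apply theta_ne_zero_of_abs_im_lt (two_tauIm_pos ha hac)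
  have := abs_im_abelRed_lt ha hac hk
  simp [abs_mul]
  linarith

theorem thetaDoubleShift_abelRed_ne_zero (ha : 0 < a) (hac : a < c) {k : ℂ}
    (hk : k ∈ cutPlane c) : thetaDoubleShift c a (abelRed c a k) ≠ 0 := by
  apply theta_ne_zero_of_abs_im_lt (two_tauIm_pos ha hac)
  have := abs_im_abelRed_lt ha hac hk
  simp [abs_mul]
  linarith

theorem thetaDouble_abelRight_ne_zero (ha : 0 < a) (hac : a < c) {y : ℝ} (h1 : |y| ≤ c)
    (h2 : |y| ≠ a) : thetaDouble c a (abelRight c a y) ≠ 0 := by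
  rcases lt_or_ge |y| a with h3 | h3
  · apply theta_ne_zero_of_abs_re_lt (two_tauIm_pos ha hac)
    have := abs_re_abelRight_gap ha hac h3
    simp [abs_mul]
    linarith
  · replace h3 := lt_of_le_of_ne h3 h2.symm
    apply theta_ne_zero_of_abs_im_lt (two_tauIm_pos ha hac)
    have : |(abelRight c a y).im| < tauIm c a / 2 := by
      rcases abs_cases y with ⟨h4, -⟩ | ⟨h4, -⟩
      · rw [h4] at h3 h1
        exact im_abelRight_band ha hac h3 h1
      · rw [h4] at h3 h1
        rw [← im_abelRight_neg ha hac]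
        exact im_abelRight_band ha hac h3 h1
    simp [abs_mul]
    linarith

theorem thetaDoubleShift_abelRight_ne_zero (ha : 0 < a) (hac : a < c) {y : ℝ} (h1 : |y| ≤ c)
    (h0 : y ≠ 0) : thetaDoubleShift c a (abelRight c a y) ≠ 0 := by
  apply theta_half_sub_ne_zero (two_tauIm_pos ha hac)
  · have := abs_re_abelRight_le ha hac h1
    simp [abs_mul]
    linarith
  · simpa using re_abelRight_ne_zero ha hac h1 h0

/-- At ia the limit of 2B is -(1/2 + τ), minus the zero 1/2 + (2τ)/2 of θ₃(·|2τ). -/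
theorem thetaDouble_abelRight_a (ha : 0 < a) (hac : a < c) :
    thetaDouble c a (abelRight c a a) = 0 := by
  have h1 : abelRight c a a = -((1 / 2 + Complex.I * ((2 * tauIm c a : ℝ) : ℂ) / 2) / 2) := by
    apply Complex.ext
    · rw [re_abelRight_band ha hac le_rfl hac.le]
      simp
      norm_num
    · rw [im_abelRight_gap ha hac (abs_of_pos ha).le]
      simp
  rw [h1, thetaDouble_neg, thetaDouble, mul_div_cancel₀ _ two_ne_zero, theta_half_eq_zero]

/-- The even function without jumps that measures the vanishing of `thetaDouble`. -/
noncomputable def thetaRatioSq (c a : ℝ) (b : ℂ) : ℂ :=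
  (thetaDouble c a b / thetaDoubleShift c a b) ^ 2

theorem thetaRatioSq_neg (b : ℂ) : thetaRatioSq c a (-b) = thetaRatioSq c a b := by
  rw [thetaRatioSq, thetaDouble_neg, thetaDoubleShift_neg, thetaRatioSq]

theorem continuousAt_thetaRatioSq (ha : 0 < a) (hac : a < c) {b : ℂ}
    (hb : thetaDoubleShift c a b ≠ 0) : ContinuousAt (thetaRatioSq c a) b :=
  ((continuous_thetaDouble ha hac).continuousAt.div
    (continuous_thetaDoubleShift ha hac).continuousAt hb).pow 2

theorem thetaRatioSq_abelRight (ha : 0 < a) (hac : a < c) {y : ℝ} (h : |y| ≤ c) :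
    thetaRatioSq c a (abelRight c a y) = thetaRatioSq c a (-abelRight c a (-y)) := by
  have hhalf : ∀ b : ℂ, thetaRatioSq c a (b + 1 / 2) = thetaRatioSq c a b := fun b => by
    rw [thetaRatioSq, thetaDouble_add_half, thetaDoubleShift_add_half, thetaRatioSq]
  obtain ⟨h1, h2⟩ := abs_le.1 h
  rcases le_or_gt |y| a with h3 | h3
  · rw [abelRight_gap ha hac h3, thetaRatioSq, thetaDouble_ratio_sub_tau, neg_sq, thetaRatioSq]
  · rcases lt_abs.1 h3 with h4 | h4
    · rw [abelRight_upper ha hac h4.le h2, ← hhalf, ← thetaRatioSq_neg]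
      congr 1
      ring
    · have e := hhalf (- -abelRight c a (-y))
      rw [thetaRatioSq_neg] at e
      rw [abelRight_lower ha hac (y := y) h4.le (by linarith), ← e]
      congr 1
      ring

theorem hasBoundaryValues_comp_abelRed (ha : 0 < a) (hac : a < c) {y : ℝ} {f : ℂ → ℂ}
    (h1 : ContinuousAt f (abelRight c a y)) (h2 : ContinuousAt f (-abelRight c a (-y))) :
    HasBoundaryValues (fun k => f (abelRed c a k)) y (f (abelRight c a y))
      (f (-abelRight c a (-y))) :=
  ⟨h1.tendsto.comp (tendsto_abelRed_right ha hac y),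
    h2.tendsto.comp (tendsto_abelRed_left ha hac y)⟩

theorem isBigO_id_thetaDoubleShift (ha : 0 < a) (hac : a < c) :
    (fun k : ℂ => k) =O[𝓝[{k | 0 < k.re}] 0] fun k => thetaDoubleShift c a (abelRed c a k) := by
  have h0 : Tendsto (fun k => 1 / 2 - 2 * abelRed c a k) (𝓝[{k : ℂ | 0 < k.re}] 0)
      (𝓝 (1 / 2 + Complex.I * ((2 * tauIm c a : ℝ) : ℂ) / 2)) := by
    have := ((tendsto_abelRed_right ha hac 0).const_mul 2).const_sub (1 / 2)
    rw [abelRight_zero ha hac, Complex.ofReal_zero, mul_zero] at this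
    convert this using 2
    push_cast
    ring
  refine ((isBigO_sub_abelRight_zero ha hac).trans ?_).trans
    ((isBigO_sub_theta_half (two_tauIm_pos ha hac)).comp_tendsto h0)
  refine ((isBigO_refl _ _).const_mul_left (-(1 / 2))).congr_left fun k => ?_
  rw [abelRight_zero ha hac, Function.comp_apply]
  push_cast
  ring

theorem isBigO_thetaRatioSq_zero (ha : 0 < a) (hac : a < c) :
    (fun k => thetaRatioSq c a (abelRed c a k) * k ^ 2) =O[𝓝[cutPlane c] 0]
      fun _ => (1 : ℝ) := by
  have hright : (fun k => thetaRatioSq c a (abelRed c a k) * k ^ 2) =O[𝓝[{k | 0 < k.re}] 0]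
      fun _ => (1 : ℝ) := by
    have hb := tendsto_abelRed_right ha hac 0
    rw [Complex.ofReal_zero, mul_zero] at hb
    have h1 := (((continuous_thetaDouble ha hac).tendsto _).comp hb).isBigO_one ℝ
    have h2 := isBigO_id_thetaDoubleShift ha hac
    have h3 : (fun k => k / thetaDoubleShift c a (abelRed c a k)) =O[𝓝[{k | 0 < k.re}] 0]
        fun _ => (1 : ℝ) := by
      have h4 : (fun k => thetaDoubleShift c a (abelRed c a k) /
          thetaDoubleShift c a (abelRed c a k)) =O[𝓝[{k | 0 < k.re}] 0] fun _ => (1 : ℝ) := by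
        refine IsBigO.of_bound 1 (Eventually.of_forall fun k => ?_)
        rw [norm_div, norm_one, one_mul]
        exact div_self_le_one _
      refine IsBigO.trans ?_ h4
      exact (h2.mul (isBigO_refl (fun k => (thetaDoubleShift c a (abelRed c a k))⁻¹) _))
    refine ((h1.mul h3).pow 2).congr (fun k => ?_) fun k => by norm_num
    simp only [thetaRatioSq, Function.comp_apply]
    ring
  have hleft : (fun k => thetaRatioSq c a (abelRed c a k) * k ^ 2) =O[𝓝[{k | k.re < 0}] 0]
      fun _ => (1 : ℝ) := by
    have h := tendsto_neg_left 0
    simp only [neg_zero, Complex.ofReal_zero, mul_zero] at h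
    refine (hright.comp_tendsto h).congr_left fun k => ?_
    simp only [Function.comp_apply, abelRed_neg, thetaRatioSq_neg, neg_sq]
  have hc := ha.trans hac
  have hsub : 𝓝[cutPlane c] (0 : ℂ) ≤ 𝓝[{k | 0 < k.re} ∪ {k | k.re < 0}] 0 := by
    refine nhdsWithin_le_iff.2 ?_
    have hball : Metric.ball (0 : ℂ) c ∈ 𝓝[cutPlane c] (0 : ℂ) :=
      nhdsWithin_le_nhds (Metric.ball_mem_nhds _ hc)
    filter_upwards [hball, self_mem_nhdsWithin] with k hk hkc
    rcases lt_trichotomy k.re 0 with h | h | h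
    · exact Or.inr h
    · exact absurd ⟨h, (Complex.abs_im_le_norm k).trans (by simpa using (mem_ball_zero_iff.1 hk).le)⟩
        hkc
    · exact Or.inl h
  refine IsBigO.mono ?_ hsub
  rw [nhdsWithin_union]
  exact hright.sup hleft

/-- The factor k² cancels the possible double pole at the origin, and subtracting rk², with r the
value at infinity, leaves o(k²). The constant is found at ia, where the numerator vanishes. The
order of vanishing at ±ia then follows without expanding B at a branch point. -/
theorem exists_thetaRatioSq_eq (ha : 0 < a) (hac : a < c) :
    ∃ r : ℂ, r ≠ 0 ∧ ∀ k ∈ cutPlane c,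
      thetaRatioSq c a (abelRed c a k) * k ^ 2 = r * (k ^ 2 + (a : ℂ) ^ 2) := by
  have hc := ha.trans hac
  have ht := two_tauIm_pos ha hac
  set r : ℂ := thetaRatioSq c a 0 with hr
  have hs0 : thetaDoubleShift c a 0 ≠ 0 := by
    apply theta_ne_zero_of_abs_im_lt ht
    simpa using tauIm_pos ha hac
  have hd0 : thetaDouble c a 0 ≠ 0 := by
    apply theta_ne_zero_of_abs_im_lt ht
    simpa using tauIm_pos ha hac
  have hr0 : r ≠ 0 := pow_ne_zero 2 (div_ne_zero hd0 hs0)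
  have hreg : ∀ {y : ℝ}, |y| ≤ c → y ≠ 0 →
      ContinuousAt (thetaRatioSq c a) (abelRight c a y) ∧
      ContinuousAt (thetaRatioSq c a) (-abelRight c a (-y)) := by
    intro y h1 h2
    refine ⟨continuousAt_thetaRatioSq ha hac (thetaDoubleShift_abelRight_ne_zero ha hac h1 h2),
      continuousAt_thetaRatioSq ha hac ?_⟩
    rw [thetaDoubleShift_neg]
    exact thetaDoubleShift_abelRight_ne_zero ha hac (by rwa [abs_neg]) (neg_ne_zero.2 h2)
  have hsq : ∀ (p : ℂ) (y : ℝ), HasBoundaryValues (fun k : ℂ => p * k ^ 2) y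
      (p * (Complex.I * y) ^ 2) (p * (Complex.I * y) ^ 2) := by
    intro p y
    have h : Continuous fun k : ℂ => p * k ^ 2 := by fun_prop
    exact ⟨(h.tendsto _).mono_left nhdsWithin_le_nhds, (h.tendsto _).mono_left nhdsWithin_le_nhds⟩
  have hbv : ∀ {y : ℝ}, |y| ≤ c → y ≠ 0 →
      HasBoundaryValues (fun k => thetaRatioSq c a (abelRed c a k) * (1 * k ^ 2) - r * k ^ 2) y
        (thetaRatioSq c a (abelRight c a y) * (1 * (Complex.I * y) ^ 2) - r * (Complex.I * y) ^ 2)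
        (thetaRatioSq c a (-abelRight c a (-y)) * (1 * (Complex.I * y) ^ 2) -
          r * (Complex.I * y) ^ 2) := by
    intro y h1 h2
    have h3 := hasBoundaryValues_comp_abelRed ha hac (hreg h1 h2).1 (hreg h1 h2).2
    exact ⟨(h3.1.mul (hsq 1 y).1).sub (hsq r y).1, (h3.2.mul (hsq 1 y).2).sub (hsq r y).2⟩
  -- The origin joins the exceptional heights: there only boundedness is known, not a limit.
  obtain ⟨C, hC⟩ := exists_eq_const (S := insert 0 (nodeHeights c a))
    (f := fun k => thetaRatioSq c a (abelRed c a k) * (1 * k ^ 2) - r * k ^ 2)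
    (by
      refine DifferentiableOn.sub (DifferentiableOn.mul ?_ (by fun_prop)) (by fun_prop)
      intro k hk
      have hb := (differentiableOn_abelRed ha hac).differentiableAt
        ((isOpen_cutPlane c).mem_nhds hk)
      have h1 := (differentiable_thetaDouble ha hac (abelRed c a k)).comp k hb
      have h2 := (differentiable_thetaDoubleShift ha hac (abelRed c a k)).comp k hb
      exact ((h1.div h2 (thetaDoubleShift_abelRed_ne_zero ha hac hk)).pow 2).differentiableWithinAt)
    (fun k _ => by rw [abelRed_neg, thetaRatioSq_neg, neg_sq])
    ((finite_nodeHeights c a).insert 0) (by simp [nodeHeights]) (by simp [nodeHeights])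
    (by
      intro y h1 h2
      have hy0 : y ≠ 0 := fun h => h2 (by simp [h])
      have h3 := hbv h1.le hy0
      rw [← thetaRatioSq_abelRight ha hac h1.le] at h3
      exact ⟨_, h3⟩)
    (by
      intro y hy
      have hyc : |y| ≤ c := by
        rcases hy with rfl | hy
        · simpa using hc.le
        · rcases abs_of_mem_nodeHeights ha hac hy with h | h <;> rw [h]
          exact hac.le
      refine IsBigO.trans (g := fun _ => (1 : ℝ)) ?_
        (isBigO_one_norm_rpow_neg (I_mul_notMem_cutPlane hyc) (by norm_num))
      have hq : ∀ p : ℂ, (fun k : ℂ => p * k ^ 2) =O[𝓝[cutPlane c] (Complex.I * y)]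
          fun _ => (1 : ℝ) := by
        intro p
        have h : Continuous fun k : ℂ => p * k ^ 2 := by fun_prop
        exact (h.continuousAt.isBigO_one ℝ).mono nhdsWithin_le_nhds
      refine IsBigO.sub ?_ (hq r)
      by_cases hy0 : y = 0
      · subst hy0
        simpa using isBigO_thetaRatioSq_zero ha hac
      · exact ((isBigO_comp_abelRed_node ha hac (hreg hyc hy0).1 (hreg hyc hy0).2).mul
          (hq 1)).congr_right fun k => mul_one _)
    (by
      have h1 := ((continuousAt_thetaRatioSq ha hac hs0).tendsto.comp
        (tendsto_abelRed_cocompact ha hac)).sub_const r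
      rw [← hr, sub_self] at h1
      have h2 := ((isLittleO_one_iff ℂ).2 h1).mul_isBigO
        (isBigO_refl (fun k : ℂ => k ^ 2) (cocompact ℂ))
      refine h2.congr (fun k => ?_) fun k => one_mul _
      simp only [Function.comp_apply]
      ring)
  have hCa : C = r * (a : ℂ) ^ 2 := by
    have h := (hbv (y := a) (by rw [abs_of_pos ha]; exact hac.le) ha.ne').1
    have := nhdsWithin_right_neBot a
    have h2 := tendsto_nhds_unique (tendsto_const_nhds.congr' (by
      filter_upwards [self_mem_nhdsWithin] with k hk
      exact (hC k (cutPlane_right_subset hk)).symm)) h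
    rw [h2, thetaRatioSq, thetaDouble_abelRight_a ha hac]
    linear_combination -r * (a : ℂ) ^ 2 * Complex.I_sq
  refine ⟨r, hr0, fun k hk => ?_⟩
  have := hC k hk
  simp only [hCa] at this
  linear_combination this

/-- The denominator `thetaDouble` vanishes at most like a square root at the inner nodes. -/
theorem isBigO_inv_thetaDouble (ha : 0 < a) (hac : a < c) {y : ℝ} (hy : |y| = a) :
    (fun k => (thetaDouble c a (abelRed c a k))⁻¹) =O[𝓝[cutPlane c] (Complex.I * y)]
      fun k => ‖k - Complex.I * y‖ ^ (-(1 / 2) : ℝ) := by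
  obtain ⟨r, hr, h⟩ := exists_thetaRatioSq_eq ha hac
  have hy0 : y ≠ 0 := by
    rintro rfl
    simp at hy
    linarith
  have hyc : |y| ≤ c := by rw [hy]; exact hac.le
  -- With D and S the double theta functions, D⁻² = r⁻¹k² S⁻² (k² + a²)⁻¹, and S stays away from
  -- zero at the inner nodes.
  refine IsBigO.of_pow (n := 2) two_ne_zero ?_
  have hS := isBigO_comp_abelRed_node ha hac (y := y)
    (f := fun b => (thetaDoubleShift c a b)⁻¹)
    ((continuous_thetaDoubleShift ha hac).continuousAt.inv₀
      (thetaDoubleShift_abelRight_ne_zero ha hac hyc hy0))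
    ((continuous_thetaDoubleShift ha hac).continuousAt.inv₀ (by
      rw [thetaDoubleShift_neg]
      exact thetaDoubleShift_abelRight_ne_zero ha hac (by rwa [abs_neg]) (neg_ne_zero.2 hy0)))
  have hk2 : (fun k : ℂ => r⁻¹ * k ^ 2) =O[𝓝[cutPlane c] (Complex.I * y)] fun _ => (1 : ℝ) := by
    have h : Continuous fun k : ℂ => r⁻¹ * k ^ 2 := by fun_prop
    exact (h.continuousAt.isBigO_one ℝ).mono nhdsWithin_le_nhds
  have hN := (isBigO_norm_sq_add_sq_rpow (r := -1) ha hy).mono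
    (nhdsWithin_le_nhds (s := cutPlane c))
  have hN' : (fun k : ℂ => (k ^ 2 + (a : ℂ) ^ 2)⁻¹) =O[𝓝[cutPlane c] (Complex.I * y)]
      fun k => ‖k - Complex.I * y‖ ^ (-1 : ℝ) := by
    rw [← isBigO_norm_left]
    refine hN.congr_left fun k => ?_
    rw [norm_inv, Real.rpow_neg_one]
  refine (((hk2.mul (hS.pow 2)).mul hN')).congr' ?_ (Eventually.of_forall fun k => ?_)
  · filter_upwards [self_mem_nhdsWithin] with k hk
    have e := h k hk
    have h1 := thetaDouble_abelRed_ne_zero ha hac hk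
    have h2 := thetaDoubleShift_abelRed_ne_zero ha hac hk
    have h3 := sq_add_a_sq_ne_zero ha hac (cutPlane_subset_bandPlane (a := a) hk)
    rw [thetaRatioSq] at e
    simp only [Pi.pow_apply]
    field_simp
    field_simp at e
    linear_combination e
  · simp only [one_pow, one_mul, Pi.pow_apply]
    rw [← Real.rpow_natCast, ← Real.rpow_mul (norm_nonneg _)]
    norm_num

end VectorModel

/-! ### m^mod solves the vector problem -/

section VectorModel

variable {c a : ℝ}

/-- The theta quotient that enters the vector model solution. -/
noncomputable def thetaQuotDouble (c a Λ : ℝ) (b : ℂ) : ℂ := thetaQuot (2 * tauIm c a) Λ (2 * b)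

theorem two_mul_tau (ha : 0 < a) (hac : a < c) :
    2 * tau c a = Complex.I * ((2 * tauIm c a : ℝ) : ℂ) := by
  rw [tau_eq ha hac]
  push_cast
  ring

theorem alphaHat_eq (ha : 0 < a) (hac : a < c) (Λ : ℝ) (b : ℂ) :
    alphaHat c a Λ (1 / 4 + b) = thetaQuotDouble c a Λ b := by
  rw [alphaHat, two_mul_tau ha hac, thetaQuotDouble, thetaQuot]
  congr 2 <;> ring

theorem betaHat_eq (ha : 0 < a) (hac : a < c) (Λ : ℝ) (b : ℂ) :
    betaHat c a Λ (1 / 4 + b) = thetaQuotDouble c a Λ (-b) := by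
  rw [betaHat, two_mul_tau ha hac, thetaQuotDouble, thetaQuot]
  congr 2 <;> ring

theorem vecMod_eq (ha : 0 < a) (hac : a < c) (Λ : ℝ) (k : ℂ) :
    vecMod c a Λ k =
      ![gammaTilde c a k * (thetaQuotDouble c a Λ (abelRed c a k) / thetaQuotDouble c a Λ 0),
        gammaTilde c a k * (thetaQuotDouble c a Λ (-abelRed c a k) / thetaQuotDouble c a Λ 0)] := by
  have h1 : alphaHat c a Λ (1 / 4) = thetaQuotDouble c a Λ 0 := by
    rw [← alphaHat_eq ha hac, add_zero]
  have h2 : betaHat c a Λ (1 / 4) = thetaQuotDouble c a Λ 0 := by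
    rw [← neg_zero, ← betaHat_eq ha hac, add_zero]
  rw [vecMod, abelInfty_eq ha hac, abel_eq_abelRed ha hac, alphaHat_eq ha hac, betaHat_eq ha hac,
    h1, h2]

theorem thetaQuotDouble_zero_ne_zero (ha : 0 < a) (hac : a < c) (Λ : ℝ) :
    thetaQuotDouble c a Λ 0 ≠ 0 := by
  have ht := two_tauIm_pos ha hac
  refine div_ne_zero ?_ ?_
  · apply theta_ne_zero_of_abs_im_lt ht
    have : (lamTilde Λ).im = 0 := Complex.ofReal_im _
    simpa [this] using tauIm_pos ha hac
  · apply theta_ne_zero_of_abs_im_lt ht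
    simpa using tauIm_pos ha hac

theorem differentiableAt_thetaQuotDouble (ha : 0 < a) (hac : a < c) (Λ : ℝ) {b : ℂ}
    (hb : thetaDouble c a b ≠ 0) :
    DifferentiableAt ℂ (thetaQuotDouble c a Λ) b ∧
      DifferentiableAt ℂ (fun b => thetaQuotDouble c a Λ (-b)) b := by
  have key : ∀ {b : ℂ}, thetaDouble c a b ≠ 0 →
      DifferentiableAt ℂ (thetaQuotDouble c a Λ) b := by
    intro b hb
    have h : DifferentiableAt ℂ (thetaQuot (2 * tauIm c a) Λ) (2 * b) :=
      differentiableAt_thetaQuot (two_tauIm_pos ha hac) Λ hb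
    exact h.comp b (differentiableAt_id.const_mul 2)
  refine ⟨key hb, ?_⟩
  have h : DifferentiableAt ℂ (thetaQuotDouble c a Λ) (-b) := key (by rwa [thetaDouble_neg])
  exact h.comp b differentiableAt_id.neg

theorem thetaQuotDouble_add_half (Λ : ℝ) (b : ℂ) :
    thetaQuotDouble c a Λ (b + 1 / 2) = thetaQuotDouble c a Λ b := by
  rw [thetaQuotDouble, show 2 * (b + 1 / 2) = 2 * b + 1 by ring, thetaQuot_add_one, thetaQuotDouble]

theorem thetaQuotDouble_sub_tau (Λ : ℝ) (b : ℂ) :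
    thetaQuotDouble c a Λ (b - Complex.I * tauIm c a) =
      Complex.exp (-(Complex.I * Λ)) * thetaQuotDouble c a Λ b := by
  rw [thetaQuotDouble, show 2 * (b - Complex.I * tauIm c a) =
    2 * b - Complex.I * ((2 * tauIm c a : ℝ) : ℂ) by push_cast; ring, thetaQuot_sub_tau,
    thetaQuotDouble]

theorem thetaQuotDouble_add_tau (Λ : ℝ) (b : ℂ) :
    thetaQuotDouble c a Λ (b + Complex.I * tauIm c a) =
      Complex.exp (Complex.I * Λ) * thetaQuotDouble c a Λ b := by
  rw [thetaQuotDouble, show 2 * (b + Complex.I * tauIm c a) =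
    2 * b + Complex.I * ((2 * tauIm c a : ℝ) : ℂ) by push_cast; ring, thetaQuot_add_tau,
    thetaQuotDouble]

/-- The vector model solution in terms of the values of `γ̃` and of the Abel map. -/
noncomputable def vecPhi (c a Λ : ℝ) (g b : ℂ) : Fin 2 → ℂ :=
  ![g * (thetaQuotDouble c a Λ b / thetaQuotDouble c a Λ 0),
    g * (thetaQuotDouble c a Λ (-b) / thetaQuotDouble c a Λ 0)]

theorem vecPhi_neg (Λ : ℝ) (g b : ℂ) :
    vecPhi c a Λ g (-b) = Matrix.vecMul (vecPhi c a Λ g b) sigma1 := by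
  ext i
  fin_cases i <;> simp [vecPhi, sigma1, Matrix.vecMul, dotProduct, Fin.sum_univ_two]

theorem vecPhi_upper (Λ : ℝ) (g b : ℂ) :
    vecPhi c a Λ (Complex.I * g) (-(1 / 2) - b) =
      Matrix.vecMul (vecPhi c a Λ g b) !![0, Complex.I; Complex.I, 0] := by
  have h1 : thetaQuotDouble c a Λ (-(1 / 2) - b) = thetaQuotDouble c a Λ (-b) := by
    rw [← thetaQuotDouble_add_half]
    congr 1
    ring
  have h2 : thetaQuotDouble c a Λ (-(-(1 / 2) - b)) = thetaQuotDouble c a Λ b := by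
    rw [← thetaQuotDouble_add_half Λ b]
    congr 1
    ring
  rw [vecPhi, vecPhi, h1, h2]
  ext i
  fin_cases i <;> simp [Matrix.vecMul, dotProduct, Fin.sum_univ_two] <;> ring

theorem vecPhi_lower (Λ : ℝ) (g b : ℂ) :
    vecPhi c a Λ (-Complex.I * g) (1 / 2 - b) =
      Matrix.vecMul (vecPhi c a Λ g b) !![0, -Complex.I; -Complex.I, 0] := by
  have h1 : thetaQuotDouble c a Λ (1 / 2 - b) = thetaQuotDouble c a Λ (-b) := by
    rw [← thetaQuotDouble_add_half Λ (-b)]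
    congr 1
    ring
  have h2 : thetaQuotDouble c a Λ (-(1 / 2 - b)) = thetaQuotDouble c a Λ b := by
    rw [← thetaQuotDouble_add_half]
    congr 1
    ring
  rw [vecPhi, vecPhi, h1, h2]
  ext i
  fin_cases i <;> simp [Matrix.vecMul, dotProduct, Fin.sum_univ_two] <;> ring

theorem vecPhi_gap (Λ : ℝ) (g b : ℂ) :
    vecPhi c a Λ g (b - Complex.I * tauIm c a) = Matrix.vecMul (vecPhi c a Λ g b)
      !![Complex.exp (-(Complex.I * Λ)), 0; 0, Complex.exp (Complex.I * Λ)] := by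
  rw [vecPhi, vecPhi, neg_sub', sub_neg_eq_add, thetaQuotDouble_sub_tau, thetaQuotDouble_add_tau]
  ext i
  fin_cases i <;> simp [Matrix.vecMul, dotProduct, Fin.sum_univ_two] <;> ring

theorem vecMod_eq_vecPhi (ha : 0 < a) (hac : a < c) (Λ : ℝ) (k : ℂ) :
    vecMod c a Λ k = vecPhi c a Λ (gammaTilde c a k) (abelRed c a k) :=
  vecMod_eq ha hac Λ k

theorem vecMod_symm (ha : 0 < a) (hac : a < c) (Λ : ℝ) (k : ℂ) :
    vecMod c a Λ (-k) = Matrix.vecMul (vecMod c a Λ k) sigma1 := by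
  rw [vecMod_eq_vecPhi ha hac, vecMod_eq_vecPhi ha hac, gammaTilde_neg, abelRed_neg, vecPhi_neg]

theorem tendsto_vecMod_right (ha : 0 < a) (hac : a < c) (Λ : ℝ) {y : ℝ} (h1 : |y| < c)
    (h2 : |y| ≠ a) :
    Tendsto (vecMod c a Λ) (𝓝[{k | 0 < k.re}] (Complex.I * y))
      (𝓝 (vecPhi c a Λ (gammaRight c a y) (abelRight c a y))) := by
  have hg := tendsto_gammaTilde_right ha hac h2 h1.ne
  have hb := tendsto_abelRed_right ha hac y
  obtain ⟨q1, q2⟩ := differentiableAt_thetaQuotDouble ha hac Λ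
    (thetaDouble_abelRight_ne_zero ha hac h1.le h2)
  rw [tendsto_pi_nhds]
  intro i
  simp only [vecMod_eq_vecPhi ha hac, vecPhi]
  fin_cases i
  · exact hg.mul ((q1.continuousAt.tendsto.comp hb).div_const _)
  · exact hg.mul ((q2.continuousAt.tendsto.comp hb).div_const _)

theorem tendsto_vecMod_left (ha : 0 < a) (hac : a < c) (Λ : ℝ) {y : ℝ} (h1 : |y| < c)
    (h2 : |y| ≠ a) :
    Tendsto (vecMod c a Λ) (𝓝[{k | k.re < 0}] (Complex.I * y))
      (𝓝 (vecPhi c a Λ (gammaRight c a (-y)) (-abelRight c a (-y)))) := by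
  have h := (tendsto_vecMod_right ha hac Λ (y := -y) (by rwa [abs_neg]) (by rwa [abs_neg])).comp
    (tendsto_neg_left y)
  have h3 : Continuous fun X : Fin 2 → ℂ => Matrix.vecMul X sigma1 := by fun_prop
  have h4 := (h3.tendsto _).comp h
  rw [← vecPhi_neg] at h4
  refine h4.congr fun k => ?_
  simp only [Function.comp_apply]
  rw [← vecMod_symm ha hac, neg_neg]

theorem gammaRight_lower (ha : 0 < a) {y : ℝ} (h1 : a < -y) (h2 : -y < c) :
    gammaRight c a y = -Complex.I * gammaRight c a (-y) := by
  have := gammaRight_upper ha h1 h2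
  rw [neg_neg] at this
  rw [this, ← mul_assoc, neg_mul, Complex.I_mul_I]
  ring

/-- At ±ia the order is 1/4 from γ̃ plus -1/2 from the denominator; at ±ic it is -1/4 from γ̃ alone,
the theta quotient being bounded. -/
theorem isBigO_vecMod_node (ha : 0 < a) (hac : a < c) (Λ : ℝ) {y : ℝ} (hy : |y| = a ∨ |y| = c) :
    vecMod c a Λ =O[𝓝[cutPlane c] (Complex.I * y)]
      fun k => ‖k - Complex.I * y‖ ^ (-(1 / 4) : ℝ) := by
  have key : ∀ f : ℂ → ℂ,
      ((fun k => gammaTilde c a k * f k) =O[𝓝[cutPlane c] (Complex.I * y)]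
        fun k => ‖k - Complex.I * y‖ ^ (-(1 / 4) : ℝ)) →
      (fun k => gammaTilde c a k * (f k / thetaQuotDouble c a Λ 0)) =O[𝓝[cutPlane c]
        (Complex.I * y)] fun k => ‖k - Complex.I * y‖ ^ (-(1 / 4) : ℝ) := by
    intro f hf
    refine (hf.const_mul_left (thetaQuotDouble c a Λ 0)⁻¹).congr_left fun k => ?_
    ring
  have hred : ((fun k => gammaTilde c a k * thetaQuotDouble c a Λ (abelRed c a k))
        =O[𝓝[cutPlane c] (Complex.I * y)] fun k => ‖k - Complex.I * y‖ ^ (-(1 / 4) : ℝ)) →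
      ((fun k => gammaTilde c a k * thetaQuotDouble c a Λ (-abelRed c a k))
        =O[𝓝[cutPlane c] (Complex.I * y)] fun k => ‖k - Complex.I * y‖ ^ (-(1 / 4) : ℝ)) →
      vecMod c a Λ =O[𝓝[cutPlane c] (Complex.I * y)]
        fun k => ‖k - Complex.I * y‖ ^ (-(1 / 4) : ℝ) := by
    intro h1 h2
    rw [isBigO_pi]
    intro i
    simp only [vecMod_eq ha hac]
    fin_cases i
    · exact key _ h1
    · exact key _ h2
  rcases hy with hy | hy
  · have hnum : ∀ s : ℂ, (fun k => theta (s * abelRed c a k - lamTilde Λ)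
        (Complex.I * ((2 * tauIm c a : ℝ) : ℂ))) =O[𝓝[cutPlane c] (Complex.I * y)]
        fun _ => (1 : ℝ) := by
      intro s
      have h : Continuous fun b => theta (s * b - lamTilde Λ)
          (Complex.I * ((2 * tauIm c a : ℝ) : ℂ)) :=
        (differentiable_theta (two_tauIm_pos ha hac)).continuous.comp
          (f := fun b => s * b - lamTilde Λ) (by fun_prop)
      exact isBigO_comp_abelRed_node ha hac h.continuousAt h.continuousAt
    have hden := isBigO_inv_thetaDouble ha hac hy
    have hg := (isBigO_gammaTilde_inner ha hac hy).mono (nhdsWithin_le_nhds (s := cutPlane c))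
    have hpow : ∀ᶠ k in 𝓝[cutPlane c] (Complex.I * y), ‖k - Complex.I * y‖ ^ (1 / 4 : ℝ) *
        (1 * ‖k - Complex.I * y‖ ^ (-(1 / 2) : ℝ)) = ‖k - Complex.I * y‖ ^ (-(1 / 4) : ℝ) := by
      refine Eventually.of_forall fun k => ?_
      rw [one_mul, ← Real.rpow_add' (norm_nonneg _) (by norm_num)]
      norm_num
    apply hred
    · refine (hg.mul ((hnum 2).mul hden)).congr' (Eventually.of_forall fun k => ?_) hpow
      simp only [thetaQuotDouble, thetaQuot, thetaDouble, div_eq_mul_inv]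
    · refine (hg.mul ((hnum (-2)).mul hden)).congr' (Eventually.of_forall fun k => ?_) hpow
      simp only [thetaQuotDouble, thetaQuot, thetaDouble, div_eq_mul_inv, mul_neg, neg_mul,
        theta_neg]
  · have hyc : |y| ≤ c := hy.le
    have hya : |y| ≠ a := by rw [hy]; exact hac.ne'
    obtain ⟨q1, q2⟩ := differentiableAt_thetaQuotDouble ha hac Λ
      (thetaDouble_abelRight_ne_zero ha hac hyc hya)
    obtain ⟨r1, r2⟩ := differentiableAt_thetaQuotDouble (b := -abelRight c a (-y)) ha hac Λ (by
      rw [thetaDouble_neg]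
      exact thetaDouble_abelRight_ne_zero ha hac (by rwa [abs_neg]) (by rwa [abs_neg]))
    have hg := isBigO_gammaTilde_node ha hac (Or.inr hy)
    apply hred
    · exact (hg.mul (isBigO_comp_abelRed_node ha hac q1.continuousAt
        r1.continuousAt)).congr_right fun k => mul_one _
    · exact (hg.mul (isBigO_comp_abelRed_node ha hac q2.continuousAt
        r2.continuousAt)).congr_right fun k => mul_one _

theorem isVectorModelSolution_vecMod (ha : 0 < a) (hac : a < c) (Λ : ℝ) :
    IsVectorModelSolution c a Λ (vecMod c a Λ) where
  holomorphic := by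
    rw [differentiableOn_pi]
    intro i k hk
    have hg := differentiableAt_gammaTilde ha hac (cutPlane_subset_bandPlane (a := a) hk)
    have hb := (differentiableOn_abelRed ha hac).differentiableAt
      ((isOpen_cutPlane c).mem_nhds hk)
    obtain ⟨q1, q2⟩ := differentiableAt_thetaQuotDouble ha hac Λ
      (thetaDouble_abelRed_ne_zero ha hac hk)
    apply DifferentiableAt.differentiableWithinAt
    simp only [vecMod_eq ha hac]
    fin_cases i
    · exact hg.mul ((q1.comp k hb).div_const _)
    · exact hg.mul ((q2.comp k hb).div_const _)
  jump y h1 h2 := by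
    refine ⟨_, _, ⟨tendsto_vecMod_right ha hac Λ h1 h2, tendsto_vecMod_left ha hac Λ h1 h2⟩, ?_⟩
    obtain ⟨h3, h4⟩ := abs_lt.1 h1
    unfold vMod
    split_ifs with h5 h6
    · rw [gammaRight_upper ha h5 h4, abelRight_upper ha hac h5.le h4.le, vecPhi_upper]
    · rw [gammaRight_lower ha (y := y) (by linarith) (by linarith),
        abelRight_lower ha hac (y := y) (by linarith) (by linarith), vecPhi_lower]
    · have h7 : |y| < a := lt_of_le_of_ne (abs_le.2 ⟨by linarith, by linarith⟩) h2
      rw [gammaRight_gap h7, abelRight_gap ha hac h7.le, vecPhi_gap]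
  symmetric k _ := vecMod_symm ha hac Λ k
  normalized := by
    have hq := thetaQuotDouble_zero_ne_zero ha hac Λ
    have hg := tendsto_gammaTilde_cocompact c a
    have hb := tendsto_abelRed_cocompact ha hac
    have hd : thetaDouble c a 0 ≠ 0 := by
      apply theta_ne_zero_of_abs_im_lt (two_tauIm_pos ha hac)
      simpa using tauIm_pos ha hac
    obtain ⟨q1, q2⟩ := differentiableAt_thetaQuotDouble ha hac Λ hd
    rw [tendsto_pi_nhds]
    intro i
    simp only [vecMod_eq ha hac]
    fin_cases i
    · have := hg.mul ((q1.continuousAt.tendsto.comp hb).div_const (thetaQuotDouble c a Λ 0))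
      rwa [div_self hq, mul_one] at this
    · have := hg.mul ((q2.continuousAt.tendsto.comp hb).div_const (thetaQuotDouble c a Λ 0))
      rwa [neg_zero, div_self hq, mul_one] at this
  singular κ hκ := by
    obtain ⟨y, hy, rfl⟩ := (mem_nodes_iff ha hac).1 hκ
    exact isBigO_vecMod_node ha hac Λ hy

end VectorModel

/-! ### A lower bound for Im τ, uniform in ξ -/

section BandEdge

variable {c a ξ ε : ℝ}

/-- By the inequality of means |w| ≤ (c² - a²)/2 on the band, so over the length c - a the primitive
gains at least 2/(c + a) ≥ 1/c. -/
theorem inv_le_periodL (ha : 0 < a) (hac : a < c) : 1 / c ≤ periodL c a := by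
  have hc := ha.trans hac
  have h := (convex_Icc a c).mul_sub_le_image_sub_of_le_deriv
    (f := fun y : ℝ => (abelExt c a (Complex.I * y)).re) (C := 2 / (c ^ 2 - a ^ 2))
    (continuous_re_abelExt ha hac).continuousOn
    (by
      intro x hx
      rw [interior_Icc] at hx
      exact (band_hasDerivAt ha hac hx.1 hx.2).1.differentiableAt.differentiableWithinAt)
    (by
      intro x hx
      rw [interior_Icc] at hx
      rw [(band_hasDerivAt ha hac hx.1 hx.2).1.deriv]
      have hpos := bandRoot_pos ha hx.1 hx.2
      have h1 : 0 < c ^ 2 - a ^ 2 := by nlinarith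
      rw [div_le_div_iff₀ h1 hpos]
      have h2 : bandRoot c a x ≤ (c ^ 2 - a ^ 2) / 2 := by
        rw [bandRoot, Real.sqrt_le_left (by positivity)]
        nlinarith [sq_nonneg (c ^ 2 + a ^ 2 - 2 * x ^ 2)]
      linarith)
    a ⟨le_rfl, hac.le⟩ c ⟨hac.le, le_rfl⟩ hac.le
  simp only [re_abelExt_outer ha hac le_rfl] at h
  refine le_trans ?_ (h.trans_eq (by rw [periodL]; ring))
  have h1 : 2 / (c ^ 2 - a ^ 2) * (c - a) = 2 / (c + a) := by
    have : c - a ≠ 0 := by linarith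
    have : c + a ≠ 0 := by linarith
    rw [show c ^ 2 - a ^ 2 = (c + a) * (c - a) by ring]
    field_simp
  rw [h1, div_le_div_iff₀ hc (by linarith)]
  linarith

/-- Replacing c² - y² by c² - a² in the integrand gives an upper bound with primitive
arcsin(y/a)/√(c² - a²). -/
theorem periodK_le (ha : 0 < a) (hac : a < c) :
    periodK c a ≤ Real.pi / 2 / √(c ^ 2 - a ^ 2) := by
  have hca : 0 < c ^ 2 - a ^ 2 := by nlinarith
  have hs : 0 < √(c ^ 2 - a ^ 2) := by positivity
  have hm : MonotoneOn (fun y : ℝ => Real.arcsin (y / a) / √(c ^ 2 - a ^ 2) -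
      (abelExt c a (Complex.I * y)).im) (Set.Icc 0 a) := by
    have hd : ∀ y ∈ Set.Ioo 0 a, HasDerivAt (fun y : ℝ => Real.arcsin (y / a) / √(c ^ 2 - a ^ 2) -
        (abelExt c a (Complex.I * y)).im)
        (1 / √(1 - (y / a) ^ 2) * (1 / a) / √(c ^ 2 - a ^ 2) - 1 / gapRoot c a y) y := by
      intro y hy
      have h1 : y / a < 1 := (div_lt_one ha).2 hy.2
      have h0 : 0 < y / a := div_pos hy.1 ha
      have h2 := (Real.hasDerivAt_arcsin (x := y / a) (by linarith) h1.ne).comp y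
        ((hasDerivAt_id y).div_const a)
      exact (h2.div_const _).sub (gap_hasDerivAt ha hac (abs_lt.2 ⟨by linarith [hy.1], hy.2⟩)).2
    apply monotoneOn_of_deriv_nonneg (convex_Icc 0 a)
    · apply Continuous.continuousOn
      have h1 : Continuous fun y : ℝ => Real.arcsin (y / a) :=
        Real.continuous_arcsin.comp (by fun_prop)
      exact (h1.div_const _).sub (continuous_im_abelExt ha hac)
    · intro y hy
      rw [interior_Icc] at hy
      exact (hd y hy).differentiableAt.differentiableWithinAt
    · intro y hy
      rw [interior_Icc] at hy
      rw [(hd y hy).deriv, sub_nonneg]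
      have hay : 0 < a ^ 2 - y ^ 2 := by nlinarith [hy.1, hy.2]
      have hcy : 0 < c ^ 2 - y ^ 2 := by nlinarith [hy.1, hy.2]
      have h1 : √(1 - (y / a) ^ 2) = √(a ^ 2 - y ^ 2) / a := by
        rw [show 1 - (y / a) ^ 2 = (a ^ 2 - y ^ 2) / a ^ 2 by field_simp,
          Real.sqrt_div hay.le, Real.sqrt_sq ha.le]
      have h2 : gapRoot c a y = √(c ^ 2 - y ^ 2) * √(a ^ 2 - y ^ 2) := by
        have h3 : √(c ^ 2 - y ^ 2) ≠ 0 := by positivity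
        rw [gapRoot, Real.sqrt_div hay.le]
        nth_rw 1 [← Real.sq_sqrt hcy.le]
        field_simp
      have h4 : √(c ^ 2 - a ^ 2) ≤ √(c ^ 2 - y ^ 2) := Real.sqrt_le_sqrt (by linarith)
      have h5 : 0 < √(a ^ 2 - y ^ 2) := by positivity
      have h6 : 1 / √(1 - (y / a) ^ 2) * (1 / a) / √(c ^ 2 - a ^ 2) =
          1 / (√(c ^ 2 - a ^ 2) * √(a ^ 2 - y ^ 2)) := by
        rw [h1]
        field_simp
      rw [h6, h2]
      apply one_div_le_one_div_of_le (by positivity)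
      exact mul_le_mul_of_nonneg_right h4 h5.le
  have h := hm ⟨le_rfl, ha.le⟩ ⟨ha.le, le_rfl⟩ ha.le
  simp only [zero_div, Real.arcsin_zero, im_abelExt_zero ha hac, div_self ha.ne',
    Real.arcsin_one] at h
  rw [periodK]
  linarith

theorem le_tauIm (ha : 0 < a) (hac : a < c) :
    √(c ^ 2 - a ^ 2) / (c * Real.pi) ≤ tauIm c a := by
  have hc := ha.trans hac
  have hca : 0 < c ^ 2 - a ^ 2 := by nlinarith
  have hs : 0 < √(c ^ 2 - a ^ 2) := by positivity
  have hK := periodK_pos ha hac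
  have h1 := periodK_le ha hac
  have h2 := inv_le_periodL ha hac
  have hpi := Real.pi_pos
  rw [tauIm, div_le_div_iff₀ (by positivity) (by positivity)]
  rw [div_le_iff₀ hc] at h2
  rw [le_div_iff₀ hs] at h1
  nlinarith

theorem integral_inv_sub (ha : 0 ≤ a) (hac : a < c) :
    ∫ s in (0 : ℝ)..a, (c - s)⁻¹ = Real.log (c / (c - a)) := by
  rw [intervalIntegral.integral_comp_sub_left (fun x => x⁻¹), sub_zero,
    integral_inv_of_pos (by linarith) (by linarith)]

/-- Trades the logarithm in the band edge estimate for a square root, so that an explicit gap can be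
written down. -/
theorem mul_log_div_le {x : ℝ} (hx : 0 < x) (hc : 0 < c) : x * Real.log (c / x) ≤ 2 * √(c * x) := by
  have h1 : Real.log (c / x) ≤ 2 * √(c / x) := by
    have h2 := Real.log_le_sub_one_of_pos (x := √(c / x)) (by positivity)
    rw [Real.log_sqrt (by positivity)] at h2
    linarith
  have h3 : x * √(c / x) = √(c * x) := by
    rw [Real.sqrt_div hc.le, Real.sqrt_mul hc.le]
    have : √x ≠ 0 := by positivity
    field_simp
    rw [Real.sq_sqrt hx.le]
  nlinarith

/-- The band edge equation, with the square root replaced by one at a controlled cost. -/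
theorem IsBandEdge.estimate (h : IsBandEdge c ξ a) (h1 : -(c ^ 2 / 2) ≤ ξ) (h2 : ξ ≤ c ^ 2 / 3 - ε) :
    a * ε ≤ a * (5 / 6 * (c ^ 2 - a ^ 2)) + 4 * c ^ 2 * ((c - a) * Real.log (c / (c - a))) := by
  obtain ⟨ha, hac, hI⟩ := h
  have hc := ha.trans hac
  set p : ℝ → ℝ := fun s => -s ^ 2 + ξ + (c ^ 2 - a ^ 2) / 2 with hp
  have hpoly : ∫ s in (0 : ℝ)..a, p s = -(a ^ 3 / 3) + a * (ξ + (c ^ 2 - a ^ 2) / 2) := by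
    have : ∀ s : ℝ, HasDerivAt (fun s => -(s ^ 3 / 3) + s * (ξ + (c ^ 2 - a ^ 2) / 2)) (p s) s := by
      intro s
      have h3 := (((hasDerivAt_id s).pow 3).div_const 3).neg.add
        ((hasDerivAt_id s).mul_const (ξ + (c ^ 2 - a ^ 2) / 2))
      refine h3.congr_deriv ?_
      simp [hp]
      ring
    rw [intervalIntegral.integral_eq_sub_of_hasDerivAt (fun s _ => this s)
      (Continuous.intervalIntegrable (by fun_prop) _ _)]
    ring
  have hden : ∀ s ∈ Set.uIcc 0 a, c - s ≠ 0 := by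
    intro s hs
    rw [Set.uIcc_of_le ha.le] at hs
    linarith [hs.2]
  have hcontr : ContinuousOn (fun s : ℝ => √((a ^ 2 - s ^ 2) / (c ^ 2 - s ^ 2))) (Set.uIcc 0 a) := by
    apply ContinuousOn.sqrt
    apply ContinuousOn.div (by fun_prop) (by fun_prop)
    intro s hs
    rw [Set.uIcc_of_le ha.le] at hs
    have : s ^ 2 < c ^ 2 := by nlinarith [hs.1, hs.2]
    linarith
  have hint1 : IntervalIntegrable (fun s => p s * √((a ^ 2 - s ^ 2) / (c ^ 2 - s ^ 2)))
      MeasureTheory.volume 0 a :=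
    ContinuousOn.intervalIntegrable (ContinuousOn.mul (by fun_prop) hcontr)
  have hint2 : IntervalIntegrable p MeasureTheory.volume 0 a :=
    Continuous.intervalIntegrable (by fun_prop) _ _
  have hint3 : IntervalIntegrable (fun s => 4 * c ^ 2 * (c - a) * (c - s)⁻¹)
      MeasureTheory.volume 0 a :=
    ContinuousOn.intervalIntegrable (continuousOn_const.mul
      (ContinuousOn.inv₀ (by fun_prop) hden))
  -- With q the quotient under the root, 1 - √q ≤ 1 - q ≤ 2(c - a)/(c - s), and -p ≤ 2c².
  have hle : ∫ s in (0 : ℝ)..a, p s * √((a ^ 2 - s ^ 2) / (c ^ 2 - s ^ 2)) ≤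
      ∫ s in (0 : ℝ)..a, (p s + 4 * c ^ 2 * (c - a) * (c - s)⁻¹) := by
    apply intervalIntegral.integral_mono_on ha.le hint1 (hint2.add hint3)
    intro s hs
    have hcs : 0 < c - s := by linarith [hs.2]
    have hs2 : 0 ≤ a ^ 2 - s ^ 2 := by nlinarith [hs.1, hs.2]
    have hcs2 : 0 < c ^ 2 - s ^ 2 := by nlinarith [hs.1, hs.2]
    have hca2 : 0 < c ^ 2 - a ^ 2 := by nlinarith
    set q := (a ^ 2 - s ^ 2) / (c ^ 2 - s ^ 2) with hq
    have hq0 : 0 ≤ q := by positivity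
    have hq1 : q ≤ 1 := by
      rw [hq, div_le_one hcs2]
      linarith
    have hr1 : √q ≤ 1 := Real.sqrt_le_one.2 hq1
    have hrq : q ≤ √q := by
      have := Real.sq_sqrt hq0
      nlinarith [Real.sqrt_nonneg q]
    have hq2 : 1 - q ≤ 2 * (c - a) * (c - s)⁻¹ := by
      have e : 1 - q = (c - a) * (c + a) / ((c - s) * (c + s)) := by
        rw [hq, show (c - s) * (c + s) = c ^ 2 - s ^ 2 by ring]
        field_simp
        ring
      rw [e, ← div_eq_mul_inv, div_le_div_iff₀ (by nlinarith [hs.1]) hcs]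
      have h5 : 0 < (c - a) * (c - s) := mul_pos (by linarith) hcs
      have h6 : 0 ≤ c - a + 2 * s := by linarith [hs.1]
      nlinarith [mul_nonneg h5.le h6]
    have hp1 : -(2 * c ^ 2) ≤ p s := by
      have : s ^ 2 ≤ a ^ 2 := by linarith
      simp only [hp]
      nlinarith
    have h7 : (1 - √q) * (-p s) ≤ (1 - √q) * (2 * c ^ 2) :=
      mul_le_mul_of_nonneg_left (by linarith) (by linarith)
    have h8 : (1 - √q) * (2 * c ^ 2) ≤ 2 * (c - a) * (c - s)⁻¹ * (2 * c ^ 2) :=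
      mul_le_mul_of_nonneg_right (by linarith) (by positivity)
    linarith
  rw [hI, intervalIntegral.integral_add hint2 hint3, hpoly,
    intervalIntegral.integral_const_mul, integral_inv_sub ha.le hac] at hle
  -- ∫p = a(ξ + c²/2 - 5a²/6), and 1/3 + 1/2 = 5/6: this is where the end point c²/3 of the interval
  -- enters.
  have h9 : a * ξ ≤ a * (c ^ 2 / 3 - ε) := mul_le_mul_of_nonneg_left h2 ha.le
  nlinarith

theorem exists_band_edge_gap (hc : 0 < c) (hε : 0 < ε) :
    ∃ δ : ℝ, 0 < δ ∧ ∀ ξ ∈ Set.Icc (-(c ^ 2 / 2) + ε) (c ^ 2 / 3 - ε), ∀ a : ℝ,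
      IsBandEdge c ξ a → δ ≤ c - a := by
  -- If c - a were smaller, the first bound would give a > c/2, the second would make the polynomial
  -- term at most aε/2, and the third the logarithmic term less than cε/4 < aε/2; together they
  -- contradict the estimate.
  refine ⟨min (c / 2) (min (3 * ε / (10 * c)) (ε ^ 2 / (2048 * c ^ 3))), by positivity, ?_⟩
  intro ξ hξ a h
  by_contra! hcon
  have hest := h.estimate (by linarith [hξ.1]) hξ.2
  obtain ⟨ha, hac, -⟩ := h
  have h1 : c - a < c / 2 := hcon.trans_le (min_le_left _ _)
  have h2 : c - a < 3 * ε / (10 * c) := hcon.trans_le ((min_le_right _ _).trans (min_le_left _ _))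
  have h3 : c - a < ε ^ 2 / (2048 * c ^ 3) :=
    hcon.trans_le ((min_le_right _ _).trans (min_le_right _ _))
  have hx : 0 < c - a := by linarith
  rw [lt_div_iff₀ (by positivity)] at h2 h3
  have h4 := mul_log_div_le hx hc
  have h5 : √(c * (c - a)) < ε / (32 * c) := by
    rw [Real.sqrt_lt' (by positivity), div_pow, lt_div_iff₀ (by positivity)]
    nlinarith [sq_pos_of_pos hε]
  rw [lt_div_iff₀ (by positivity)] at h5
  have h6 : 5 / 6 * (c ^ 2 - a ^ 2) ≤ ε / 2 := by nlinarith
  have h7 : a * (5 / 6 * (c ^ 2 - a ^ 2)) ≤ a * (ε / 2) := mul_le_mul_of_nonneg_left h6 ha.le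
  have h8 : 4 * c ^ 2 * ((c - a) * Real.log (c / (c - a))) ≤ 4 * c ^ 2 * (2 * √(c * (c - a))) :=
    mul_le_mul_of_nonneg_left h4 (by positivity)
  have h9 : 4 * c ^ 2 * (2 * √(c * (c - a))) < c * ε / 4 := by nlinarith
  nlinarith

theorem exists_tauIm_lower_bound (hc : 0 < c) (hε : 0 < ε) :
    ∃ t₀ : ℝ, 0 < t₀ ∧ ∀ ξ ∈ Set.Icc (-(c ^ 2 / 2) + ε) (c ^ 2 / 3 - ε), ∀ a : ℝ,
      IsBandEdge c ξ a → t₀ ≤ tauIm c a := by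
  obtain ⟨δ, hδ, h⟩ := exists_band_edge_gap hc hε
  refine ⟨√(c * δ) / (c * Real.pi), by positivity, fun ξ hξ a ha => ?_⟩
  have h1 := h ξ hξ a ha
  refine le_trans ?_ (le_tauIm ha.1 ha.2.1)
  have h2 : c * δ ≤ c ^ 2 - a ^ 2 := by nlinarith [ha.1, ha.2.1]
  gcongr

end BandEdge

end KdVModel

/-! ### Assembly -/

open KdVModel in
theorem lemma5p1 (c ε : ℝ) (hc : 0 < c) (hε : 0 < ε) :
    ∃ C : ℝ, 0 < C ∧
      ∀ ξ ∈ Set.Icc (-(c ^ 2 / 2) + ε) (c ^ 2 / 3 - ε), ∀ a : ℝ, IsBandEdge c ξ a → ∀ Λ : ℝ,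
        -- holomorphic away from the segment
        (∀ i j, DifferentiableOn ℂ (fun k => matMod c a Λ k i j) (cutPlane c)) ∧
        -- jump condition, with boundary values at all points of the segment except the nodes
        (∀ y : ℝ, |y| < c → |y| ≠ a →
          ∃ P Q : Matrix (Fin 2) (Fin 2) ℂ,
            HasBoundaryValues (matMod c a Λ) y P Q ∧ P = Q * vMod a Λ y) ∧
        -- symmetry
        (∀ k ∈ cutPlane c, matMod c a Λ k = sigma1 * matMod c a Λ (-k) * sigma1) ∧
        -- singularities at the nodes
        (∀ κ ∈ nodes c a, ∀ i j,
          (fun k => matMod c a Λ k i j) =O[𝓝[cutPlane c] κ]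
            fun k => ‖k - κ‖ ^ (-(1 / 4) : ℝ)) ∧
        -- value of the determinant
        (∀ k ∈ cutPlane c, (matMod c a Λ k).det =
          4 * (theta (tau c a / 2 - lamTilde Λ) (tau c a) *
              theta (-(tau c a / 2) - lamTilde Λ) (tau c a)) /
            theta (tau c a / 2) (tau c a) ^ 2) ∧
        -- zeros of the determinant
        (∀ k ∈ cutPlane c,
          (matMod c a Λ k).det = 0 ↔ ∃ n : ℤ, Λ = Real.pi * (2 * n + 1)) ∧
        -- the values at infinity, and the formula for the vector model solution
        ∃ μ ν : ℝ,
          Tendsto (mu c a Λ) (cocompact ℂ) (𝓝 (μ : ℂ)) ∧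
          Tendsto (nu c a Λ) (cocompact ℂ) (𝓝 (ν : ℂ)) ∧
          C ≤ μ ∧ C ≤ ν ∧
          Set.EqOn (vecMod c a Λ) (rowMod c a Λ μ ν) (cutPlane c) ∧
          ∀ m : ℂ → Fin 2 → ℂ,
            IsVectorModelSolution c a Λ m ↔ Set.EqOn m (rowMod c a Λ μ ν) (cutPlane c) := by
  obtain ⟨t₀, ht₀, hτ⟩ := exists_tauIm_lower_bound hc hε
  obtain ⟨C, hC, hθ⟩ := exists_theta_real_ratio_lower_bound ht₀
  refine ⟨C, hC, fun ξ hξ a hedge Λ => ?_⟩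
  have ht := hτ ξ hξ a hedge
  obtain ⟨ha, hac, -⟩ := hedge
  refine ⟨differentiableOn_matMod ha hac Λ, fun y h1 h2 => matMod_jump ha hac Λ h1 h2,
    fun k _ => by rw [← matMod_symm ha hac, neg_neg],
    fun κ hκ i j => isBigO_matMod_node ha hac Λ hκ i j,
    fun k hk => det_matMod ha hac Λ hk, fun k hk => det_matMod_eq_zero_iff ha hac Λ hk, ?_⟩
  -- B(∞) = 0, so μ(∞) and ν(∞) are the theta quotients at the real points 0 and -1/2.
  have hval : ∀ y : ℝ, ∃ r : ℝ, C ≤ r ∧ thetaQuot (tauIm c a) Λ y = r := by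
    intro y
    obtain ⟨-, r, hr, h⟩ := hθ _ ht (y - Λ / (2 * Real.pi)) y
    refine ⟨r, hr, ?_⟩
    rw [← h, thetaQuot, lamTilde, Complex.ofReal_sub]
  obtain ⟨μ, hμC, hμ⟩ := hval 0
  obtain ⟨ν, hνC, hν⟩ := hval (-(1 / 2))
  push_cast at hμ hν
  have hrow : IsVectorModelSolution c a Λ (rowMod c a Λ μ ν) :=
    IsVectorModelSolution.of_rowMod ha hac hμ.symm hν.symm (hC.trans_le hμC) (hC.trans_le hνC)
  -- Both vectors solve the problem, so uniqueness supplies the formula that relates them.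
  refine ⟨μ, ν, hμ ▸ tendsto_mu_cocompact ha hac Λ, hν ▸ tendsto_nu_cocompact ha hac Λ, hμC, hνC,
    (isVectorModelSolution_vecMod ha hac Λ).unique ha hac hrow, fun m => ?_⟩
  exact ⟨fun hm => hm.unique ha hac hrow, fun h => hrow.congr h⟩
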